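/- Let $K$ be a totally real number field with ring of integers $\mathcal O$, different $\partial$ and real embeddings $\varphi_1,\dots,\varphi_d$ ($d=[K:\mathbb Q]$); let $n>1$ and $k$ be integers. "Fractional ideal" means nonzero fractional ideal, and $\alpha\gg0$ means that $\alpha$ is totally positive. Let $\mathcal H_n$ be the set of symmetric $X+iY\in\mathbb C^{n,n}$ with $X,Y$ real and $Y>0$. A matrix $M=\begin{pmatrix}A&B\\C&D\end{pmatrix}$ over $K$ (in $n\times n$ blocks) with $A\,{}^tB$, $C\,{}^tD$ symmetric and $A\,{}^tD-B\,{}^tC=uI$, $u\gg0$, acts on functions $f:\mathcal H_n^d\to\mathbb C$ by $$f|M(\tau)=\det N(A\,{}^tD-B\,{}^tC)^{k/2}\,\det N(C\tau+D)^{-k}\,f\big((A\tau+B)(C\tau+D)^{-1}\big),$$ where on $\tau=(\tau_1,\dots,\tau_d)$ the expression is read embedding by embedding and $\det N$ is the product of the determinants at the $d$ embeddings. For fractional ideals $\mathcal I_1,\dots,\mathcal I_n,\mathcal J$ let $\Gamma(\mathcal I_1,\dots,\mathcal I_n;\mathcal J)$ be the group of such $M$ for which $u$ is a (totally positive) unit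 of $\mathcal O$ and $$a_{ij}\in\mathcal I_i\mathcal I_j^{-1},\quad b_{ij}\in\mathcal I_i\mathcal I_j\mathcal J\partial^{-1},\quad c_{ij}\in(\mathcal I_i\mathcal I_j\mathcal J)^{-1}\partial,\quad d_{ij}\in\mathcal I_i^{-1}\mathcal I_j .$$ Let $\mathcal M_k(\Gamma)$ be the space of $f:\mathcal H_n^d\to\mathbb C$ with $f|M=f$ for all $M\in\Gamma$ that have an (unconditionally convergent) expansion $f(\tau)=\sum_T c(T)\exp\big(\pi i\sum_{m}\operatorname{trace}(\varphi_m(T)\tau_m)\big)$ for all $\tau\in\mathcal H_n^d$, where $T$ runs over the symmetric $n\times n$ matrices over $K$ that are positive semi-definite at every real embedding. Consider the following maps on $\mathcal M_k(\Gamma(\mathcal I_1,\dots,\mathcal I_n;\mathcal J))$. * $U_\ell(\alpha)$, for $\alpha\in K^\times$, $1\le\ell\le n$: $f\mapsto f|\begin{pmatrix}X&\\&{}^tX^{-1}\end{pmatrix}$ with $X$ diagonal, $\alpha^{-1}$ in place $\ell$ and $1$ elsewhere; it replaces $\mathcal I_\ell$ by $\alpha\mathcal I_\ell$. * $W(\alpha)$,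 for $\alpha\gg0$: $f\mapsto f|\begin{pmatrix}\alpha^{-1}I&\\&I\end{pmatrix}$; it replaces $\mathcal J$ by $\alpha\mathcal J$. * $V_\ell(\mathcal Q)$, for a fractional ideal $\mathcal Q$, $1\le\ell<n$: $f\mapsto f|\begin{pmatrix}X&\\&{}^tX^{-1}\end{pmatrix}$ with $X$ the identity except for a block of determinant $1$ in rows and columns $\ell,\ell+1$, taken from $\begin{pmatrix}\mathcal Q^{-1}&\mathcal Q\mathcal I_\ell\mathcal I_{\ell+1}^{-1}\\\mathcal Q^{-1}\mathcal I_\ell^{-1}\mathcal I_{\ell+1}&\mathcal Q\end{pmatrix}$; it replaces $\mathcal I_\ell,\mathcal I_{\ell+1}$ by $\mathcal Q\mathcal I_\ell,\mathcal Q^{-1}\mathcal I_{\ell+1}$. * $S_\ell(\mathcal Q)$, for a fractional ideal $\mathcal Q$, $1\le\ell\le n$: $f\mapsto f|M$, where $M$ is $\begin{pmatrix}a&b\\c&d\end{pmatrix}\in\begin{pmatrix}\mathcal Q&\mathcal Q^{-1}\mathcal I_\ell^2\mathcal J\partial^{-1}\\\mathcal Q\mathcal I_\ell^{-2}\mathcal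 J^{-1}\partial&\mathcal Q^{-1}\end{pmatrix}$, $ad-bc=1$, in rows and columns $\ell,n+\ell$ and the identity elsewhere; it replaces $\mathcal I_\ell$ by $\mathcal Q^{-1}\mathcal I_\ell$. The product space $\mathcal M_k=\prod_{\mathcal I_1,\dots,\mathcal I_n,\mathcal J}\mathcal M_k(\Gamma(\mathcal I_1,\dots,\mathcal I_n;\mathcal J))/\sim$ is taken over all fractional ideals, forms being identified by $f\sim f|U_\ell(\alpha)$, $f\sim f|W(\alpha)$, $f\sim f|V_\ell(\mathcal Q)$; thus an element $F$ of $\mathcal M_k$ is a family of forms, one in each space, compatible with all these maps. For any set $\mathfrak J$ of fractional ideals let $\mathcal M_k^{\mathfrak J}$ be the same space built only from the $\mathcal J\in\mathfrak J$, so that $\mathcal M_k$ is the case in which $\mathfrak J$ consists of all fractional ideals. For a fractional ideal $\mathcal Q$, $F|S(\mathcal Q)$ is the family obtained by applying $S_\ell(\mathcal Q)$ (for any $\ell$ and any choice of the matrices) to the members of $F$. **Proposition 3.2.** For every $\mathfrak J$ (in particular for $\mathcal M_k$ itself), $$\mathcal M_k^{\mathfrak J}=\bigoplus_\chi\mathcal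 M_k^{\mathfrak J}(\chi),\qquad \mathcal M_k^{\mathfrak J}(\chi)=\{F\in\mathcal M_k^{\mathfrak J}:\ F|S(\mathcal Q)=\chi(\mathcal Q)F\text{ for all fractional ideals }\mathcal Q\},$$ where $\chi$ runs over all characters of the ideal class group of $K$ with values in $\mathbb C^\times$. -/

import Mathlib

open scoped nonZeroDivisors NumberField Matrix

noncomputable section

namespace HilbertSiegel

/-- Nonzero fractional ideals of the number field `K`, as a group. -/
abbrev Idl (K : Type*) [Field K] [NumberField K] : Type _ := (FractionalIdeal (𝓞 K)⁰ K)ˣ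

/-- The principal fractional ideal `α𝓞`, for `α ∈ Kˣ`. -/
abbrev principal {K : Type*} [Field K] [NumberField K] (α : Kˣ) : Idl K :=
  toPrincipalIdeal (𝓞 K) K α

/-- The different `∂` of `K` over `ℚ`, as a fractional ideal. -/
def different (K : Type*) [Field K] [NumberField K] : FractionalIdeal (𝓞 K)⁰ K :=
  (differentIdeal ℤ (𝓞 K) : FractionalIdeal (𝓞 K)⁰ K)

/-- `α ≫ 0`: the image of `α` under every real embedding is positive. -/
def TotPos {K : Type*} [Field K] (α : K) : Prop := ∀ φ : K →+* ℝ, 0 < φ α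

/-! ### Siegel upper half-space -/

/-- Siegel upper half-space of degree `n`: symmetric complex matrices `X + iY`, `Y > 0`. -/
def SiegelHalfSpace (n : ℕ) : Type :=
  {τ : Matrix (Fin n) (Fin n) ℂ // τ.IsSymm ∧ (τ.map Complex.im).PosDef}

/-- The product of `d` copies of Siegel upper half-space, indexed by the real embeddings of `K`
(for `K` totally real of degree `d` there are `d` of them). -/
abbrev HalfSpaceProd (n : ℕ) (K : Type*) [Field K] : Type _ :=
  (K →+* ℝ) → SiegelHalfSpace n

/-- A matrix over `K`, sent to a complex matrix by the real embedding `φ`. -/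
def emb {n : ℕ} {K : Type*} [Field K] (φ : K →+* ℝ) (A : Matrix (Fin n) (Fin n) K) :
    Matrix (Fin n) (Fin n) ℂ :=
  A.map (fun x => ((φ x : ℝ) : ℂ))

/-! ### Symplectic similitudes with totally positive multiplier -/

/-- Matrices `(A B; C D)` over `K`, in `n × n` blocks, with `A ᵗB` and `C ᵗD` symmetric and
`A ᵗD - B ᵗC = u I` for some totally positive `u`. -/
@[ext]
structure Similitude (n : ℕ) (K : Type*) [Field K] where
  A : Matrix (Fin n) (Fin n) K
  B : Matrix (Fin n) (Fin n) K
  C : Matrix (Fin n) (Fin n) K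
  D : Matrix (Fin n) (Fin n) K
  symm_AB : (A * Bᵀ).IsSymm
  symm_CD : (C * Dᵀ).IsSymm
  exists_mult : ∃ u : K, TotPos u ∧ A * Dᵀ - B * Cᵀ = u • (1 : Matrix (Fin n) (Fin n) K)

section Action

open scoped ComplexOrder

variable {n : ℕ} {K : Type*} [Field K]

theorem rels_of_rels {A B C D : Matrix (Fin n) (Fin n) K} {u : K} (hu : u ≠ 0)
    (hAB : (A * Bᵀ).IsSymm) (hCD : (C * Dᵀ).IsSymm)
    (h : A * Dᵀ - B * Cᵀ = u • (1 : Matrix (Fin n) (Fin n) K)) :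
    Aᵀ * C = Cᵀ * A ∧ Bᵀ * D = Dᵀ * B ∧
      Dᵀ * A - Bᵀ * C = u • (1 : Matrix (Fin n) (Fin n) K) := by
  have hAB' : B * Aᵀ = A * Bᵀ := by
    have := hAB.eq
    rwa [Matrix.transpose_mul, Matrix.transpose_transpose] at this
  have hCD' : D * Cᵀ = C * Dᵀ := by
    have := hCD.eq
    rwa [Matrix.transpose_mul, Matrix.transpose_transpose] at this
  have h' : D * Aᵀ - C * Bᵀ = u • (1 : Matrix (Fin n) (Fin n) K) := by
    have := congrArg Matrix.transpose h
    simpa [Matrix.transpose_sub, Matrix.transpose_mul] using this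
  have key : Matrix.fromBlocks A B C D * (u⁻¹ • Matrix.fromBlocks Dᵀ (-Bᵀ) (-Cᵀ) Aᵀ) = 1 := by
    rw [Matrix.mul_smul, Matrix.fromBlocks_multiply, ← Matrix.fromBlocks_one,
      Matrix.fromBlocks_smul]
    congr 1
    · rw [Matrix.mul_neg, ← sub_eq_add_neg, h, smul_smul, inv_mul_cancel₀ hu, one_smul]
    · rw [Matrix.mul_neg, hAB', neg_add_cancel, smul_zero]
    · rw [Matrix.mul_neg, hCD', add_neg_cancel, smul_zero]
    · rw [Matrix.mul_neg, neg_add_eq_sub, h', smul_smul, inv_mul_cancel₀ hu, one_smul]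
  have key' := mul_eq_one_comm.mp key
  rw [Matrix.smul_mul, Matrix.fromBlocks_multiply] at key'
  have key2 : Matrix.fromBlocks (Dᵀ * A + -Bᵀ * C) (Dᵀ * B + -Bᵀ * D)
      (-Cᵀ * A + Aᵀ * C) (-Cᵀ * B + Aᵀ * D) = Matrix.fromBlocks (u • 1) 0 0 (u • 1) := by
    have := congrArg (fun M => u • M) key'
    simpa [smul_smul, hu, ← Matrix.fromBlocks_one, Matrix.fromBlocks_smul] using this
  obtain ⟨h1, h2, h3, -⟩ := Matrix.fromBlocks_inj.mp key2
  refine ⟨?_, ?_, ?_⟩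
  · rw [Matrix.neg_mul, neg_add_eq_sub, sub_eq_zero] at h3
    exact h3
  · rw [Matrix.neg_mul, ← sub_eq_add_neg, sub_eq_zero] at h2
    exact h2.symm
  · rw [Matrix.neg_mul, ← sub_eq_add_neg] at h1
    exact h1

theorem emb_mul (φ : K →+* ℝ) (A B : Matrix (Fin n) (Fin n) K) :
    emb φ (A * B) = emb φ A * emb φ B := by
  have : ∀ M : Matrix (Fin n) (Fin n) K, emb φ M = M.map (Complex.ofRealHom.comp φ) :=
    fun M => rfl
  simp only [this, Matrix.map_mul]

theorem emb_conjTranspose (φ : K →+* ℝ) (A : Matrix (Fin n) (Fin n) K) :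
    (emb φ A)ᴴ = emb φ Aᵀ := by
  ext i j
  simp [emb, Matrix.conjTranspose_apply]

theorem emb_transpose (φ : K →+* ℝ) (A : Matrix (Fin n) (Fin n) K) :
    (emb φ A)ᵀ = emb φ Aᵀ := rfl

/-- A positive definite real matrix is positive definite as a complex matrix. -/
theorem posDef_ofReal {Y : Matrix (Fin n) (Fin n) ℝ} (hY : Y.PosDef) :
    (Y.map (fun x : ℝ => (x : ℂ))).PosDef := by
  have hsymm : ∀ i j, Y i j = Y j i := fun i j => by
    have := hY.isHermitian.apply j i
    simpa using this
  refine Matrix.PosDef.of_dotProduct_mulVec_pos ?_ fun w hw => ?_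
  · ext i j
    simp [hsymm i j]
  have hre : (star w ⬝ᵥ (Y.map (fun x : ℝ => (x : ℂ)) *ᵥ w)) =
      (((fun i => (w i).re) ⬝ᵥ (Y *ᵥ fun i => (w i).re) +
        (fun i => (w i).im) ⬝ᵥ (Y *ᵥ fun i => (w i).im) : ℝ) : ℂ) := by
    apply Complex.ext
    · simp [dotProduct, Matrix.mulVec, Finset.mul_sum, Finset.sum_add_distrib]
    · simp only [dotProduct, Matrix.mulVec, Finset.mul_sum, Complex.ofReal_im, Complex.im_sum]
      have hswap := Finset.sum_comm (s := Finset.univ) (t := Finset.univ)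
        (f := fun i j : Fin n => (w i).im * (Y i j * (w j).re))
      have : ∀ i j : Fin n, (star w i * (Y.map (fun x : ℝ => (x : ℂ)) i j * w j)).im =
          (w j).im * (Y j i * (w i).re) - (w i).im * (Y i j * (w j).re) := fun i j => by
        simp [hsymm i j]
        ring
      simp only [this, Finset.sum_sub_distrib]
      rw [hswap, sub_self]
  rw [hre]
  have hnn : ∀ v : Fin n → ℝ, 0 ≤ v ⬝ᵥ (Y *ᵥ v) := fun v => by
    simpa using hY.posSemidef.dotProduct_mulVec_nonneg v
  have hpos : ∀ v : Fin n → ℝ, v ≠ 0 → 0 < v ⬝ᵥ (Y *ᵥ v) := fun v hv => by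
    simpa using hY.dotProduct_mulVec_pos hv
  rw [Complex.zero_lt_real]
  by_cases h : (fun i => (w i).re) = 0
  · have h2 : (fun i => (w i).im) ≠ 0 := fun h2 => hw <| by
      ext i
      exact Complex.ext (congrFun h i) (congrFun h2 i)
    exact add_pos_of_nonneg_of_pos (hnn _) (hpos _ h2)
  · exact add_pos_of_pos_of_nonneg (hpos _ h) (hnn _)

theorem posDef_of_ofReal {Y : Matrix (Fin n) (Fin n) ℝ}
    (hY : (Y.map (fun x : ℝ => (x : ℂ))).PosDef) : Y.PosDef := by
  refine Matrix.PosDef.of_dotProduct_mulVec_pos ?_ fun v hv => ?_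
  · ext i j
    have := hY.isHermitian.apply i j
    simpa using this
  have hv' : (fun i => (v i : ℂ)) ≠ 0 := fun h => hv <| by
    ext i
    simpa using congrFun h i
  have h := hY.dotProduct_mulVec_pos hv'
  have he : (star (fun i => (v i : ℂ)) ⬝ᵥ
      (Y.map (fun x : ℝ => (x : ℂ)) *ᵥ fun i => (v i : ℂ))) =
      ((star v ⬝ᵥ (Y *ᵥ v) : ℝ) : ℂ) := by
    simp [dotProduct, Matrix.mulVec]
  rw [he, Complex.zero_lt_real] at h
  exact h

/-- The matrix `C τ + D` at the real place `φ`. -/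
def denom (g : Similitude n K) (φ : K →+* ℝ) (τ : SiegelHalfSpace n) :
    Matrix (Fin n) (Fin n) ℂ :=
  emb φ g.C * τ.1 + emb φ g.D

/-- The matrix `A τ + B` at the real place `φ`. -/
def num (g : Similitude n K) (φ : K →+* ℝ) (τ : SiegelHalfSpace n) :
    Matrix (Fin n) (Fin n) ℂ :=
  emb φ g.A * τ.1 + emb φ g.B

theorem num_denom (g : Similitude n K) (φ : K →+* ℝ) (τ : SiegelHalfSpace n) :
    ((num g φ τ)ᵀ * denom g φ τ = (denom g φ τ)ᵀ * num g φ τ) ∧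
    ∃ u : ℝ, 0 < u ∧ (denom g φ τ)ᴴ * num g φ τ - (num g φ τ)ᴴ * denom g φ τ =
      (2 * Complex.I * u) • ((τ.1.map Complex.im).map (fun x : ℝ => (x : ℂ))) := by
  obtain ⟨u, hu, hmul⟩ := g.exists_mult
  have hu0 : u ≠ 0 := by
    rintro rfl
    simpa using hu φ
  obtain ⟨h1, h2, h3⟩ := rels_of_rels hu0 g.symm_AB g.symm_CD hmul
  have h4 : g.Aᵀ * g.D - g.Cᵀ * g.B = u • (1 : Matrix (Fin n) (Fin n) K) := by
    have := congrArg Matrix.transpose h3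
    simpa [Matrix.transpose_sub, Matrix.transpose_mul] using this
  have hsc : emb φ (u • (1 : Matrix (Fin n) (Fin n) K)) =
      ((φ u : ℝ) : ℂ) • (1 : Matrix (Fin n) (Fin n) ℂ) := by
    ext i j
    by_cases hij : i = j <;> simp [emb, hij]
  have esub : ∀ X Y : Matrix (Fin n) (Fin n) K, emb φ (X - Y) = emb φ X - emb φ Y := by
    intro X Y
    ext i j
    simp [emb]
  have e1 := congrArg (emb φ) h1
  have e2 := congrArg (emb φ) h2
  have e3 := congrArg (emb φ) h3
  have e4 := congrArg (emb φ) h4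
  rw [hsc, esub] at e3 e4
  simp only [emb_mul] at e1 e2 e3 e4
  have hτ : τ.1ᵀ = τ.1 := τ.2.1
  have hY : τ.1 - τ.1ᴴ = (2 * Complex.I) •
      ((τ.1.map Complex.im).map (fun x : ℝ => (x : ℂ))) := by
    ext i j
    have hij : τ.1 j i = τ.1 i j := congrFun (congrFun hτ i) j
    simp only [Matrix.sub_apply, Matrix.conjTranspose_apply, Matrix.smul_apply, Matrix.map_apply,
      hij, smul_eq_mul]
    apply Complex.ext <;> simp
    ring
  have e3' := eq_add_of_sub_eq e3
  have e4' := eq_add_of_sub_eq e4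
  refine ⟨?_, φ u, hu φ, ?_⟩
  · simp only [num, denom, Matrix.transpose_add, Matrix.transpose_mul, hτ, emb_transpose,
      Matrix.add_mul, Matrix.mul_add]
    have a1 : τ.1 * emb φ g.Aᵀ * (emb φ g.C * τ.1) = τ.1 * emb φ g.Cᵀ * (emb φ g.A * τ.1) := by
      calc _ = τ.1 * (emb φ g.Aᵀ * emb φ g.C) * τ.1 := by simp only [Matrix.mul_assoc]
        _ = _ := by rw [e1]; simp only [Matrix.mul_assoc]
    have a2 : τ.1 * emb φ g.Aᵀ * emb φ g.D =
        ((φ u : ℝ) : ℂ) • τ.1 + τ.1 * emb φ g.Cᵀ * emb φ g.B := by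
      rw [Matrix.mul_assoc, e4', Matrix.mul_add, Matrix.mul_smul, Matrix.mul_one,
        ← Matrix.mul_assoc]
    have a3 : emb φ g.Dᵀ * (emb φ g.A * τ.1) =
        ((φ u : ℝ) : ℂ) • τ.1 + emb φ g.Bᵀ * (emb φ g.C * τ.1) := by
      rw [← Matrix.mul_assoc, e3', Matrix.add_mul, Matrix.smul_mul, Matrix.one_mul,
        ← Matrix.mul_assoc]
    rw [a1, a2, a3, e2]
    abel
  · simp only [num, denom, Matrix.conjTranspose_add, Matrix.conjTranspose_mul, emb_conjTranspose,
      Matrix.add_mul, Matrix.mul_add]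
    have a1 : τ.1ᴴ * emb φ g.Cᵀ * (emb φ g.A * τ.1) =
        τ.1ᴴ * emb φ g.Aᵀ * (emb φ g.C * τ.1) := by
      calc _ = τ.1ᴴ * (emb φ g.Cᵀ * emb φ g.A) * τ.1 := by simp only [Matrix.mul_assoc]
        _ = _ := by rw [← e1]; simp only [Matrix.mul_assoc]
    have a2 : τ.1ᴴ * emb φ g.Aᵀ * emb φ g.D =
        ((φ u : ℝ) : ℂ) • τ.1ᴴ + τ.1ᴴ * emb φ g.Cᵀ * emb φ g.B := by
      rw [Matrix.mul_assoc, e4', Matrix.mul_add, Matrix.mul_smul, Matrix.mul_one,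
        ← Matrix.mul_assoc]
    have a3 : emb φ g.Dᵀ * (emb φ g.A * τ.1) =
        ((φ u : ℝ) : ℂ) • τ.1 + emb φ g.Bᵀ * (emb φ g.C * τ.1) := by
      rw [← Matrix.mul_assoc, e3', Matrix.add_mul, Matrix.smul_mul, Matrix.one_mul,
        ← Matrix.mul_assoc]
    rw [a1, a2, a3, e2, mul_comm (2 * Complex.I), mul_smul, ← hY, smul_sub]
    abel

theorem isUnit_denom (g : Similitude n K) (φ : K →+* ℝ) (τ : SiegelHalfSpace n) :
    IsUnit (denom g φ τ).det := by
  obtain ⟨-, u, hu, h⟩ := num_denom g φ τ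
  rw [isUnit_iff_ne_zero]
  intro hdet
  obtain ⟨w, hw, hzero⟩ := Matrix.exists_mulVec_eq_zero_iff.mpr hdet
  have hpos := (posDef_ofReal τ.2.2).dotProduct_mulVec_pos hw
  have h0 : star w ⬝ᵥ (((denom g φ τ)ᴴ * num g φ τ - (num g φ τ)ᴴ * denom g φ τ) *ᵥ w) = 0 := by
    rw [Matrix.sub_mulVec, dotProduct_sub, ← Matrix.mulVec_mulVec, ← Matrix.mulVec_mulVec, hzero,
      Matrix.mulVec_zero, dotProduct_zero, sub_zero, Matrix.dotProduct_mulVec,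
      ← Matrix.star_mulVec, hzero, star_zero, zero_dotProduct]
  rw [h, Matrix.smul_mulVec, dotProduct_smul, smul_eq_mul] at h0
  have hc : (2 * Complex.I * u : ℂ) ≠ 0 := by
    simp [hu.ne']
  exact hpos.ne' ((mul_eq_zero.mp h0).resolve_left hc)

theorem moebius_mem (g : Similitude n K) (φ : K →+* ℝ) (τ : SiegelHalfSpace n) :
    (num g φ τ * (denom g φ τ)⁻¹).IsSymm ∧
      ((num g φ τ * (denom g φ τ)⁻¹).map Complex.im).PosDef := by
  obtain ⟨hs, u, hu, h⟩ := num_denom g φ τ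
  have hQ := isUnit_denom g φ τ
  set P := num g φ τ
  set Q := denom g φ τ
  have hQ1 : Q * Q⁻¹ = 1 := Matrix.mul_nonsing_inv _ hQ
  have hQt : (Q⁻¹)ᵀ * Qᵀ = 1 := by rw [← Matrix.transpose_mul, hQ1, Matrix.transpose_one]
  have hQh : (Q⁻¹)ᴴ * Qᴴ = 1 := by
    rw [← Matrix.conjTranspose_mul, hQ1, Matrix.conjTranspose_one]
  have hsymm : (P * Q⁻¹)ᵀ = P * Q⁻¹ := by
    calc (P * Q⁻¹)ᵀ = (Q⁻¹)ᵀ * (Pᵀ * Q) * Q⁻¹ := by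
          rw [Matrix.transpose_mul, Matrix.mul_assoc, Matrix.mul_assoc, hQ1, Matrix.mul_one]
      _ = ((Q⁻¹)ᵀ * Qᵀ) * (P * Q⁻¹) := by rw [hs]; simp only [Matrix.mul_assoc]
      _ = P * Q⁻¹ := by rw [hQt, Matrix.one_mul]
  refine ⟨hsymm, posDef_of_ofReal ?_⟩
  have hdiff : P * Q⁻¹ - (P * Q⁻¹)ᴴ = (Q⁻¹)ᴴ * (Qᴴ * P - Pᴴ * Q) * Q⁻¹ := by
    rw [Matrix.mul_sub, Matrix.sub_mul, ← Matrix.mul_assoc, hQh, Matrix.one_mul,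
      Matrix.conjTranspose_mul, Matrix.mul_assoc _ (Pᴴ * Q), Matrix.mul_assoc Pᴴ, hQ1,
      Matrix.mul_one]
  have him : P * Q⁻¹ - (P * Q⁻¹)ᴴ = (2 * Complex.I) •
      (((P * Q⁻¹).map Complex.im).map (fun x : ℝ => (x : ℂ))) := by
    ext i j
    have hij : (P * Q⁻¹) j i = (P * Q⁻¹) i j := congrFun (congrFun hsymm i) j
    simp only [Matrix.sub_apply, Matrix.conjTranspose_apply, Matrix.smul_apply, Matrix.map_apply,
      hij, smul_eq_mul]
    apply Complex.ext <;> simp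
    ring
  have hfin : ((P * Q⁻¹).map Complex.im).map (fun x : ℝ => (x : ℂ)) =
      (u : ℂ) • ((Q⁻¹)ᴴ * ((τ.1.map Complex.im).map (fun x : ℝ => (x : ℂ))) * Q⁻¹) := by
    have h2 : (2 * Complex.I : ℂ) ≠ 0 := by simp
    refine smul_right_injective _ h2 ?_
    show (2 * Complex.I) • _ = (2 * Complex.I) • _
    rw [← him, hdiff, h, Matrix.mul_smul, Matrix.smul_mul, smul_smul]
  rw [hfin]
  have hinj : Function.Injective (Q⁻¹).mulVec := by
    refine Matrix.mulVec_injective_iff_isUnit.mpr ?_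
    rw [Matrix.isUnit_iff_isUnit_det]
    exact Matrix.isUnit_nonsing_inv_det _ hQ
  exact ((posDef_ofReal τ.2.2).conjTranspose_mul_mul_same hinj).smul
    (Complex.zero_lt_real.mpr hu)

/-- The action `τ ↦ (Aτ + B)(Cτ + D)⁻¹`, place by place. -/
def moebius (g : Similitude n K) (τ : HalfSpaceProd n K) : HalfSpaceProd n K :=
  fun φ => ⟨num g φ (τ φ) * (denom g φ (τ φ))⁻¹, moebius_mem g φ (τ φ)⟩

/-- The weight `k` action
`f|(A B; C D) (τ) = det(N(A ᵗD - B ᵗC))^{k/2} det(N(Cτ + D))^{-k} f((Aτ + B)(Cτ + D)⁻¹)`,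
where `N` is the product over the real embeddings of `K`. -/
def slash [Fintype (K →+* ℝ)] (k : ℤ) (f : HalfSpaceProd n K → ℂ) (g : Similitude n K) :
    HalfSpaceProd n K → ℂ :=
  fun τ =>
    (((∏ φ : K →+* ℝ, φ (g.A * g.Dᵀ - g.B * g.Cᵀ).det) ^ ((k : ℝ) / 2) : ℝ) : ℂ) *
      (∏ φ : K →+* ℝ, (denom g φ (τ φ)).det) ^ (-k) * f (moebius g τ)

/-- The similitude `(X, ᵗX⁻¹)` in diagonal blocks. -/
def levi (X : GL (Fin n) K) : Similitude n K where
  A := X.1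
  B := 0
  C := 0
  D := (X⁻¹).1ᵀ
  symm_AB := by simp [Matrix.IsSymm]
  symm_CD := by simp [Matrix.IsSymm]
  exists_mult := ⟨1, fun φ => by simp, by
    rw [Matrix.transpose_transpose, Matrix.zero_mul, sub_zero, one_smul]
    exact Units.mul_inv X⟩

/-- The similitude `(α⁻¹ I, I)` in diagonal blocks, for `α ≫ 0`. -/
def scaling (α : Kˣ) (hα : TotPos (α : K)) : Similitude n K where
  A := (α⁻¹ : Kˣ).1 • 1
  B := 0
  C := 0
  D := 1
  symm_AB := by simp [Matrix.IsSymm]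
  symm_CD := by simp [Matrix.IsSymm]
  exists_mult := ⟨(α⁻¹ : Kˣ).1, fun φ => by
    simpa using hα φ, by simp⟩

/-- The matrix which is `(a b; c d)` in the rows and columns `ℓ, n + ℓ` and the identity matrix
elsewhere. -/
def embSL (l : Fin n) (a b c d : K) (h : a * d - b * c = 1) : Similitude n K where
  A := Matrix.diagonal (Function.update 1 l a)
  B := Matrix.diagonal (Pi.single l b)
  C := Matrix.diagonal (Pi.single l c)
  D := Matrix.diagonal (Function.update 1 l d)
  symm_AB := by simp [Matrix.IsSymm]
  symm_CD := by simp [Matrix.IsSymm]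
  exists_mult := ⟨1, fun φ => by simp, by
    rw [Matrix.diagonal_transpose, Matrix.diagonal_transpose, Matrix.diagonal_mul_diagonal,
      Matrix.diagonal_mul_diagonal, Matrix.diagonal_sub, one_smul, ← Matrix.diagonal_one]
    congr 1
    ext i
    by_cases hi : i = l
    · subst hi
      simpa using h
    · simp [hi]⟩

end Action

/-! ### The groups `Γ(I₁,…,Iₙ;J)` and their modular forms -/

variable (n : ℕ) (K : Type*) [Field K] [NumberField K]

/-- The indices `(I₁,…,Iₙ;J)`, all entries being nonzero fractional ideals. -/
abbrev Label : Type _ := (Fin n → Idl K) × Idl K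

variable {n K}

/-- `Γ(I₁,…,Iₙ;J)`, as a set of similitudes; the multiplier is a totally positive unit. -/
def Gam (L : Label n K) : Set (Similitude n K) :=
  {g | (∃ u : (𝓞 K)ˣ, TotPos ((u : 𝓞 K) : K) ∧
      g.A * g.Dᵀ - g.B * g.Cᵀ = ((u : 𝓞 K) : K) • (1 : Matrix (Fin n) (Fin n) K)) ∧
    (∀ i j, g.A i j ∈ (L.1 i * (L.1 j)⁻¹ : Idl K).1) ∧
    (∀ i j, g.B i j ∈ (L.1 i * L.1 j * L.2 : Idl K).1 * (different K)⁻¹) ∧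
    (∀ i j, g.C i j ∈ ((L.1 i * L.1 j * L.2)⁻¹ : Idl K).1 * different K) ∧
    (∀ i j, g.D i j ∈ ((L.1 i)⁻¹ * L.1 j : Idl K).1)}

/-- Symmetric matrices over `K` that are positive semi-definite at every real embedding. -/
def PsdMatrix (n : ℕ) (K : Type*) [Field K] : Type _ :=
  {T : Matrix (Fin n) (Fin n) K // T.IsSymm ∧ ∀ φ : K →+* ℝ, (T.map φ).PosSemidef}

/-- `e{Tτ} = exp(πi σ(Tr(Tτ)))` with `Tr(Tτ) = ∑_φ φ(T) τ_φ` and `σ` the matrix trace. -/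
def expTrace (T : PsdMatrix n K) (τ : HalfSpaceProd n K) : ℂ :=
  Complex.exp (Real.pi * Complex.I * Matrix.trace (∑ φ : K →+* ℝ, emb φ T.1 * (τ φ).1))

/-- `f` is analytic on the product of half-spaces and at infinity: it is the sum of a convergent
Fourier series supported on positive semi-definite matrices. -/
def HasFourierExpansion (f : HalfSpaceProd n K → ℂ) : Prop :=
  ∃ c : PsdMatrix n K → ℂ, ∀ τ, HasSum (fun T => c T * expTrace T τ) (f τ)

/-- The space `M_k(Γ(I₁,…,Iₙ;J))` of Hilbert–Siegel modular forms of degree `n`, weight `k`. -/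
def modularForms (k : ℤ) (L : Label n K) : Submodule ℂ (HalfSpaceProd n K → ℂ) where
  carrier := {f | HasFourierExpansion f ∧ ∀ g ∈ Gam L, slash k f g = f}
  zero_mem' := by
    refine ⟨⟨0, fun τ => ?_⟩, fun g _ => ?_⟩
    · simp
    · funext τ
      simp [slash]
  add_mem' := by
    rintro f₁ f₂ ⟨⟨c₁, h₁⟩, h₁'⟩ ⟨⟨c₂, h₂⟩, h₂'⟩
    refine ⟨⟨c₁ + c₂, fun τ => ?_⟩, fun g hg => ?_⟩
    · simpa [add_mul] using (h₁ τ).add (h₂ τ)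
    · funext τ
      have e₁ := congrFun (h₁' g hg) τ
      have e₂ := congrFun (h₂' g hg) τ
      simp only [slash, Pi.add_apply, mul_add] at e₁ e₂ ⊢
      rw [e₁, e₂]
  smul_mem' := by
    rintro a f ⟨⟨c, h⟩, h'⟩
    refine ⟨⟨a • c, fun τ => ?_⟩, fun g hg => ?_⟩
    · simpa [mul_assoc] using (h τ).mul_left a
    · funext τ
      have e := congrFun (h' g hg) τ
      simp only [slash, Pi.smul_apply, smul_eq_mul] at e ⊢
      rw [mul_left_comm, e]

/-! ### The isomorphisms `U`, `W`, `V` and the product space -/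

/-- `Ident L g L'`: the matrix `g` gives the action `f ↦ f|g` of one of the maps `U_ℓ(α)`, `W(α)`,
`V_ℓ(Q)` from `M_k(Γ(L))` to `M_k(Γ(L'))`. -/
inductive Ident : Label n K → Similitude n K → Label n K → Prop
  /-- `U_ℓ(α)`: the matrix is `diag(1,…,α⁻¹,…,1)`, and `I_ℓ` becomes `αI_ℓ`. -/
  | U (I : Fin n → Idl K) (J : Idl K) (l : Fin n) (α : Kˣ) (X : GL (Fin n) K)
      (hX : X.1 = Matrix.diagonal (Function.update 1 l (α⁻¹ : Kˣ).1)) :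
      Ident (I, J) (levi X) (Function.update I l (principal α * I l), J)
  /-- `W(α)`, for `α ≫ 0`: `J` becomes `αJ`. -/
  | W (I : Fin n → Idl K) (J : Idl K) (α : Kˣ) (hα : TotPos (α : K)) :
      Ident (I, J) (scaling α hα) (I, principal α * J)
  /-- `V_ℓ(Q)`: the matrix `X` has determinant `1`, differs from the identity at most in the rows
  and columns `ℓ, ℓ + 1`, and has there entries in `Q⁻¹`, `Q I_ℓ I_{ℓ+1}⁻¹`, `Q⁻¹ I_ℓ⁻¹ I_{ℓ+1}`,
  `Q`; `I_ℓ` becomes `Q I_ℓ` and `I_{ℓ+1}` becomes `Q⁻¹ I_{ℓ+1}`. -/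
  | V (I : Fin n → Idl K) (J : Idl K) (l m : Fin n) (hlm : m.1 = l.1 + 1) (Q : Idl K)
      (X : GL (Fin n) K) (hdet : X.1.det = 1)
      (hX : ∀ i j, ¬ ((i = l ∨ i = m) ∧ (j = l ∨ j = m)) →
        X.1 i j = (1 : Matrix (Fin n) (Fin n) K) i j)
      (h₁₁ : X.1 l l ∈ (Q⁻¹ : Idl K).1) (h₁₂ : X.1 l m ∈ (Q * I l * (I m)⁻¹ : Idl K).1)
      (h₂₁ : X.1 m l ∈ (Q⁻¹ * (I l)⁻¹ * I m : Idl K).1) (h₂₂ : X.1 m m ∈ Q.1) :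
      Ident (I, J) (levi X)
        (Function.update (Function.update I l (Q * I l)) m (Q⁻¹ * I m), J)

/-- The product of the spaces `M_k(Γ(I₁,…,Iₙ;J))` over all fractional ideals `I₁,…,Iₙ` and all
`J` in the set `𝒥` of fractional ideals, modulo the identifications `f ∼ f|U_ℓ(α)`, `f ∼ f|W(α)`,
`f ∼ f|V_ℓ(Q)`. Each equivalence class of forms contains exactly one form in each of the spaces
that are identified with one another, so an element of the product is given by a family of forms,
one in each space, which is compatible with the identifications. -/
def productSpace (k : ℤ) (𝒥 : Set (Idl K)) :
    Submodule ℂ ((Fin n → Idl K) × 𝒥 → HalfSpaceProd n K → ℂ) where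
  carrier := {F | (∀ L, F L ∈ modularForms k (L.1, L.2.1)) ∧
    ∀ (L L' : (Fin n → Idl K) × 𝒥) (g : Similitude n K),
      Ident (L.1, L.2.1) g (L'.1, L'.2.1) → F L' = slash k (F L) g}
  zero_mem' := by
    refine ⟨fun L => Submodule.zero_mem _, fun L L' g _ => ?_⟩
    funext τ
    simp [slash]
  add_mem' := by
    rintro F₁ F₂ ⟨h₁, h₁'⟩ ⟨h₂, h₂'⟩
    refine ⟨fun L => Submodule.add_mem _ (h₁ L) (h₂ L), fun L L' g hg => ?_⟩
    rw [Pi.add_apply, h₁' L L' g hg, h₂' L L' g hg]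
    funext τ
    simp [slash, mul_add]
  smul_mem' := by
    rintro a F ⟨h, h'⟩
    refine ⟨fun L => Submodule.smul_mem _ a (h L), fun L L' g hg => ?_⟩
    rw [Pi.smul_apply, h' L L' g hg]
    funext τ
    simp [slash, mul_left_comm]

/-! ### The operators `S(Q)` and their eigenspaces -/

/-- `IsImageS k Q F G`: the family `G` is `F|S(Q)`. For each `ℓ`, each index `(I₁,…,Iₙ;J)` and each
choice of a matrix `(a b; c d)` of determinant `1` with `a ∈ Q`, `b ∈ Q⁻¹ I_ℓ² J ∂⁻¹`,
`c ∈ Q I_ℓ⁻² J⁻¹ ∂`, `d ∈ Q⁻¹`, the component of `G` at the index with `Q⁻¹ I_ℓ` in place of `I_ℓ`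
is `f|S_ℓ(Q)`, where `f` is the component of `F` at `(I₁,…,Iₙ;J)`. -/
def IsImageS (k : ℤ) {𝒥 : Set (Idl K)} (Q : Idl K)
    (F G : (Fin n → Idl K) × 𝒥 → HalfSpaceProd n K → ℂ) : Prop :=
  ∀ (l : Fin n) (I : Fin n → Idl K) (J : 𝒥) (a b c d : K) (h : a * d - b * c = 1),
    a ∈ Q.1 →
    b ∈ (Q⁻¹ * I l ^ 2 * J.1 : Idl K).1 * (different K)⁻¹ →
    c ∈ (Q * (I l ^ 2)⁻¹ * J.1⁻¹ : Idl K).1 * different K →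
    d ∈ (Q⁻¹ : Idl K).1 →
    G (Function.update I l (Q⁻¹ * I l), J) = slash k (F (I, J)) (embSL l a b c d h)

/-- `M_k(χ)`: those `F` in the product space with `F|S(Q) = χ(Q) F` for all fractional ideals `Q`,
for `χ` a character of the ideal class group. -/
def eigenspace (n : ℕ) (k : ℤ) (𝒥 : Set (Idl K)) (χ : ClassGroup (𝓞 K) →* ℂˣ) :
    Submodule ℂ (productSpace (n := n) k 𝒥) where
  carrier := {F | ∀ Q : Idl K, IsImageS k Q F.1 ((χ (ClassGroup.mk K Q) : ℂ) • F.1)}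
  zero_mem' := by
    intro Q l I J a b c d h _ _ _ _
    funext τ
    simp [slash]
  add_mem' := by
    intro F₁ F₂ h₁ h₂ Q l I J a b c d h ha hb hc hd
    have e₁ := h₁ Q l I J a b c d h ha hb hc hd
    have e₂ := h₂ Q l I J a b c d h ha hb hc hd
    funext τ
    have e₁' := congrFun e₁ τ
    have e₂' := congrFun e₂ τ
    simp only [slash, Submodule.coe_add, smul_add, Pi.add_apply, mul_add] at e₁' e₂' ⊢
    rw [e₁', e₂']
  smul_mem' := by
    intro r F h₁ Q l I J a b c d h ha hb hc hd
    have e₁ := h₁ Q l I J a b c d h ha hb hc hd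
    funext τ
    have e₁' := congrFun e₁ τ
    simp only [slash, Submodule.coe_smul, Pi.smul_apply, smul_eq_mul] at e₁' ⊢
    rw [mul_left_comm, e₁', mul_left_comm]

end HilbertSiegel

end

/-!
The similitudes `g` with unit multiplier that map the lattice
`I'₁ ⊕ … ⊕ I'ₙ ⊕ (I'₁J)⁻¹∂ ⊕ … ⊕ (I'ₙJ)⁻¹∂` into that of `(I;J)` are closed under products and
inverses: they form a groupoid on the indices with fixed `J`, with vertex groups `Γ(I₁,…,Iₙ;J)`, and
`f ↦ f|g` is an action of it (`IsMap`, `isMap_self_iff`, `slash_comp`). The matrices of `U_ℓ(α)`,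
`V_ℓ(Q)` and `S_ℓ(Q)` belong to it. As `U` and `V` connect any two indices with the same ideal class
of `I₁ ⋯ Iₙ` (`reach_of_mk_eq`), and as the components of a family `F` in the product space are
invariant under the vertex groups, `F` is compatible with *all* `g` in the groupoid between such
indices (`slash_eq_of_mk_eq`).

Hence `f|g`, for `g` from `(I;J)` to `(I';J)` and `f` the component of `F` at `(I;J)`, depends only
on `I'` and on the ideal class `c` of `∏ I / ∏ I'`. This defines the operator of `c` on families
(`classFamily`); `S(Q)` is the operator of the class of `Q` (`isImageS_iff`), and one obtains an
action of the ideal class group on the product space (`classAction`). The class group being finite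
and commutative, the space is the direct sum of the isotypic components of its characters
(`isInternal_of_mem_iff`).

That the new families belong to the product space is not formal, since a Fourier expansion over
positive semi-definite matrices has to be found for `f|g`. It comes from the Koecher principle
(`hasFourierExpansion_of_holo`), which needs `n > 1`. Functions with such an expansion are
holomorphic (`HasFourierExpansion.holo`), holomorphy is inherited by `f|g` (`Holo.slash`), a
periodic holomorphic function on a tube domain has a Fourier expansion (`exists_tube_expansion`),
and invariance under suitable unipotent matrices makes all coefficients at matrices that are not
positive semi-definite vanish (`exists_unipotent_trace_lt`).
-/

noncomputable section

namespace HilbertSiegel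

open MeasureTheory Filter Topology

/-! ### Fourier expansion on tube domains -/

/-- Holomorphic dependence on a parameter for integrals over a compact space. Only the integrand has
to be jointly continuous: Cauchy's estimate bounds its derivative, and the derivative is measurable
as a limit of difference quotients. -/
theorem differentiableOn_integral_of_continuousOn {X : Type*} [TopologicalSpace X] [CompactSpace X]
    [MeasurableSpace X] [BorelSpace X] (μ : Measure X) [IsFiniteMeasure μ]
    {U : Set ℂ} (hU : IsOpen U) (Φ : ℂ → X → ℂ)
    (hc : ContinuousOn (Function.uncurry Φ) (U ×ˢ Set.univ))
    (hd : ∀ x, DifferentiableOn ℂ (fun w => Φ w x) U) :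
    DifferentiableOn ℂ (fun w => ∫ x, Φ w x ∂μ) U := by
  intro w₀ hw₀
  obtain ⟨r, hr, hball⟩ := Metric.nhds_basis_closedBall.mem_iff.mp (hU.mem_nhds hw₀)
  have hcw : ∀ w ∈ U, Continuous (Φ w) := fun w hw => by
    rw [← continuousOn_univ]
    exact hc.comp (by fun_prop : Continuous fun x : X => (w, x)).continuousOn
      fun x _ => ⟨hw, trivial⟩
  obtain ⟨M, hM⟩ := ((isCompact_closedBall w₀ r).prod isCompact_univ).exists_bound_of_continuousOn
    (hc.mono (Set.prod_mono hball subset_rfl))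
  have hint : ∀ w ∈ U, Integrable (Φ w) μ := fun w hw =>
    (hcw w hw).integrable_of_hasCompactSupport (HasCompactSupport.of_compactSpace _)
  have hd' : ∀ x, ∀ w ∈ U, HasDerivAt (fun w => Φ w x) (deriv (fun w => Φ w x) w) w :=
    fun x w hw => ((hd x).differentiableAt (hU.mem_nhds hw)).hasDerivAt
  have hmeas : AEStronglyMeasurable (fun x => deriv (fun w => Φ w x) w₀) μ := by
    have h1 : Tendsto (fun j : ℕ => ((r / (j + 1) : ℝ) : ℂ)) atTop (𝓝[≠] 0) := by
      rw [tendsto_nhdsWithin_iff]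
      constructor
      · have : Tendsto (fun j : ℕ => r / ((j : ℝ) + 1)) atTop (𝓝 0) := by
          simpa [div_eq_mul_inv] using
            (tendsto_one_div_add_atTop_nhds_zero_nat (𝕜 := ℝ)).const_mul r
        exact_mod_cast (Complex.continuous_ofReal.tendsto 0).comp this
      · refine Eventually.of_forall fun j => ?_
        have : r / ((j : ℝ) + 1) ≠ 0 := by positivity
        exact Complex.ofReal_ne_zero.mpr this
    refine aestronglyMeasurable_of_tendsto_ae (u := atTop)
      (f := fun (j : ℕ) x => ((r / (j + 1) : ℝ) : ℂ)⁻¹ •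
        (Φ (w₀ + ((r / (j + 1) : ℝ) : ℂ)) x - Φ w₀ x)) ?_ ?_
    · intro j
      have : w₀ + ((r / (j + 1) : ℝ) : ℂ) ∈ U := by
        apply hball
        rw [Metric.mem_closedBall, dist_eq_norm, add_sub_cancel_left, Complex.norm_real,
          Real.norm_of_nonneg (by positivity)]
        exact div_le_self hr.le (by linarith [(Nat.cast_nonneg j : (0 : ℝ) ≤ j)])
      exact AEStronglyMeasurable.const_smul
        ((hcw _ this).sub (hcw _ hw₀)).aestronglyMeasurable (((r / (j + 1) : ℝ) : ℂ)⁻¹)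
    · refine Eventually.of_forall fun x => ?_
      exact (hasDerivAt_iff_tendsto_slope_zero.mp (hd' x w₀ hw₀)).comp h1
  have hb : ∀ x, ∀ w ∈ Metric.ball w₀ (r / 2), ‖deriv (fun w => Φ w x) w‖ ≤ M / (r / 2) := by
    intro x w hw
    have hsub : Metric.closedBall w (r / 2) ⊆ Metric.closedBall w₀ r := by
      refine Metric.closedBall_subset_closedBall' ?_
      have := Metric.mem_ball.mp hw
      linarith
    refine Complex.norm_deriv_le_of_forall_mem_sphere_norm_le (by positivity) ?_ ?_
    · refine DifferentiableOn.diffContOnCl ((hd x).mono ?_)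
      exact (Metric.closure_ball_subset_closedBall.trans hsub).trans hball
    · intro z hz
      exact hM (z, x) ⟨hsub (Metric.sphere_subset_closedBall hz), trivial⟩
  have := (hasDerivAt_integral_of_dominated_loc_of_deriv_le (μ := μ) (F := Φ)
    (F' := fun w x => deriv (fun w => Φ w x) w) (bound := fun _ => M / (r / 2))
    (Metric.ball_mem_nhds w₀ (by positivity : 0 < r / 2))
    ((hU.mem_nhds hw₀ |> Filter.Eventually.mono <| fun w hw => (hcw w hw).aestronglyMeasurable))
    (hint w₀ hw₀) hmeas (Eventually.of_forall hb) (integrable_const _)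
    (Eventually.of_forall fun x w hw => hd' x w
      (hball (Metric.ball_subset_closedBall (Metric.ball_subset_ball (by linarith) hw))))).2
  exact this.differentiableAt.differentiableWithinAt

/-- A product of summable functions of the single coordinates is summable over `ι → κ`. -/
theorem summable_pi_prod {ι κ : Type*} [Fintype ι] {g : κ → ℝ} (hg : Summable g)
    (h0 : ∀ a, 0 ≤ g a) : Summable fun m : ι → κ => ∏ i, g (m i) := by
  classical
  refine summable_of_sum_le (c := ∏ _i : ι, ∑' a, g a)
    (fun m => Finset.prod_nonneg fun i _ => h0 _) fun s => ?_
  calc ∑ m ∈ s, ∏ i, g (m i)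
      ≤ ∑ m ∈ Fintype.piFinset (fun i => s.image fun m => m i), ∏ i, g (m i) := by
        refine Finset.sum_le_sum_of_subset_of_nonneg (fun m hm => ?_)
          fun m _ _ => Finset.prod_nonneg fun i _ => h0 _
        rw [Fintype.mem_piFinset]
        exact fun i => Finset.mem_image_of_mem _ hm
    _ = ∏ i, ∑ a ∈ s.image (fun m => m i), g a := (Finset.prod_univ_sum _ _).symm
    _ ≤ ∏ _i : ι, ∑' a, g a := by
        refine Finset.prod_le_prod (fun i _ => Finset.sum_nonneg fun a _ => h0 a) fun i _ => ?_
        exact hg.sum_le_tsum _ fun a _ => h0 a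

theorem summable_exp_neg_abs {ε : ℝ} (hε : 0 < ε) :
    Summable fun a : ℤ => Real.exp (-(ε * |(a : ℝ)|)) := by
  have hnat : Summable fun a : ℕ => Real.exp (-(ε * a)) := by
    have : (fun a : ℕ => Real.exp (-(ε * a))) = fun a : ℕ => Real.exp (-ε) ^ a := by
      funext a
      rw [← Real.exp_nat_mul]
      congr 1
      ring
    rw [this]
    exact summable_geometric_of_lt_one (Real.exp_nonneg _) (by simpa using hε)
  refine Summable.of_nat_of_neg ?_ ?_ <;> simpa using hnat

section Tube

variable {ι : Type*}

/-- The tube domain over a set `C` of imaginary parts. -/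
def tube (C : Set (ι → ℝ)) : Set (ι → ℂ) := {z | (fun i => (z i).im) ∈ C}

/-- A real vector, regarded as a complex one. -/
def cvec (v : ι → ℝ) : ι → ℂ := fun i => (v i : ℂ)

theorem isOpen_tube {C : Set (ι → ℝ)} (hC : IsOpen C) : IsOpen (tube C) :=
  hC.preimage (by fun_prop)

theorem add_cvec_mem_tube {C : Set (ι → ℝ)} {z : ι → ℂ} (hz : z ∈ tube C) (v : ι → ℝ) :
    z + cvec v ∈ tube C := by
  simpa [tube, cvec] using hz

/-- The covering map of the torus. -/
def torusMk (x : ι → ℝ) : UnitAddTorus ι := fun i => (x i : UnitAddCircle)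

theorem isOpenQuotientMap_torusMk : IsOpenQuotientMap (torusMk : (ι → ℝ) → UnitAddTorus ι) :=
  IsOpenQuotientMap.piMap fun _ => QuotientAddGroup.isOpenQuotientMap_mk

/-- A lift of a point of the torus. -/
def torusRep (t : UnitAddTorus ι) : ι → ℝ :=
  Function.surjInv isOpenQuotientMap_torusMk.surjective t

theorem torusMk_torusRep (t : UnitAddTorus ι) : torusMk (torusRep t) = t :=
  Function.surjInv_eq _ t

theorem exists_int_of_torusMk_eq {x y : ι → ℝ} (h : torusMk x = torusMk y) :
    ∃ m : ι → ℤ, x = y + fun i => (m i : ℝ) := by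
  have : ∀ i, ∃ m : ℤ, x i = y i + m := fun i => by
    have hi : (x i : UnitAddCircle) = y i := congrFun h i
    rw [QuotientAddGroup.eq_iff_sub_mem, AddSubgroup.mem_zmultiples_iff] at hi
    obtain ⟨m, hm⟩ := hi
    refine ⟨m, ?_⟩
    rw [zsmul_one] at hm
    linarith
  choose m hm using this
  exact ⟨m, funext hm⟩

variable {C : Set (ι → ℝ)} {H : (ι → ℂ) → ℂ}

/-- Invariance under `ℤ`-translations on the tube. -/
def IntPeriodic (C : Set (ι → ℝ)) (H : (ι → ℂ) → ℂ) : Prop :=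
  ∀ z ∈ tube C, ∀ m : ι → ℤ, H (z + cvec fun i => (m i : ℝ)) = H z

theorem IntPeriodic.eq_of_torusMk (hper : IntPeriodic C H) {z : ι → ℂ} (hz : z ∈ tube C)
    {x y : ι → ℝ} (h : torusMk x = torusMk y) : H (z + cvec x) = H (z + cvec y) := by
  obtain ⟨m, rfl⟩ := exists_int_of_torusMk_eq h
  rw [← hper _ (add_cvec_mem_tube hz y) m]
  congr 1
  funext i
  simp [cvec, add_assoc]

/-- The function `x ↦ H(z + x)` on the torus. It is defined through a set-theoretic lift; the choice
does not matter if `H` is periodic. -/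
def torusFun (H : (ι → ℂ) → ℂ) (z : ι → ℂ) (t : UnitAddTorus ι) : ℂ := H (z + cvec (torusRep t))

theorem torusFun_torusMk (hper : IntPeriodic C H) {z : ι → ℂ} (hz : z ∈ tube C) (x : ι → ℝ) :
    torusFun H z (torusMk x) = H (z + cvec x) :=
  hper.eq_of_torusMk hz (torusMk_torusRep _)

/-- Joint continuity descends along the open quotient map from `ι → ℝ` to the torus. -/
theorem continuousOn_torusFun (hC : IsOpen C) (hH : ContinuousOn H (tube C))
    (hper : IntPeriodic C H) :
    ContinuousOn (Function.uncurry (torusFun H)) (tube C ×ˢ Set.univ) := by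
  rintro ⟨z, t⟩ ⟨hz, -⟩
  refine ContinuousAt.continuousWithinAt ?_
  have hq := (IsOpenQuotientMap.id (X := ι → ℂ)).prodMap (isOpenQuotientMap_torusMk (ι := ι))
  obtain ⟨x, rfl⟩ := isOpenQuotientMap_torusMk.surjective t
  have hmap := hq.map_nhds_eq (z, x)
  change Tendsto _ (𝓝 (Prod.map id torusMk (z, x))) _
  rw [← hmap, tendsto_map'_iff]
  have hcont : ContinuousAt (fun p : (ι → ℂ) × (ι → ℝ) => H (p.1 + cvec p.2)) (z, x) := by
    have h1 : ContinuousAt H (z + cvec x) :=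
      hH.continuousAt ((isOpen_tube hC).mem_nhds (add_cvec_mem_tube hz x))
    have h2 : ContinuousAt (fun p : (ι → ℂ) × (ι → ℝ) => p.1 + cvec p.2) (z, x) := by
      unfold cvec
      fun_prop
    exact ContinuousAt.comp (f := fun p : (ι → ℂ) × (ι → ℝ) => p.1 + cvec p.2) h1 h2
  have hlim : Function.uncurry (torusFun H) (Prod.map id torusMk (z, x)) = H (z + cvec x) :=
    torusFun_torusMk hper hz x
  change Tendsto _ _ (𝓝 (Function.uncurry (torusFun H) (Prod.map id torusMk (z, x))))
  rw [hlim]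
  refine hcont.tendsto.congr' ?_
  have : ∀ᶠ p : (ι → ℂ) × (ι → ℝ) in 𝓝 (z, x), p.1 ∈ tube C :=
    (continuous_fst.tendsto (z, x)).eventually ((isOpen_tube hC).mem_nhds hz)
  filter_upwards [this] with p hp
  exact (torusFun_torusMk hper hp p.2).symm

theorem continuous_torusFun (hC : IsOpen C) (hH : ContinuousOn H (tube C))
    (hper : IntPeriodic C H) {z : ι → ℂ} (hz : z ∈ tube C) : Continuous (torusFun H z) := by
  rw [← continuousOn_univ]
  exact (continuousOn_torusFun hC hH hper).comp
    (by fun_prop : Continuous fun t : UnitAddTorus ι => (z, t)).continuousOn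
    fun t _ => ⟨hz, trivial⟩

/-- A periodic continuous function on the tube is bounded along the real directions, by
compactness of the torus. -/
theorem exists_forall_norm_le (hC : IsOpen C) (hH : ContinuousOn H (tube C))
    (hper : IntPeriodic C H) {z : ι → ℂ} (hz : z ∈ tube C) :
    ∃ B : ℝ, ∀ x : ι → ℝ, ‖H (z + cvec x)‖ ≤ B := by
  obtain ⟨B, hB⟩ := isCompact_univ.exists_bound_of_continuousOn
    (continuous_torusFun hC hH hper hz).continuousOn
  refine ⟨B, fun x => ?_⟩
  rw [← torusFun_torusMk hper hz]
  exact hB _ trivial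

variable [Fintype ι]

/-- The exponential `e(m·z)`. -/
def expZ (m : ι → ℤ) (z : ι → ℂ) : ℂ := Complex.exp (2 * Real.pi * Complex.I * ∑ i, m i * z i)

theorem expZ_ne_zero (m : ι → ℤ) (z : ι → ℂ) : expZ m z ≠ 0 := Complex.exp_ne_zero _

theorem expZ_add (m : ι → ℤ) (z w : ι → ℂ) : expZ m (z + w) = expZ m z * expZ m w := by
  simp only [expZ, ← Complex.exp_add, Pi.add_apply, mul_add, Finset.sum_add_distrib]

theorem expZ_neg (m : ι → ℤ) (z : ι → ℂ) : expZ (-m) z = (expZ m z)⁻¹ := by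
  simp [expZ, ← Complex.exp_neg]

theorem norm_expZ (m : ι → ℤ) (z : ι → ℂ) :
    ‖expZ m z‖ = Real.exp (-(2 * Real.pi * ∑ i, m i * (z i).im)) := by
  rw [expZ, Complex.norm_exp]
  congr 1
  have : (2 * Real.pi * Complex.I * ∑ i, (m i : ℂ) * z i : ℂ) =
      ((2 * Real.pi : ℝ) : ℂ) * (Complex.I * ∑ i, (m i : ℂ) * z i) := by
    push_cast; ring
  rw [this, Complex.re_ofReal_mul, Complex.I_mul_re, Complex.im_sum]
  simp

theorem mFourier_torusMk (m : ι → ℤ) (x : ι → ℝ) :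
    UnitAddTorus.mFourier m (torusMk x) = expZ m (cvec x) := by
  simp only [UnitAddTorus.mFourier, torusMk, ContinuousMap.coe_mk, expZ, Finset.mul_sum,
    Complex.exp_sum, fourier_coe_apply, cvec]
  refine Finset.prod_congr rfl fun i _ => ?_
  congr 1
  push_cast
  ring

/-- The normalized Haar measure of the torus. -/
def torusMeasure (ι : Type*) [Fintype ι] : Measure (UnitAddTorus ι) :=
  Measure.pi fun _ => AddCircle.haarAddCircle

instance : IsProbabilityMeasure (torusMeasure ι) := by
  unfold torusMeasure; infer_instance

instance : (torusMeasure ι).IsAddLeftInvariant := by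
  unfold torusMeasure; infer_instance

theorem mFourierCoeff_eq (G : UnitAddTorus ι → ℂ) (m : ι → ℤ) :
    UnitAddTorus.mFourierCoeff G m =
      ∫ t, UnitAddTorus.mFourier (-m) t • G t ∂(torusMeasure ι) := rfl

/-- The Fourier coefficient of `x ↦ H(z + x)`, normalized so as not to depend on `z`. -/
def tubeCoeff (H : (ι → ℂ) → ℂ) (m : ι → ℤ) (z : ι → ℂ) : ℂ :=
  UnitAddTorus.mFourierCoeff (torusFun H z) m * expZ (-m) z

theorem tubeCoeff_add_cvec (hper : IntPeriodic C H) {z : ι → ℂ} (hz : z ∈ tube C) (m : ι → ℤ)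
    (x : ι → ℝ) : tubeCoeff H m (z + cvec x) = tubeCoeff H m z := by
  have h1 : ∀ t, torusFun H (z + cvec x) t = torusFun H z (torusMk x + t) := fun t => by
    have : torusMk x + t = torusMk (x + torusRep t) := by
      conv_lhs => rw [← torusMk_torusRep t]
      rfl
    rw [this, torusFun_torusMk hper hz, torusFun]
    congr 1
    funext i
    simp [cvec, add_assoc]
  have h2 : ∀ t, UnitAddTorus.mFourier (-m) t =
      UnitAddTorus.mFourier (-m) (torusMk x + t) * expZ m (cvec x) := fun t => by
    have e : torusMk x + t = torusMk (x + torusRep t) := by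
      conv_lhs => rw [← torusMk_torusRep t]
      rfl
    have e2 : cvec (x + torusRep t) = cvec x + cvec (torusRep t) := by
      funext i; simp [cvec]
    conv_lhs => rw [← torusMk_torusRep t]
    rw [e, mFourier_torusMk, mFourier_torusMk, e2, expZ_add, expZ_neg, expZ_neg]
    have := expZ_ne_zero m (cvec x)
    field_simp
  rw [tubeCoeff, tubeCoeff, mFourierCoeff_eq, mFourierCoeff_eq]
  have h3 : ∀ t, UnitAddTorus.mFourier (-m) t • torusFun H (z + cvec x) t =
      (fun s => expZ m (cvec x) * (UnitAddTorus.mFourier (-m) s • torusFun H z s))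
        (torusMk x + t) := fun t => by
    simp only [smul_eq_mul]
    rw [h1, h2 t]
    ring
  simp_rw [h3]
  rw [integral_add_left_eq_self (μ := torusMeasure ι)
    (fun s => expZ m (cvec x) * (UnitAddTorus.mFourier (-m) s • torusFun H z s)) (torusMk x),
    integral_const_mul, expZ_add, expZ_neg m (cvec x)]
  have := expZ_ne_zero m (cvec x)
  field_simp

/-- Holomorphy along all complex lines with real direction. -/
def LineHolo (C : Set (ι → ℝ)) (H : (ι → ℂ) → ℂ) : Prop :=
  ∀ (z : ι → ℂ) (v : ι → ℝ),
    DifferentiableOn ℂ (fun w : ℂ => H (z + w • cvec v)) {w | z + w • cvec v ∈ tube C}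

/-- The normalized Fourier coefficient is constant on the tube: along the complex line in the
direction of the difference of the imaginary parts it is holomorphic and invariant under real
translations, so that its derivative vanishes. -/
theorem tubeCoeff_eq (hC : IsOpen C) (hconv : Convex ℝ C) (hH : ContinuousOn H (tube C))
    (hhol : LineHolo C H) (hper : IntPeriodic C H) (m : ι → ℤ) {z z' : ι → ℂ}
    (hz : z ∈ tube C) (hz' : z' ∈ tube C) : tubeCoeff H m z' = tubeCoeff H m z := by
  -- `z'` is `z + iv`, up to a real translation
  set v : ι → ℝ := fun i => (z' i).im - (z i).im with hv
  set U : Set ℂ := {w | z + w • cvec v ∈ tube C} with hUdef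
  have hUim : ∀ w, w ∈ U ↔ (fun i => (z i).im) + w.im • v ∈ C := fun w => by
    simp only [hUdef, tube, Set.mem_ofPred_eq]
    have : (fun i => ((z + w • cvec v) i).im) = (fun i => (z i).im) + w.im • v := by
      funext i
      simp [cvec]
    rw [this]
  have hUo : IsOpen U := (isOpen_tube hC).preimage (by fun_prop)
  have hUc : Convex ℝ U := by
    intro a ha b hb s t hs ht hst
    rw [hUim] at ha hb ⊢
    have := hconv ha hb hs ht hst
    convert this using 1
    funext i
    simp only [Complex.add_im, Complex.smul_im, smul_eq_mul, Pi.add_apply, Pi.smul_apply]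
    linear_combination (-(z i).im) * hst
  set A : ℂ → ℂ := fun w => tubeCoeff H m (z + w • cvec v) with hA
  have hAd : DifferentiableOn ℂ A U := by
    refine DifferentiableOn.mul ?_ ?_
    · simp only [mFourierCoeff_eq]
      refine differentiableOn_integral_of_continuousOn (torusMeasure ι) hUo
        (fun w t => UnitAddTorus.mFourier (-m) t • torusFun H (z + w • cvec v) t) ?_ ?_
      · refine ContinuousOn.smul (f := fun p : ℂ × UnitAddTorus ι => UnitAddTorus.mFourier (-m) p.2)
          (g := fun p : ℂ × UnitAddTorus ι => torusFun H (z + p.1 • cvec v) p.2)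
          (by fun_prop) ?_
        refine (continuousOn_torusFun hC hH hper).comp
          (f := fun p : ℂ × UnitAddTorus ι => (z + p.1 • cvec v, p.2)) (by fun_prop) ?_
        rintro ⟨w, t⟩ ⟨hw, -⟩
        exact ⟨hw, trivial⟩
      · intro t
        refine DifferentiableOn.const_mul ?_ _
        have := hhol (z + cvec (torusRep t)) v
        refine (this.congr fun w hw => ?_).mono fun w hw => ?_
        · simp only [torusFun, add_right_comm]
        · change z + cvec (torusRep t) + w • cvec v ∈ tube C
          rw [add_right_comm]
          exact add_cvec_mem_tube hw _
    · simp only [expZ]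
      fun_prop
  have hAt : ∀ w ∈ U, ∀ t : ℝ, A (w + t) = A w := fun w hw t => by
    have : z + (w + t) • cvec v = (z + w • cvec v) + cvec (t • v) := by
      funext i
      simp [cvec]
      ring
    simp only [hA]
    rw [this, tubeCoeff_add_cvec hper hw]
  have hA0 : Set.EqOn (fderiv ℂ A) 0 U := by
    intro w hw
    have h1 : HasDerivAt A (deriv A w) w :=
      (hAd.differentiableAt (hUo.mem_nhds hw)).hasDerivAt
    have h2 : HasDerivAt (fun t : ℝ => A (w + t)) (deriv A w) 0 := by
      have h3 : HasDerivAt (fun t : ℝ => w + (t : ℂ)) 1 0 :=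
        (Complex.ofRealCLM.hasDerivAt (x := (0 : ℝ))).const_add w
      have h1' : HasDerivAt A (deriv A w) (w + ((0 : ℝ) : ℂ)) := by simpa using h1
      have h6 := h1'.comp (0 : ℝ) h3
      rw [mul_one] at h6
      exact h6
    have h4 : (fun t : ℝ => A (w + t)) = fun _ => A w := funext fun t => hAt w hw t
    rw [h4] at h2
    have h5 : deriv A w = 0 := h2.unique (hasDerivAt_const _ _)
    ext
    simpa using h5
  have h0 : (0 : ℂ) ∈ U := by simpa [hUdef] using hz
  have hI : Complex.I ∈ U := by
    rw [hUim]
    have : (fun i => (z i).im) + Complex.I.im • v = fun i => (z' i).im := by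
      funext i; simp [hv]
    rw [this]
    exact hz'
  have hAI := hUo.is_const_of_fderiv_eq_zero hUc.isPreconnected hAd hA0 h0 hI
  have hz'eq : z' = (z + Complex.I • cvec v) + cvec (fun i => (z' i).re - (z i).re) := by
    funext i
    apply Complex.ext <;> simp [cvec, hv]
  rw [hz'eq, tubeCoeff_add_cvec hper hI]
  have h0' : A 0 = tubeCoeff H m z := by simp [hA]
  rw [← h0', hAI]

/-- Fourier expansion of a periodic holomorphic function on a tube domain over an open convex set,
with Cauchy's estimate for the coefficients. -/
theorem exists_tube_expansion (hC : IsOpen C) (hconv : Convex ℝ C) (hH : ContinuousOn H (tube C))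
    (hhol : LineHolo C H) (hper : IntPeriodic C H) :
    ∃ c : (ι → ℤ) → ℂ, (∀ z ∈ tube C, HasSum (fun m => c m * expZ m z) (H z)) ∧
      ∀ z ∈ tube C, ∀ B : ℝ, (∀ x : ι → ℝ, ‖H (z + cvec x)‖ ≤ B) →
        ∀ m, ‖c m * expZ m z‖ ≤ B := by
  classical
  rcases (tube C).eq_empty_or_nonempty with hemp | ⟨z₀, hz₀⟩
  · exact ⟨0, by simp [hemp], by simp [hemp]⟩
  have key : ∀ z ∈ tube C, ∀ m, tubeCoeff H m z₀ * expZ m z =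
      UnitAddTorus.mFourierCoeff (torusFun H z) m := fun z hz m => by
    rw [tubeCoeff_eq hC hconv hH hhol hper m hz hz₀, tubeCoeff, expZ_neg]
    have := expZ_ne_zero m z
    field_simp
  have hest : ∀ z ∈ tube C, ∀ B : ℝ, (∀ x : ι → ℝ, ‖H (z + cvec x)‖ ≤ B) →
      ∀ m, ‖tubeCoeff H m z₀ * expZ m z‖ ≤ B := by
    intro z hz B hB m
    rw [key z hz, mFourierCoeff_eq]
    have := norm_integral_le_of_norm_le_const (μ := torusMeasure ι)
      (f := fun t => UnitAddTorus.mFourier (-m) t • torusFun H z t) (C := B)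
      (Eventually.of_forall fun t => by
        rw [norm_smul]
        have h1 : ‖UnitAddTorus.mFourier (-m) t‖ ≤ 1 :=
          ((UnitAddTorus.mFourier (-m)).norm_coe_le_norm t).trans
            UnitAddTorus.mFourier_norm.le
        have h2 : ‖torusFun H z t‖ ≤ B := hB _
        calc _ ≤ 1 * ‖torusFun H z t‖ := by gcongr
          _ ≤ B := by simpa using h2)
    simpa using this
  refine ⟨fun m => tubeCoeff H m z₀, fun z hz => ?_, hest⟩
  -- moving the imaginary part by `±ε` in each coordinate gives exponential decay
  obtain ⟨ε, hε, hball⟩ := Metric.isOpen_iff.mp hC _ hz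
  have hsigns : ∀ s : ι → Bool,
      z + (fun i => ((if s i then ε / 2 else -(ε / 2) : ℝ) : ℂ) * Complex.I) ∈ tube C := by
    intro s
    apply hball
    rw [Metric.mem_ball, dist_pi_lt_iff hε]
    intro i
    simp only [Pi.add_apply, Complex.add_im, Complex.mul_im, Complex.ofReal_re, Complex.I_im,
      mul_one, Complex.ofReal_im, Complex.I_re, mul_zero, add_zero, Real.dist_eq,
      add_sub_cancel_left]
    split_ifs <;> simp only [abs_neg, abs_of_pos (half_pos hε)] <;> linarith
  choose B hB using fun s => exists_forall_norm_le hC hH hper (hsigns s)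
  have hsum : Summable fun m => tubeCoeff H m z₀ * expZ m z := by
    refine Summable.of_norm_bounded (g := fun m : ι → ℤ => (∑ s, |B s|) *
      ∏ i, Real.exp (-((Real.pi * ε) * |(m i : ℝ)|)))
      ((summable_pi_prod (summable_exp_neg_abs (by positivity))
        fun a => Real.exp_nonneg _).mul_left _) fun m => ?_
    set s : ι → Bool := fun i => decide (m i ≤ 0) with hs
    have h1 := hest _ (hsigns s) (B s) (hB s) m
    rw [expZ_add, ← mul_assoc, norm_mul, norm_expZ m (fun i => _)] at h1
    have h2 : -(2 * Real.pi * ∑ i, (m i : ℝ) *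
        (((if s i then ε / 2 else -(ε / 2) : ℝ) : ℂ) * Complex.I).im) =
        ∑ i, Real.pi * ε * |(m i : ℝ)| := by
      rw [Finset.mul_sum, ← Finset.sum_neg_distrib]
      refine Finset.sum_congr rfl fun i _ => ?_
      by_cases hi : m i ≤ 0
      · have : (m i : ℝ) ≤ 0 := by exact_mod_cast hi
        simp [hs, hi, abs_of_nonpos this]
        ring
      · have : (0 : ℝ) ≤ m i := by exact_mod_cast (not_le.mp hi).le
        simp [hs, hi, abs_of_nonneg this]
        ring
    rw [h2] at h1
    have h3 : B s ≤ ∑ s, |B s| :=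
      (le_abs_self _).trans
        (Finset.single_le_sum (f := fun s => |B s|) (fun _ _ => abs_nonneg _) (Finset.mem_univ s))
    rw [← Real.exp_sum, Finset.sum_neg_distrib, Real.exp_neg, ← div_eq_mul_inv,
      le_div_iff₀ (Real.exp_pos _)]
    exact h1.trans h3
  have hsum' : Summable (UnitAddTorus.mFourierCoeff
      (⟨torusFun H z, continuous_torusFun hC hH hper hz⟩ : C(UnitAddTorus ι, ℂ))) := by
    refine hsum.congr fun m => key z hz m
  have := UnitAddTorus.hasSum_mFourier_series_apply_of_summable hsum' (torusMk 0)
  have h0 : cvec (0 : ι → ℝ) = 0 := by funext i; simp [cvec]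
  simp only [ContinuousMap.coe_mk, mFourier_torusMk, torusFun_torusMk hper hz, h0, add_zero] at this
  refine this.congr_fun fun m => ?_
  rw [key z hz m]
  simp [expZ]

end Tube

/-! ### Positive definite matrices -/

/-- Positive definiteness is an open condition on symmetric matrices, by compactness of the unit
sphere. -/
theorem eventually_posDef {n : ℕ} {P : Matrix (Fin n) (Fin n) ℝ} (hP : P.PosDef) :
    ∀ᶠ N in 𝓝 P, N.IsSymm → N.PosDef := by
  have h1 : ∀ᶠ N in 𝓝 P, ∀ v ∈ Metric.sphere (0 : Fin n → ℝ) 1, 0 < v ⬝ᵥ (N *ᵥ v) := by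
    refine (isCompact_sphere _ _).eventually_forall_of_forall_eventually fun v hv => ?_
    have hv0 : v ≠ 0 := by
      rintro rfl
      simp at hv
    have hc : Continuous fun p : Matrix (Fin n) (Fin n) ℝ × (Fin n → ℝ) =>
        p.2 ⬝ᵥ (p.1 *ᵥ p.2) :=
      Continuous.dotProduct continuous_snd (Continuous.matrix_mulVec continuous_fst continuous_snd)
    refine hc.continuousAt.eventually_const_lt (u := 0) ?_
    simpa using hP.dotProduct_mulVec_pos hv0
  filter_upwards [h1] with N hN hs
  refine Matrix.PosDef.of_dotProduct_mulVec_pos ?_ fun v hv => ?_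
  · rw [Matrix.IsHermitian, Matrix.conjTranspose_eq_transpose_of_trivial]
    exact hs
  · have hv' : 0 < ‖v‖ := norm_pos_iff.mpr hv
    have := hN (‖v‖⁻¹ • v) (by simp [norm_smul, hv'.ne'])
    rw [Matrix.mulVec_smul, smul_dotProduct, dotProduct_smul, smul_eq_mul, smul_eq_mul,
      ← mul_assoc] at this
    simpa using (pos_iff_pos_of_mul_pos this).mp (by positivity)

/-- The trace of `SP` is the value at `(1,…,1)` of the quadratic form of the Hadamard product of `S`
and `P`, which is positive semi-definite by the Schur product theorem. -/
theorem trace_mul_nonneg_of_posSemidef {n : ℕ} {S P : Matrix (Fin n) (Fin n) ℝ}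
    (hS : S.PosSemidef) (hP : P.PosSemidef) : 0 ≤ (S * P).trace := by
  have h := (hS.hadamard hP).dotProduct_mulVec_nonneg (fun _ => (1 : ℝ))
  have hsymm : ∀ i j, P i j = P j i := fun i j => by simpa using hP.isHermitian.apply j i
  have e : (S * P).trace = star (fun _ => (1 : ℝ)) ⬝ᵥ (S ⊙ P) *ᵥ (fun _ => (1 : ℝ)) := by
    simp only [Matrix.trace, Matrix.diag, Matrix.mul_apply, dotProduct, Matrix.mulVec,
      Matrix.hadamard_apply, Pi.star_apply, star_one, one_mul, mul_one]
    exact Finset.sum_congr rfl fun i _ => Finset.sum_congr rfl fun j _ => by rw [hsymm j i]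
  rw [e]
  exact h

/-! ### Holomorphic functions on the product of half-spaces -/

section Holo

variable {n : ℕ} {K : Type*} [Field K]

/-- The family `M` of complex matrices is a point of the product of half-spaces. -/
def IsPt (M : (K →+* ℝ) → Matrix (Fin n) (Fin n) ℂ) : Prop :=
  ∀ φ, (M φ).IsSymm ∧ ((M φ).map Complex.im).PosDef

/-- The point of the product of half-spaces given by a family of matrices. -/
def IsPt.toPt {M : (K →+* ℝ) → Matrix (Fin n) (Fin n) ℂ} (h : IsPt M) : HalfSpaceProd n K :=
  fun φ => ⟨M φ, h φ⟩

open Classical in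
/-- The extension by zero of a function on the product of half-spaces to all families of
matrices. It makes continuity and holomorphy available, as `SiegelHalfSpace` carries no topology. -/
def extendZero (f : HalfSpaceProd n K → ℂ) (M : (K →+* ℝ) → Matrix (Fin n) (Fin n) ℂ) : ℂ :=
  if h : IsPt M then f h.toPt else 0

theorem extendZero_of_isPt (f : HalfSpaceProd n K → ℂ)
    {M : (K →+* ℝ) → Matrix (Fin n) (Fin n) ℂ} (h : IsPt M) : extendZero f M = f h.toPt :=
  dif_pos h

theorem isPt_coe (τ : HalfSpaceProd n K) : IsPt fun φ => (τ φ).1 := fun φ => (τ φ).2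

theorem extendZero_coe (f : HalfSpaceProd n K → ℂ) (τ : HalfSpaceProd n K) :
    extendZero f (fun φ => (τ φ).1) = f τ :=
  extendZero_of_isPt f (isPt_coe τ)

/-- Holomorphy of a function on the product of half-spaces, in the form used below: continuity,
and holomorphy along every holomorphic curve. -/
def Holo (f : HalfSpaceProd n K → ℂ) : Prop :=
  ContinuousOn (extendZero f) {M | IsPt M} ∧
  ∀ (U : Set ℂ) (γ : ℂ → (K →+* ℝ) → Matrix (Fin n) (Fin n) ℂ), IsOpen U →
    (∀ φ i j, DifferentiableOn ℂ (fun w => γ w φ i j) U) → (∀ w ∈ U, IsPt (γ w)) →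
      DifferentiableOn ℂ (fun w => extendZero f (γ w)) U

theorem differentiableOn_det {U : Set ℂ} {M : ℂ → Matrix (Fin n) (Fin n) ℂ}
    (hM : ∀ i j, DifferentiableOn ℂ (fun w => M w i j) U) :
    DifferentiableOn ℂ (fun w => (M w).det) U := by
  simp only [Matrix.det_apply]
  refine DifferentiableOn.fun_sum fun σ _ => ?_
  simp only [Units.smul_def, zsmul_eq_mul]
  refine DifferentiableOn.const_mul ?_ _
  exact DifferentiableOn.fun_finsetProd fun i _ => hM _ _

theorem differentiableOn_mul_apply {U : Set ℂ} {M N : ℂ → Matrix (Fin n) (Fin n) ℂ}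
    (hM : ∀ i j, DifferentiableOn ℂ (fun w => M w i j) U)
    (hN : ∀ i j, DifferentiableOn ℂ (fun w => N w i j) U) (i j : Fin n) :
    DifferentiableOn ℂ (fun w => (M w * N w) i j) U := by
  simp only [Matrix.mul_apply]
  exact DifferentiableOn.fun_sum fun l _ => (hM i l).mul (hN l j)

theorem differentiableOn_inv_apply {U : Set ℂ} {M : ℂ → Matrix (Fin n) (Fin n) ℂ}
    (hM : ∀ i j, DifferentiableOn ℂ (fun w => M w i j) U) (h0 : ∀ w ∈ U, (M w).det ≠ 0)
    (i j : Fin n) : DifferentiableOn ℂ (fun w => (M w)⁻¹ i j) U := by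
  simp only [Matrix.inv_def, Ring.inverse_eq_inv', Matrix.smul_apply, smul_eq_mul,
    Matrix.adjugate_apply]
  refine ((differentiableOn_det hM).inv h0).mul (differentiableOn_det fun a b => ?_)
  by_cases ha : a = j
  · subst ha
    simp only [Matrix.updateRow_self]
    fun_prop
  · simp only [Matrix.updateRow_ne ha]
    exact hM a b

/-- The matrix `Cτ + D`, for an arbitrary family of matrices `τ`. -/
def rawDenom (g : Similitude n K) (M : (K →+* ℝ) → Matrix (Fin n) (Fin n) ℂ) (φ : K →+* ℝ) :
    Matrix (Fin n) (Fin n) ℂ :=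
  emb φ g.C * M φ + emb φ g.D

/-- The matrix `(Aτ + B)(Cτ + D)⁻¹`, for an arbitrary family of matrices `τ`. -/
def rawMoebius (g : Similitude n K) (M : (K →+* ℝ) → Matrix (Fin n) (Fin n) ℂ) (φ : K →+* ℝ) :
    Matrix (Fin n) (Fin n) ℂ :=
  (emb φ g.A * M φ + emb φ g.B) * (rawDenom g M φ)⁻¹

theorem isPt_rawMoebius (g : Similitude n K) {M : (K →+* ℝ) → Matrix (Fin n) (Fin n) ℂ}
    (h : IsPt M) : IsPt (rawMoebius g M) :=
  fun φ => moebius_mem g φ (h.toPt φ)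

theorem det_rawDenom_ne_zero (g : Similitude n K) {M : (K →+* ℝ) → Matrix (Fin n) (Fin n) ℂ}
    (h : IsPt M) (φ : K →+* ℝ) : (rawDenom g M φ).det ≠ 0 :=
  (isUnit_denom g φ (h.toPt φ)).ne_zero

theorem extendZero_slash [Fintype (K →+* ℝ)] (k : ℤ) (f : HalfSpaceProd n K → ℂ)
    (g : Similitude n K) {M : (K →+* ℝ) → Matrix (Fin n) (Fin n) ℂ} (h : IsPt M) :
    extendZero (slash k f g) M =
      (((∏ φ : K →+* ℝ, φ (g.A * g.Dᵀ - g.B * g.Cᵀ).det) ^ ((k : ℝ) / 2) : ℝ) : ℂ) *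
        (∏ φ : K →+* ℝ, (rawDenom g M φ).det) ^ (-k) * extendZero f (rawMoebius g M) := by
  rw [extendZero_of_isPt _ h, extendZero_of_isPt _ (isPt_rawMoebius g h)]
  rfl

theorem Holo.slash [Fintype (K →+* ℝ)] {f : HalfSpaceProd n K → ℂ} (hf : Holo f) (k : ℤ)
    (g : Similitude n K) : Holo (slash k f g) := by
  constructor
  · have hden : ∀ φ, Continuous fun M : (K →+* ℝ) → Matrix (Fin n) (Fin n) ℂ =>
        rawDenom g M φ := fun φ =>
      (continuous_const.matrix_mul (continuous_apply φ)).add continuous_const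
    have hmob : ContinuousOn (rawMoebius g) {M | IsPt M} := by
      refine continuousOn_pi.mpr fun φ => ?_
      refine ContinuousOn.mul (f := fun M : (K →+* ℝ) → Matrix (Fin n) (Fin n) ℂ =>
        emb φ g.A * M φ + emb φ g.B) ?_ ?_
      · exact ((continuous_const.matrix_mul (continuous_apply φ)).add
          continuous_const).continuousOn
      · simp only [Matrix.inv_def, Ring.inverse_eq_inv']
        refine ContinuousOn.smul (f := fun M => (rawDenom g M φ).det⁻¹)
          (g := fun M => (rawDenom g M φ).adjugate) ?_ (hden φ).matrix_adjugate.continuousOn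
        exact (hden φ).matrix_det.continuousOn.inv₀ fun M hM => det_rawDenom_ne_zero g hM φ
    refine ContinuousOn.congr ?_ fun M hM => extendZero_slash k f g hM
    refine (continuousOn_const.mul ?_).mul (hf.1.comp hmob fun M hM => isPt_rawMoebius g hM)
    refine ContinuousOn.zpow₀ ?_ _ fun M hM => Or.inl ?_
    · exact continuousOn_finsetProd _ fun φ _ => (hden φ).matrix_det.continuousOn
    · exact Finset.prod_ne_zero_iff.mpr fun φ _ => det_rawDenom_ne_zero g hM φ
  · intro U γ hU hγ hpt
    have hlin : ∀ (P Q : Matrix (Fin n) (Fin n) ℂ) (φ : K →+* ℝ) (i j),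
        DifferentiableOn ℂ (fun w => (P * γ w φ + Q) i j) U := fun P Q φ i j => by
      simp only [Matrix.add_apply]
      exact (differentiableOn_mul_apply (M := fun _ => P) (fun _ _ => by fun_prop) (hγ φ) i
        j).add (by fun_prop)
    have hmob : ∀ φ i j, DifferentiableOn ℂ (fun w => rawMoebius g (γ w) φ i j) U :=
      fun φ i j => differentiableOn_mul_apply (hlin _ _ φ)
        (differentiableOn_inv_apply (hlin _ _ φ) fun w hw => det_rawDenom_ne_zero g (hpt w hw) φ)
        i j
    refine DifferentiableOn.congr ?_ fun w hw => extendZero_slash k f g (hpt w hw)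
    refine DifferentiableOn.mul (DifferentiableOn.const_mul ?_ _)
      (hf.2 U _ hU hmob fun w hw => isPt_rawMoebius g (hpt w hw))
    refine DifferentiableOn.zpow ?_ (Or.inl fun w hw => ?_)
    · exact DifferentiableOn.fun_finsetProd fun φ _ => differentiableOn_det (hlin _ _ φ)
    · exact Finset.prod_ne_zero_iff.mpr fun φ _ => det_rawDenom_ne_zero g (hpt w hw) φ

end Holo

section Series

variable {n : ℕ} {K : Type*} [Field K] [NumberField K]

/-- The exponential `e{TM}`, for arbitrary families of matrices `M`. -/
def rawExp (T : Matrix (Fin n) (Fin n) K) (M : (K →+* ℝ) → Matrix (Fin n) (Fin n) ℂ) : ℂ :=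
  Complex.exp (Real.pi * Complex.I * Matrix.trace (∑ φ : K →+* ℝ, emb φ T * M φ))

theorem expTrace_eq_rawExp (T : PsdMatrix n K) (τ : HalfSpaceProd n K) :
    expTrace T τ = rawExp T.1 fun φ => (τ φ).1 := rfl

theorem norm_rawExp (T : Matrix (Fin n) (Fin n) K)
    (M : (K →+* ℝ) → Matrix (Fin n) (Fin n) ℂ) :
    ‖rawExp T M‖ = Real.exp (-(Real.pi * ∑ φ : K →+* ℝ,
      (T.map φ * (M φ).map Complex.im).trace)) := by
  rw [rawExp, Complex.norm_exp, mul_assoc, Complex.re_ofReal_mul, Complex.I_mul_re,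
    Matrix.trace_sum, Complex.im_sum, mul_neg]
  refine congrArg (fun x => Real.exp (-(Real.pi * x))) (Finset.sum_congr rfl fun φ _ => ?_)
  simp [Matrix.trace, Matrix.mul_apply, emb]

/-- Near a given point, imaginary parts exceed half of that of the given point. -/
theorem eventually_posSemidef_sub {M₀ : (K →+* ℝ) → Matrix (Fin n) (Fin n) ℂ} (h₀ : IsPt M₀) :
    ∀ᶠ M in 𝓝 M₀, IsPt M → ∀ φ : K →+* ℝ,
      ((M φ).map Complex.im - (1 / 2 : ℝ) • (M₀ φ).map Complex.im).PosSemidef := by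
  have h1 : ∀ φ : K →+* ℝ, ∀ᶠ M in 𝓝 M₀, (M φ).IsSymm →
      ((M φ).map Complex.im - (1 / 2 : ℝ) • (M₀ φ).map Complex.im).PosDef := by
    intro φ
    have hc : Continuous fun M : (K →+* ℝ) → Matrix (Fin n) (Fin n) ℂ =>
        (M φ).map Complex.im - (1 / 2 : ℝ) • (M₀ φ).map Complex.im :=
      ((continuous_apply φ).matrix_map Complex.continuous_im).sub continuous_const
    have hP : ((M₀ φ).map Complex.im - (1 / 2 : ℝ) • (M₀ φ).map Complex.im).PosDef := by
      have : (M₀ φ).map Complex.im - (1 / 2 : ℝ) • (M₀ φ).map Complex.im =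
          (1 / 2 : ℝ) • (M₀ φ).map Complex.im := by
        ext i j
        simp
        ring
      rw [this]
      exact (h₀ φ).2.smul (by norm_num)
    filter_upwards [hc.continuousAt.eventually (eventually_posDef hP)] with M hM hs
    refine hM ?_
    have h0s : (M₀ φ)ᵀ = M₀ φ := (h₀ φ).1
    have hs' : (M φ)ᵀ = M φ := hs
    rw [Matrix.IsSymm, Matrix.transpose_sub, Matrix.transpose_smul, ← Matrix.transpose_map,
      ← Matrix.transpose_map, h0s, hs']
  filter_upwards [eventually_all.mpr h1] with M hM hpt φ
  exact (hM φ (hpt φ).1).posSemidef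

/-- A function with a Fourier expansion over positive semi-definite matrices is holomorphic: near
a point with imaginary part `Y` the series is dominated by its value at `iY/2`. -/
theorem HasFourierExpansion.holo {f : HalfSpaceProd n K → ℂ} (hf : HasFourierExpansion f) :
    Holo f := by
  obtain ⟨c, hc⟩ := hf
  have hext : ∀ M, IsPt M → extendZero f M = ∑' T : PsdMatrix n K, c T * rawExp T.1 M :=
    fun M hM => by
      rw [extendZero_of_isPt f hM, ← (hc hM.toPt).tsum_eq]
      rfl
  have hmaj : ∀ M₀ : (K →+* ℝ) → Matrix (Fin n) (Fin n) ℂ, IsPt M₀ →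
      ∃ u : PsdMatrix n K → ℝ, Summable u ∧
        ∀ᶠ M in 𝓝 M₀, IsPt M → ∀ T : PsdMatrix n K, ‖c T * rawExp T.1 M‖ ≤ u T := by
    intro M₀ h₀
    have hhalf : IsPt fun φ =>
        (((1 / 2 : ℝ) • (M₀ φ).map Complex.im).map fun x : ℝ => (x : ℂ) * Complex.I) := by
      intro φ
      have h0s : (M₀ φ)ᵀ = M₀ φ := (h₀ φ).1
      constructor
      · rw [Matrix.IsSymm, ← Matrix.transpose_map, Matrix.transpose_smul, ← Matrix.transpose_map,
          h0s]
      · have : ((((1 / 2 : ℝ) • (M₀ φ).map Complex.im).map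
            fun x : ℝ => (x : ℂ) * Complex.I)).map Complex.im =
            (1 / 2 : ℝ) • (M₀ φ).map Complex.im := by
          ext i j
          simp
        rw [this]
        exact (h₀ φ).2.smul (by norm_num)
    refine ⟨_, (hc hhalf.toPt).summable.norm, ?_⟩
    filter_upwards [eventually_posSemidef_sub h₀] with M hM hpt T
    rw [norm_mul, norm_mul]
    refine mul_le_mul_of_nonneg_left ?_ (norm_nonneg _)
    rw [expTrace_eq_rawExp, norm_rawExp, norm_rawExp, Real.exp_le_exp, neg_le_neg_iff]
    refine mul_le_mul_of_nonneg_left (Finset.sum_le_sum fun φ _ => ?_) Real.pi_pos.le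
    have h := trace_mul_nonneg_of_posSemidef (T.2.2 φ) (hM hpt φ)
    rw [Matrix.mul_sub, Matrix.trace_sub, sub_nonneg] at h
    have e : (hhalf.toPt φ).1.map Complex.im = (1 / 2 : ℝ) • (M₀ φ).map Complex.im := by
      ext i j
      simp [IsPt.toPt]
    rw [e]
    exact h
  constructor
  · intro M₀ h₀
    obtain ⟨u, hu, hev⟩ := hmaj M₀ h₀
    set V : Set ((K →+* ℝ) → Matrix (Fin n) (Fin n) ℂ) :=
      {M | IsPt M → ∀ T : PsdMatrix n K, ‖c T * rawExp T.1 M‖ ≤ u T}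
    have hcont : ContinuousOn (fun M => ∑' T : PsdMatrix n K, c T * rawExp T.1 M)
        ({M | IsPt M} ∩ V) := by
      refine continuousOn_tsum (fun T => Continuous.continuousOn ?_) hu
        fun T M hM => hM.2 hM.1 T
      refine continuous_const.mul (Complex.continuous_exp.comp (continuous_const.mul ?_))
      exact Continuous.matrix_trace
        (continuous_finsetSum _ fun φ _ => continuous_const.matrix_mul (continuous_apply φ))
    refine (continuousWithinAt_inter hev).mp ?_
    exact (hcont.congr fun M hM => hext M hM.1) M₀ ⟨h₀, mem_of_mem_nhds hev⟩
  · intro U γ hU hγ hpt w₀ hw₀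
    obtain ⟨u, hu, hev⟩ := hmaj (γ w₀) (hpt w₀ hw₀)
    have hγc : ContinuousAt γ w₀ := by
      refine continuousAt_pi.mpr fun φ => ?_
      refine continuousAt_pi.mpr fun i => continuousAt_pi.mpr fun j => ?_
      exact ((hγ φ i j).differentiableAt (hU.mem_nhds hw₀)).continuousAt
    have hnear : ∀ᶠ w in 𝓝 w₀, w ∈ U ∧
        ∀ T : PsdMatrix n K, ‖c T * rawExp T.1 (γ w)‖ ≤ u T := by
      filter_upwards [hγc.eventually hev, hU.mem_nhds hw₀] with w hw hwU
      exact ⟨hwU, hw (hpt w hwU)⟩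
    obtain ⟨V, hV, hVo, hwV⟩ := mem_nhds_iff.mp hnear
    have hdiff : DifferentiableOn ℂ (fun w => ∑' T : PsdMatrix n K, c T * rawExp T.1 (γ w)) V := by
      refine Complex.differentiableOn_tsum_of_summable_norm hu (fun T => ?_) hVo
        fun T w hw => (hV hw).2 T
      have : ∀ φ : K →+* ℝ, DifferentiableOn ℂ (fun w => (emb φ T.1 * γ w φ).trace) V := by
        intro φ
        simp only [Matrix.trace, Matrix.diag]
        refine DifferentiableOn.fun_sum fun i _ => ?_
        exact differentiableOn_mul_apply (M := fun _ => emb φ T.1) (fun _ _ => by fun_prop)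
          (fun i j => (hγ φ i j).mono fun w hw => (hV hw).1) i i
      simp only [rawExp, Matrix.trace_sum]
      exact (((DifferentiableOn.fun_sum fun φ _ => this φ).const_mul _).cexp).const_mul _
    have hloc : DifferentiableAt ℂ (fun w => ∑' T : PsdMatrix n K, c T * rawExp T.1 (γ w)) w₀ :=
      hdiff.differentiableAt (hVo.mem_nhds hwV)
    refine (hloc.congr_of_eventuallyEq ?_).differentiableWithinAt
    filter_upwards [hU.mem_nhds hw₀] with w hw
    exact hext _ (hpt w hw)

end Series

/-! ### Real embeddings, dual bases and units -/

section Arithmetic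

variable {K : Type*} [Field K] [NumberField K]

/-- Every fractional ideal contains `N𝓞` for some positive integer `N`. -/
theorem exists_nat_mul_mem (P : Idl K) :
    ∃ N : ℕ, N ≠ 0 ∧ ∀ y : 𝓞 K, (N : K) * (y : K) ∈ P.1 := by
  obtain ⟨x, hx, hxP⟩ := FractionalIdeal.exists_ne_zero_mem_isInteger P.ne_zero
  refine ⟨Ideal.absNorm (Ideal.span {x}), ?_, fun y => ?_⟩
  · rw [Ne, Ideal.absNorm_eq_zero_iff, Ideal.span_singleton_eq_bot]
    exact hx
  · obtain ⟨z, hz⟩ := Ideal.mem_span_singleton'.mp (Ideal.absNorm_mem (Ideal.span {x}))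
    have : ((Ideal.absNorm (Ideal.span {x}) : ℕ) : K) * (y : K) =
        (z * y) • algebraMap (𝓞 K) K x := by
      have := congrArg (algebraMap (𝓞 K) K) hz
      rw [map_mul, map_natCast] at this
      rw [← this, Algebra.smul_def, map_mul]
      ring
    rw [this]
    exact Submodule.smul_mem _ _ hxP

theorem exists_nat_mul_mem_forall {β : Type*} [Finite β] (P : β → Idl K) :
    ∃ N : ℕ, N ≠ 0 ∧ ∀ b, ∀ y : 𝓞 K, (N : K) * (y : K) ∈ (P b).1 := by
  classical
  have := Fintype.ofFinite β
  choose N hN hmem using fun b => exists_nat_mul_mem (P b)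
  refine ⟨∏ b, N b, Finset.prod_ne_zero_iff.mpr fun b _ => hN b, fun b y => ?_⟩
  rw [← Finset.mul_prod_erase _ _ (Finset.mem_univ b)]
  have := hmem b (((∏ a ∈ Finset.univ.erase b, N a : ℕ) : 𝓞 K) * y)
  push_cast at this ⊢
  rw [mul_assoc]
  exact this

variable [NumberField.IsTotallyReal K]

variable (K) in
/-- Over a totally real field, real and complex embeddings are the same. -/
def realEmbEquiv : (K →+* ℝ) ≃ (K →+* ℂ) where
  toFun φ := Complex.ofRealHom.comp φ
  invFun ψ := (NumberField.IsTotallyReal.complexEmbedding_isReal ψ).embedding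
  left_inv φ := by
    ext x
    simp [NumberField.ComplexEmbedding.IsReal.embedding]
  right_inv ψ := by
    ext x
    simp

theorem sum_realEmb_eq_trace (x : K) :
    ∑ φ : K →+* ℝ, φ x = ((Algebra.trace ℚ K x : ℚ) : ℝ) := by
  apply Complex.ofReal_injective
  have h := trace_eq_sum_embeddings (K := ℚ) (L := K) ℂ (x := x)
  rw [eq_ratCast] at h
  push_cast
  rw [h, ← (RingHom.equivRatAlgHom K ℂ).sum_comp, ← (realEmbEquiv K).sum_comp]
  rfl

variable (K) in
theorem card_realEmb : Fintype.card (K →+* ℝ) = Module.finrank ℚ K := by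
  rw [Fintype.card_congr (realEmbEquiv K), NumberField.Embeddings.card]

variable (K) in
/-- The basis dual to the integral basis with respect to the trace form. -/
def dualBasis : Module.Basis (Module.Free.ChooseBasisIndex ℤ (𝓞 K)) ℚ K :=
  (Algebra.traceForm ℚ K).dualBasis (traceForm_nondegenerate ℚ K) (NumberField.integralBasis K)

theorem sum_emb_basis_mul_dual (r s : Module.Free.ChooseBasisIndex ℤ (𝓞 K)) :
    ∑ φ : K →+* ℝ, φ (NumberField.integralBasis K r) * φ (dualBasis K s) =
      if r = s then 1 else 0 := by
  have h := LinearMap.BilinForm.apply_dualBasis_left (B := Algebra.traceForm ℚ K)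
    (traceForm_nondegenerate ℚ K) (NumberField.integralBasis K) s r
  rw [Algebra.traceForm_apply] at h
  simp only [← map_mul]
  rw [sum_realEmb_eq_trace, mul_comm, dualBasis, h]
  split_ifs <;> simp

/-- The second orthogonality relation of dual bases, which follows from the first one as the matrix
of the embeddings of a basis is square. -/
theorem sum_basis_emb_mul_dual [DecidableEq (K →+* ℝ)] (φ ψ : K →+* ℝ) :
    ∑ r, φ (NumberField.integralBasis K r) * ψ (dualBasis K r) = if φ = ψ then 1 else 0 := by
  classical
  set P : Matrix (Module.Free.ChooseBasisIndex ℤ (𝓞 K)) (K →+* ℝ) ℝ :=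
    Matrix.of fun r φ => φ (dualBasis K r)
  set Q : Matrix (K →+* ℝ) (Module.Free.ChooseBasisIndex ℤ (𝓞 K)) ℝ :=
    Matrix.of fun φ r => φ (NumberField.integralBasis K r)
  have hPQ : P * Q = 1 := by
    ext r s
    rw [Matrix.mul_apply, Matrix.one_apply]
    have := sum_emb_basis_mul_dual (K := K) s r
    simp only [P, Q, Matrix.of_apply]
    simp only [mul_comm] at this ⊢
    rw [this]
    simp [eq_comm]
  have hcard : Fintype.card (Module.Free.ChooseBasisIndex ℤ (𝓞 K)) =
      Fintype.card (K →+* ℝ) := by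
    rw [card_realEmb, Module.finrank_eq_card_basis (NumberField.integralBasis K)]
  have hQP : Q * P = 1 := (Matrix.mul_eq_one_comm_of_card_eq _ _ _ hcard).mp hPQ
  have := congrFun (congrFun hQP φ) ψ
  rw [Matrix.mul_apply, Matrix.one_apply] at this
  exact this

/-- Integers which are arbitrarily large at one real embedding and bounded at all the others:
multiples of a high power of a unit that is small at the other embeddings. -/
theorem exists_integer_large_at (φ₀ : K →+* ℝ) (j : ℕ) :
    ∃ y : 𝓞 K, (∀ φ : K →+* ℝ, φ ≠ φ₀ → |φ y| ≤ 1) ∧ (j : ℝ) ≤ |φ₀ y| := by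
  set pl : (K →+* ℝ) → NumberField.InfinitePlace K :=
    fun φ => NumberField.InfinitePlace.mk (realEmbEquiv K φ) with hpl
  have hplv : ∀ φ x, pl φ x = |φ x| := fun φ x => by
    simp [hpl, realEmbEquiv, NumberField.InfinitePlace.apply]
  have hinj : ∀ φ, pl φ = pl φ₀ → φ = φ₀ := fun φ h => by
    rcases NumberField.InfinitePlace.mk_eq_iff.mp h with h | h
    · exact (realEmbEquiv K).injective h
    · have hr := NumberField.ComplexEmbedding.isReal_iff.mp
        (NumberField.IsTotallyReal.complexEmbedding_isReal (realEmbEquiv K φ))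
      exact (realEmbEquiv K).injective (hr.symm.trans h)
  obtain ⟨u, hu⟩ := NumberField.Units.dirichletUnitTheorem.exists_unit K (pl φ₀)
  have hune : ∀ φ : K →+* ℝ, φ ((u : 𝓞 K) : K) ≠ 0 := fun φ => by simp
  have hlt : ∀ φ : K →+* ℝ, φ ≠ φ₀ → |φ ((u : 𝓞 K) : K)| < 1 := fun φ hφ => by
    have h := hu (pl φ) fun h => hφ (hinj φ h)
    rw [hplv] at h
    exact (Real.log_neg_iff (abs_pos.mpr (hune φ))).mp h
  have hge : 1 ≤ |φ₀ ((u : 𝓞 K) : K)| := by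
    have hsum := NumberField.Units.sum_mult_mul_log u
    classical
    rw [← Finset.add_sum_erase _ _ (Finset.mem_univ (pl φ₀))] at hsum
    have hneg : ∑ w ∈ Finset.univ.erase (pl φ₀),
        (w.mult : ℝ) * Real.log (w ((u : 𝓞 K) : K)) ≤ 0 :=
      Finset.sum_nonpos fun w hw => mul_nonpos_of_nonneg_of_nonpos (Nat.cast_nonneg _)
        (hu w (Finset.ne_of_mem_erase hw)).le
    have h0 : 0 ≤ Real.log (pl φ₀ ((u : 𝓞 K) : K)) := by
      have hm : (0 : ℝ) < (pl φ₀).mult := by exact_mod_cast NumberField.InfinitePlace.mult_pos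
      have : 0 ≤ ((pl φ₀).mult : ℝ) * Real.log (pl φ₀ ((u : 𝓞 K) : K)) := by linarith
      exact (mul_nonneg_iff_of_pos_left hm).mp this
    rw [hplv] at h0
    exact (Real.log_nonneg_iff (abs_pos.mpr (hune φ₀))).mp h0
  have hev : ∀ φ : K →+* ℝ, ∀ᶠ e : ℕ in atTop, φ ≠ φ₀ →
      (j : ℝ) * |φ ((u : 𝓞 K) : K)| ^ e ≤ 1 := fun φ => by
    by_cases hφ : φ = φ₀
    · exact Eventually.of_forall fun e h => absurd hφ h
    · have := (tendsto_pow_atTop_nhds_zero_of_lt_one (abs_nonneg _) (hlt φ hφ)).const_mul (j : ℝ)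
      rw [mul_zero] at this
      filter_upwards [this.eventually_le_const zero_lt_one] with e he _
      exact he
  obtain ⟨e, he⟩ := (eventually_all.mpr hev).exists
  refine ⟨j * (u : 𝓞 K) ^ e, fun φ hφ => ?_, ?_⟩
  · simpa [abs_mul, abs_pow] using he φ hφ
  · simp only [map_mul, map_natCast, map_pow, abs_mul, abs_pow, Nat.abs_cast]
    exact le_mul_of_one_le_right (Nat.cast_nonneg _) (one_le_pow₀ hge)

end Arithmetic

/-! ### Coordinates on families of symmetric matrices -/

/-- A sum over ordered pairs counts the off-diagonal unordered pairs twice. -/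
theorem sum_sym2 {α : Type*} [Fintype α] [DecidableEq α] (G : Sym2 α → ℂ) :
    ∑ i, ∑ j, (if i = j then 2 else 1) * G s(i, j) = 2 * ∑ p, G p := by
  rw [← Finset.sum_product', ← Finset.sum_fiberwise (Finset.univ ×ˢ Finset.univ)
    (fun p : α × α => s(p.1, p.2)), Finset.mul_sum]
  refine Finset.sum_congr rfl fun q _ => ?_
  induction q using Sym2.ind with
  | _ a b =>
    have hfib : (Finset.univ ×ˢ Finset.univ : Finset (α × α)).filter
        (fun p => s(p.1, p.2) = s(a, b)) = {(a, b), (b, a)} := by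
      ext ⟨x, y⟩
      simp
    rw [hfib]
    by_cases hab : a = b
    · subst hab
      simp
    · rw [Finset.sum_pair (by simp [hab])]
      simp only [hab, Ne.symm hab, if_false, Sym2.eq_swap (a := b)]
      ring

section Coordinates

variable (n : ℕ) (K : Type*) [Field K] [NumberField K]

/-- Indices of the coordinates on families of symmetric matrices: a symmetric pair of indices
together with an element of the integral basis of `K`. -/
abbrev CoordIdx : Type _ := Sym2 (Fin n) × Module.Free.ChooseBasisIndex ℤ (𝓞 K)

variable {n K}

/-- The family of symmetric matrices with given coordinates, the lattice of integral coordinates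
being `N` times that of symmetric matrices over `𝓞 K`. -/
def coordMat (N : ℕ) (z : CoordIdx n K → ℂ) (φ : K →+* ℝ) : Matrix (Fin n) (Fin n) ℂ :=
  Matrix.of fun i j => N * ∑ r, ((φ (NumberField.integralBasis K r) : ℝ) : ℂ) * z (s(i, j), r)

/-- The real analogue of `coordMat`. -/
def realMat (N : ℕ) (y : CoordIdx n K → ℝ) (φ : K →+* ℝ) : Matrix (Fin n) (Fin n) ℝ :=
  Matrix.of fun i j => N * ∑ r, φ (NumberField.integralBasis K r) * y (s(i, j), r)

theorem coordMat_cvec (N : ℕ) (y : CoordIdx n K → ℝ) (φ : K →+* ℝ) :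
    coordMat N (cvec y) φ = (realMat N y φ).map fun x : ℝ => (x : ℂ) := by
  ext i j
  simp [coordMat, realMat, cvec]

theorem coordMat_add (N : ℕ) (z w : CoordIdx n K → ℂ) (φ : K →+* ℝ) :
    coordMat N (z + w) φ = coordMat N z φ + coordMat N w φ := by
  ext i j
  simp [coordMat, mul_add, Finset.sum_add_distrib]

theorem coordMat_smul (N : ℕ) (a : ℂ) (z : CoordIdx n K → ℂ) (φ : K →+* ℝ) :
    coordMat N (a • z) φ = a • coordMat N z φ := by
  ext i j
  simp only [coordMat, Matrix.of_apply, Pi.smul_apply, smul_eq_mul, Matrix.smul_apply,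
    Finset.mul_sum]
  exact Finset.sum_congr rfl fun r _ => by ring

theorem isSymm_coordMat (N : ℕ) (z : CoordIdx n K → ℂ) (φ : K →+* ℝ) :
    (coordMat N z φ).IsSymm := by
  ext i j
  simp [coordMat, Sym2.eq_swap (a := i)]

theorem isSymm_realMat (N : ℕ) (y : CoordIdx n K → ℝ) (φ : K →+* ℝ) :
    (realMat N y φ).IsSymm := by
  ext i j
  simp [realMat, Sym2.eq_swap (a := i)]

theorem coordMat_im (N : ℕ) (z : CoordIdx n K → ℂ) (φ : K →+* ℝ) :
    (coordMat N z φ).map Complex.im = realMat N (fun p => (z p).im) φ := by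
  ext i j
  have : ((N : ℂ) * ∑ r, ((φ (NumberField.integralBasis K r) : ℝ) : ℂ) * z (s(i, j), r)).im =
      N * (∑ r, ((φ (NumberField.integralBasis K r) : ℝ) : ℂ) * z (s(i, j), r)).im := by
    rw [← Complex.ofReal_natCast, Complex.im_ofReal_mul]
  simp only [coordMat, realMat, Matrix.map_apply, Matrix.of_apply]
  rw [this, Complex.im_sum]
  simp only [Complex.im_ofReal_mul]

variable (n K) in
/-- The cone of coordinates of families of positive definite matrices. -/
def posCone (N : ℕ) : Set (CoordIdx n K → ℝ) := {y | ∀ φ, (realMat N y φ).PosDef}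

theorem isPt_coordMat_iff (N : ℕ) (z : CoordIdx n K → ℂ) :
    IsPt (coordMat N z) ↔ z ∈ tube (posCone n K N) := by
  simp only [IsPt, isSymm_coordMat, true_and, coordMat_im]
  rfl

theorem isOpen_posCone (N : ℕ) : IsOpen (posCone n K N) := by
  rw [isOpen_iff_mem_nhds]
  intro y hy
  have : ∀ φ : K →+* ℝ, ∀ᶠ y' in 𝓝 y, (realMat N y' φ).PosDef := fun φ => by
    have hc : Continuous fun y' : CoordIdx n K → ℝ => realMat N y' φ := by
      refine continuous_matrix fun i j => ?_
      simp only [realMat, Matrix.of_apply]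
      fun_prop
    filter_upwards [hc.continuousAt.eventually (eventually_posDef (hy φ))] with y' h
    exact h (isSymm_realMat N y' φ)
  exact eventually_all.mpr this

theorem convex_posCone (N : ℕ) : Convex ℝ (posCone n K N) := by
  intro x hx y hy a b ha hb hab φ
  have : realMat N (a • x + b • y) φ = a • realMat N x φ + b • realMat N y φ := by
    ext i j
    simp only [realMat, Matrix.of_apply, Pi.add_apply, Pi.smul_apply, smul_eq_mul,
      Matrix.add_apply, Matrix.smul_apply, mul_add, Finset.sum_add_distrib, Finset.mul_sum]
    congr 1 <;> exact Finset.sum_congr rfl fun r _ => by ring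
  rw [this]
  rcases ha.eq_or_lt with rfl | ha
  · rw [zero_smul, zero_add]
    exact (hy φ).smul (by linarith)
  · exact ((hx φ).smul ha).add_posSemidef ((hy φ).posSemidef.smul hb)

/-- The symmetric matrix over `K` giving the character with exponents `m` in the coordinates of
`coordMat N`. The diagonal is doubled as `e{Tτ}` involves `πi` and not `2πi`. -/
def dualMat [NumberField.IsTotallyReal K] (N : ℕ) (m : CoordIdx n K → ℤ) :
    Matrix (Fin n) (Fin n) K :=
  Matrix.of fun i j =>
    (N : K)⁻¹ * ((if i = j then 2 else 1) * ∑ r, (m (s(i, j), r) : K) * dualBasis K r)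

variable [NumberField.IsTotallyReal K]

theorem exists_realMat_eq {N : ℕ} (hN : N ≠ 0) (M : (K →+* ℝ) → Matrix (Fin n) (Fin n) ℝ)
    (hM : ∀ φ, (M φ).IsSymm) : ∃ y : CoordIdx n K → ℝ, realMat N y = M := by
  classical
  refine ⟨fun p => (N : ℝ)⁻¹ * ∑ φ : K →+* ℝ, φ (dualBasis K p.2) *
    Sym2.lift ⟨fun i j => M φ i j, fun i j => (hM φ).apply j i⟩ p.1, ?_⟩
  funext φ
  ext i j
  have hN' : (N : ℝ) ≠ 0 := by exact_mod_cast hN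
  simp only [realMat, Matrix.of_apply, Sym2.lift_mk]
  calc _ = ∑ r, ∑ ψ : K →+* ℝ,
        (φ (NumberField.integralBasis K r) * ψ (dualBasis K r)) * M ψ i j := by
        rw [Finset.mul_sum]
        refine Finset.sum_congr rfl fun r _ => ?_
        rw [mul_left_comm _ (N : ℝ)⁻¹, mul_inv_cancel_left₀ hN', Finset.mul_sum]
        exact Finset.sum_congr rfl fun ψ _ => by ring
    _ = ∑ ψ : K →+* ℝ, (if φ = ψ then 1 else 0) * M ψ i j := by
        rw [Finset.sum_comm]
        refine Finset.sum_congr rfl fun ψ _ => ?_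
        rw [← Finset.sum_mul, sum_basis_emb_mul_dual]
    _ = M φ i j := by simp

theorem exists_coordMat_eq {N : ℕ} (hN : N ≠ 0) (M : (K →+* ℝ) → Matrix (Fin n) (Fin n) ℂ)
    (hM : ∀ φ, (M φ).IsSymm) : ∃ z : CoordIdx n K → ℂ, coordMat N z = M := by
  have hsymm : ∀ (f : ℂ → ℝ) φ, ((M φ).map f).IsSymm := fun f φ => by
    have h : (M φ)ᵀ = M φ := hM φ
    rw [Matrix.IsSymm, ← Matrix.transpose_map, h]
  obtain ⟨x, hx⟩ := exists_realMat_eq hN (fun φ => (M φ).map Complex.re) (hsymm _)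
  obtain ⟨y, hy⟩ := exists_realMat_eq hN (fun φ => (M φ).map Complex.im) (hsymm _)
  refine ⟨cvec x + Complex.I • cvec y, funext fun φ => ?_⟩
  rw [coordMat_add, coordMat_smul, coordMat_cvec, coordMat_cvec, hx, hy]
  ext i j
  simp only [Matrix.add_apply, Matrix.map_apply, Matrix.smul_apply, smul_eq_mul]
  rw [mul_comm, Complex.re_add_im]

theorem isSymm_dualMat (N : ℕ) (m : CoordIdx n K → ℤ) : (dualMat N m).IsSymm := by
  ext i j
  simp [dualMat, Sym2.eq_swap (a := i), eq_comm (a := i)]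

theorem trace_dualMat_mul_coordMat {N : ℕ} (hN : N ≠ 0) (m : CoordIdx n K → ℤ)
    (z : CoordIdx n K → ℂ) :
    Matrix.trace (∑ φ : K →+* ℝ, emb φ (dualMat N m) * coordMat N z φ) =
      2 * ∑ p, (m p : ℂ) * z p := by
  have hN' : (N : ℂ) ≠ 0 := by exact_mod_cast hN
  have horth : ∀ r s : Module.Free.ChooseBasisIndex ℤ (𝓞 K),
      ∑ φ : K →+* ℝ, ((φ (dualBasis K r) : ℝ) : ℂ) * ((φ (NumberField.integralBasis K s) : ℝ) : ℂ)
        = if s = r then 1 else 0 := fun r s => by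
    have := congrArg (fun x : ℝ => (x : ℂ)) (sum_emb_basis_mul_dual (K := K) s r)
    simp only [Complex.ofReal_sum, Complex.ofReal_mul] at this
    simp only [mul_comm] at this ⊢
    rw [this]
    split_ifs <;> simp
  have hentry : ∀ i j : Fin n, ∑ φ : K →+* ℝ, emb φ (dualMat N m) i j * coordMat N z φ j i =
      (if i = j then 2 else 1) * ∑ r, (m (s(i, j), r) : ℂ) * z (s(i, j), r) := by
    intro i j
    set κ : ℂ := if i = j then 2 else 1 with hκ
    have h1 : ∀ φ : K →+* ℝ, emb φ (dualMat N m) i j * coordMat N z φ j i =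
        κ * ∑ r, ∑ s, ((m (s(i, j), r) : ℂ) * z (s(i, j), s)) *
          (((φ (dualBasis K r) : ℝ) : ℂ) * ((φ (NumberField.integralBasis K s) : ℝ) : ℂ)) := by
      intro φ
      have e1 : emb φ (dualMat N m) i j =
          (N : ℂ)⁻¹ * (κ * ∑ r, (m (s(i, j), r) : ℂ) * ((φ (dualBasis K r) : ℝ) : ℂ)) := by
        simp only [emb, dualMat, Matrix.map_apply, Matrix.of_apply, map_mul, map_inv₀,
          map_natCast, map_sum, map_intCast, Complex.ofReal_mul, Complex.ofReal_inv,
          Complex.ofReal_natCast, Complex.ofReal_sum, Complex.ofReal_intCast, hκ]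
        split_ifs <;> simp [map_ofNat]
      have e2 : coordMat N z φ j i =
          N * ∑ s, ((φ (NumberField.integralBasis K s) : ℝ) : ℂ) * z (s(i, j), s) := by
        simp [coordMat, Sym2.eq_swap (a := j)]
      rw [e1, e2]
      have : ∀ a b : ℂ, (N : ℂ)⁻¹ * (κ * a) * (N * b) = κ * (a * b) := fun a b => by
        field_simp
      rw [this, Finset.sum_mul_sum]
      congr 1
      exact Finset.sum_congr rfl fun r _ => Finset.sum_congr rfl fun s _ => by ring
    simp only [h1]
    rw [← Finset.mul_sum, Finset.sum_comm]
    congr 1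
    refine Finset.sum_congr rfl fun r _ => ?_
    rw [Finset.sum_comm]
    simp only [← Finset.mul_sum, horth]
    simp
  rw [Matrix.trace_sum]
  simp only [Matrix.trace, Matrix.diag, Matrix.mul_apply]
  rw [Finset.sum_comm]
  simp_rw [Finset.sum_comm (s := (Finset.univ : Finset (K →+* ℝ))), hentry]
  rw [sum_sym2 (fun p => ∑ r, (m (p, r) : ℂ) * z (p, r)), Fintype.sum_prod_type]

theorem rawExp_dualMat {N : ℕ} (hN : N ≠ 0) (m : CoordIdx n K → ℤ) (z : CoordIdx n K → ℂ) :
    rawExp (dualMat N m) (coordMat N z) = expZ m z := by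
  rw [rawExp, trace_dualMat_mul_coordMat hN, expZ]
  congr 1
  ring

theorem dualMat_injective {N : ℕ} (hN : N ≠ 0) :
    Function.Injective (dualMat N : (CoordIdx n K → ℤ) → Matrix (Fin n) (Fin n) K) := by
  classical
  intro m m' h
  funext p
  have h1 := trace_dualMat_mul_coordMat hN m (Pi.single p 1)
  rw [h, trace_dualMat_mul_coordMat hN m'] at h1
  simpa [Pi.single_apply] using h1.symm

end Coordinates

/-! ### The Koecher principle -/

section Koecher

variable {n : ℕ} {K : Type*} [Field K]

theorem emb_one (φ : K →+* ℝ) : emb φ (1 : Matrix (Fin n) (Fin n) K) = 1 := by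
  ext i j
  by_cases h : i = j <;> simp [emb, Matrix.one_apply, h]

theorem emb_zero (φ : K →+* ℝ) : emb φ (0 : Matrix (Fin n) (Fin n) K) = 0 := by
  ext i j
  simp [emb]

theorem det_emb (φ : K →+* ℝ) (A : Matrix (Fin n) (Fin n) K) :
    (emb φ A).det = ((φ A.det : ℝ) : ℂ) :=
  ((Complex.ofRealHom.comp φ).map_det A).symm

/-- The similitude `τ ↦ τ + S`. -/
def transl (S : Matrix (Fin n) (Fin n) K) (hS : S.IsSymm) : Similitude n K where
  A := 1
  B := S
  C := 0
  D := 1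
  symm_AB := by
    rw [Matrix.one_mul]
    exact hS.transpose
  symm_CD := by simp [Matrix.IsSymm]
  exists_mult := ⟨1, fun φ => by simp, by simp⟩

theorem extendZero_slash_transl [Fintype (K →+* ℝ)] (k : ℤ) (f : HalfSpaceProd n K → ℂ)
    (S : Matrix (Fin n) (Fin n) K) (hS : S.IsSymm)
    {M : (K →+* ℝ) → Matrix (Fin n) (Fin n) ℂ} (h : IsPt M) :
    extendZero (slash k f (transl S hS)) M = extendZero f fun φ => M φ + emb φ S := by
  have h1 : ∀ φ, rawDenom (transl S hS) M φ = 1 := fun φ => by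
    simp [rawDenom, transl, emb_one, emb_zero]
  rw [extendZero_slash k f _ h]
  have h2 : rawMoebius (transl S hS) M = fun φ => M φ + emb φ S := by
    funext φ
    rw [rawMoebius, h1]
    simp [transl, emb_one]
  rw [h2]
  simp only [h1]
  simp [transl]

theorem rawDenom_levi (X : GL (Fin n) K) (M : (K →+* ℝ) → Matrix (Fin n) (Fin n) ℂ)
    (φ : K →+* ℝ) : rawDenom (levi X) M φ = emb φ (X⁻¹).1ᵀ := by
  simp [rawDenom, levi, emb_zero]

theorem rawMoebius_levi (X : GL (Fin n) K) (M : (K →+* ℝ) → Matrix (Fin n) (Fin n) ℂ) :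
    rawMoebius (levi X) M = fun φ => emb φ X.1 * M φ * (emb φ X.1)ᵀ := by
  funext φ
  rw [rawMoebius, rawDenom_levi]
  have : (emb φ (X⁻¹).1ᵀ)⁻¹ = (emb φ X.1)ᵀ := by
    refine Matrix.inv_eq_right_inv ?_
    rw [emb_transpose, ← emb_mul, ← Matrix.transpose_mul, X.mul_inv, Matrix.transpose_one, emb_one]
  rw [this]
  simp [levi, emb_zero]

theorem extendZero_slash_levi [Fintype (K →+* ℝ)] (k : ℤ) (f : HalfSpaceProd n K → ℂ)
    (X : GL (Fin n) K) (hX : X.1.det = 1)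
    {M : (K →+* ℝ) → Matrix (Fin n) (Fin n) ℂ} (h : IsPt M) :
    extendZero (slash k f (levi X)) M =
      extendZero f fun φ => emb φ X.1 * M φ * (emb φ X.1)ᵀ := by
  rw [extendZero_slash k f _ h, rawMoebius_levi]
  have h3 : (levi X).A * (levi X).Dᵀ - (levi X).B * (levi X).Cᵀ = 1 := by
    simp only [levi, Matrix.transpose_transpose, Matrix.zero_mul, sub_zero]
    exact X.mul_inv
  rw [h3]
  simp [rawDenom_levi, det_emb, hX]

/-- The unipotent matrix `1 + v ᵗw`, for `w` orthogonal to `v`. -/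
def unipotent (v w : Fin n → K) (hvw : w ⬝ᵥ v = 0) : GL (Fin n) K where
  val := 1 + Matrix.vecMulVec v w
  inv := 1 - Matrix.vecMulVec v w
  val_inv := by
    rw [Matrix.mul_sub, Matrix.mul_one, Matrix.add_mul, Matrix.one_mul,
      Matrix.vecMulVec_mul_vecMulVec, hvw]
    simp
  inv_val := by
    rw [Matrix.mul_add, Matrix.mul_one, Matrix.sub_mul, Matrix.one_mul,
      Matrix.vecMulVec_mul_vecMulVec, hvw]
    simp

theorem det_unipotent (v w : Fin n → K) (hvw : w ⬝ᵥ v = 0) :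
    (unipotent v w hvw).1.det = 1 := by
  have := Matrix.det_one_add_replicateCol_mul_replicateRow (ι := Unit) v w
  rw [← Matrix.vecMulVec_eq, hvw, add_zero] at this
  exact this

theorem trace_mul_unipotent (T : Matrix (Fin n) (Fin n) K) (hT : T.IsSymm) (v w : Fin n → K)
    (x : K) (hvw' : w ⬝ᵥ (x • v) = 0) :
    (T * ((unipotent (x • v) w hvw').1 * (unipotent (x • v) w hvw').1ᵀ)).trace =
      T.trace + x * (2 * (w ⬝ᵥ T *ᵥ v)) + x ^ 2 * ((w ⬝ᵥ w) * (v ⬝ᵥ T *ᵥ v)) := by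
  have hsym : v ⬝ᵥ T *ᵥ w = w ⬝ᵥ T *ᵥ v := by
    rw [Matrix.dotProduct_mulVec, ← Matrix.mulVec_transpose, hT.eq, dotProduct_comm]
  have h1 : (unipotent (x • v) w hvw').1 * (unipotent (x • v) w hvw').1ᵀ =
      1 + x • Matrix.vecMulVec v w + x • Matrix.vecMulVec w v +
        (x ^ 2 * (w ⬝ᵥ w)) • Matrix.vecMulVec v v := by
    have h2 : (Matrix.vecMulVec v w)ᵀ = Matrix.vecMulVec w v := Matrix.transpose_vecMulVec _ _
    have h3 : Matrix.vecMulVec v w * Matrix.vecMulVec w v = (w ⬝ᵥ w) • Matrix.vecMulVec v v := by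
      rw [Matrix.vecMulVec_mul_vecMulVec, Matrix.vecMulVec_smul]
    have h4 : (unipotent (x • v) w hvw').1 = 1 + x • Matrix.vecMulVec v w := by
      simp [unipotent, Matrix.smul_vecMulVec]
    rw [h4, Matrix.transpose_add, Matrix.transpose_one, Matrix.transpose_smul, h2, Matrix.mul_add,
      Matrix.mul_one, Matrix.add_mul, Matrix.one_mul, Matrix.smul_mul, Matrix.mul_smul, h3]
    module
  rw [h1]
  simp only [Matrix.mul_add, Matrix.mul_smul, Matrix.trace_add, Matrix.trace_smul, Matrix.mul_one,
    Matrix.mul_vecMulVec, Matrix.trace_vecMulVec, smul_eq_mul]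
  rw [dotProduct_comm (T *ᵥ v) w, dotProduct_comm (T *ᵥ w) v, dotProduct_comm (T *ᵥ v) v, hsym]
  ring

/-- A form that takes a negative value takes one at an integral vector, since rational vectors are
dense. -/
theorem exists_int_dotProduct_neg {S : Matrix (Fin n) (Fin n) ℝ} (hS : S.IsSymm)
    (hneg : ¬ S.PosSemidef) :
    ∃ v : Fin n → ℤ, (fun i => (v i : ℝ)) ⬝ᵥ S *ᵥ (fun i => (v i : ℝ)) < 0 := by
  have h1 : ∃ v : Fin n → ℝ, v ⬝ᵥ S *ᵥ v < 0 := by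
    by_contra! h
    refine hneg (Matrix.PosSemidef.of_dotProduct_mulVec_nonneg ?_ fun v => by simpa using h v)
    rw [Matrix.IsHermitian, Matrix.conjTranspose_eq_transpose_of_trivial]
    exact hS
  have hopen : IsOpen {v : Fin n → ℝ | v ⬝ᵥ S *ᵥ v < 0} :=
    isOpen_lt (Continuous.dotProduct continuous_id
      (Continuous.matrix_mulVec continuous_const continuous_id)) continuous_const
  have hdense : DenseRange (Pi.map fun _ : Fin n => ((↑) : ℚ → ℝ)) :=
    DenseRange.piMap fun _ => Rat.denseRange_cast
  obtain ⟨q, hq⟩ := hdense.exists_mem_open hopen h1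
  obtain ⟨b, hb⟩ := IsLocalization.exist_integer_multiples_of_finite ℤ⁰ q
  choose v hv using hb
  refine ⟨v, ?_⟩
  have hb0 : (b.1 : ℝ) ≠ 0 := by exact_mod_cast nonZeroDivisors.ne_zero b.2
  have hv' : (fun i => (v i : ℝ)) = (b.1 : ℝ) • Pi.map (fun _ : Fin n => ((↑) : ℚ → ℝ)) q := by
    funext i
    have := hv i
    simp only [algebraMap_int_eq, eq_intCast, zsmul_eq_mul] at this
    have := congrArg ((↑) : ℚ → ℝ) this
    push_cast at this
    simpa using this
  rw [hv', Matrix.mulVec_smul, smul_dotProduct, dotProduct_smul, smul_eq_mul, smul_eq_mul,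
    ← mul_assoc]
  exact mul_neg_of_pos_of_neg (mul_self_pos.mpr hb0) hq

/-- This is where the degree has to exceed `1`. -/
theorem exists_int_orthogonal (hn : 1 < n) (v : Fin n → ℤ) (hv : v ≠ 0) :
    ∃ w : Fin n → ℤ, w ≠ 0 ∧ w ⬝ᵥ v = 0 := by
  obtain ⟨i, hi⟩ := Function.ne_iff.mp hv
  have : Nontrivial (Fin n) := Fin.nontrivial_iff_two_le.mpr hn
  obtain ⟨j, hj⟩ := exists_ne i
  refine ⟨Pi.single j (v i) - Pi.single i (v j), ?_, ?_⟩
  · intro h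
    have := congrFun h j
    simp [hj] at this
    exact hi this
  · rw [sub_dotProduct, single_dotProduct, single_dotProduct]
    ring

theorem zero_mem_idl [NumberField K] (P : FractionalIdeal (𝓞 K)⁰ K) : (0 : K) ∈ P :=
  Submodule.zero_mem (P : Submodule (𝓞 K) K)

theorem one_apply_mem [NumberField K] (P : Fin n → Idl K) (i j : Fin n) :
    (1 : Matrix (Fin n) (Fin n) K) i j ∈ (P i * (P j)⁻¹ : Idl K).1 := by
  by_cases hij : i = j
  · subst hij
    rw [mul_inv_cancel, Matrix.one_apply_eq]
    exact FractionalIdeal.one_mem_one (𝓞 K)⁰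
  · rw [Matrix.one_apply_ne hij]
    exact zero_mem_idl _

variable (K) in
theorem different_ne_zero [NumberField K] : different K ≠ 0 := by
  rw [different, FractionalIdeal.coeIdeal_ne_zero]
  exact differentIdeal_ne_bot

variable (K) in
/-- The different, as an element of the group of fractional ideals. -/
def dif [NumberField K] : Idl K := Units.mk0 (different K) (different_ne_zero K)

end Koecher

section Expansion

variable {n : ℕ} {K : Type*} [Field K] [NumberField K] [NumberField.IsTotallyReal K]

/-- The traces of `T U ᵗU` take arbitrarily large negative values if `T` is not positive
semi-definite, where `U` runs over unipotent matrices congruent to `1` modulo `N`: take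
`U = 1 + x v ᵗw` with integral vectors `v`, `w` such that `T[v]` is negative at `φ₀` and `w` is
orthogonal to `v`, and `x` large at `φ₀` and bounded elsewhere. The trace is then quadratic in `x`
with leading coefficient `(ᵗw w) T[v]`. -/
theorem exists_unipotent_trace_lt (hn : 1 < n) {T : Matrix (Fin n) (Fin n) K} (hT : T.IsSymm)
    {φ₀ : K →+* ℝ} (hneg : ¬ (T.map φ₀).PosSemidef) (N : ℕ) (hN : N ≠ 0) (L : ℝ) :
    ∃ X : GL (Fin n) K, X.1.det = 1 ∧
      (∃ E : Matrix (Fin n) (Fin n) (𝓞 K),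
        X.1 = 1 + E.map (fun y => (N : K) * (y : K)) ∧
        X⁻¹.1 = 1 + E.map (fun y => (N : K) * ((-y : 𝓞 K) : K))) ∧
      ∑ φ : K →+* ℝ, φ (T * (X.1 * X.1ᵀ)).trace < L := by
  classical
  have hT' : (T.map φ₀).IsSymm := by
    have h : Tᵀ = T := hT
    rw [Matrix.IsSymm, ← Matrix.transpose_map, h]
  obtain ⟨v, hv⟩ := exists_int_dotProduct_neg hT' hneg
  have hv0 : v ≠ 0 := by
    rintro rfl
    simp at hv
  obtain ⟨w, hw0, hwv⟩ := exists_int_orthogonal hn v hv0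
  set vK : Fin n → K := fun i => (v i : K)
  set wK : Fin n → K := fun i => (w i : K)
  have hwvK : wK ⬝ᵥ vK = 0 := by
    have := congrArg (fun a : ℤ => (a : K)) hwv
    simpa [dotProduct, vK, wK] using this
  set t₀ := T.trace
  set t₁ := 2 * (wK ⬝ᵥ T *ᵥ vK)
  set t₂ := (wK ⬝ᵥ wK) * (vK ⬝ᵥ T *ᵥ vK)
  have ht₂ : φ₀ t₂ < 0 := by
    have e1 : φ₀ (wK ⬝ᵥ wK) = ((w ⬝ᵥ w : ℤ) : ℝ) := by simp [dotProduct, wK]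
    have e2 : φ₀ (vK ⬝ᵥ T *ᵥ vK) =
        (fun i => (v i : ℝ)) ⬝ᵥ (T.map φ₀) *ᵥ (fun i => (v i : ℝ)) := by
      simp [dotProduct, Matrix.mulVec, vK]
    rw [map_mul, e1, e2]
    refine mul_neg_of_pos_of_neg ?_ hv
    have : 0 < w ⬝ᵥ w := by
      refine lt_of_le_of_ne (Finset.sum_nonneg fun i _ => mul_self_nonneg _) fun h => hw0 ?_
      exact dotProduct_self_eq_zero.mp h.symm
    exact_mod_cast this
  have hN' : (1 : ℝ) ≤ N := by exact_mod_cast Nat.one_le_iff_ne_zero.mpr hN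
  -- `R` bounds the contribution of the embeddings other than `φ₀`.
  set R : ℝ := ∑ φ : K →+* ℝ, (|φ t₀| + N * |φ t₁| + N ^ 2 * |φ t₂|) with hR
  set δ : ℝ := -φ₀ t₂ with hδ
  have hδ0 : 0 < δ := by simpa [hδ] using ht₂
  obtain ⟨j, hj⟩ := exists_nat_gt ((|φ₀ t₁| + R + |L|) / δ + 1)
  obtain ⟨y, hy1, hy2⟩ := exists_integer_large_at φ₀ j
  set x : K := (N : K) * (y : K) with hx
  have hxv : wK ⬝ᵥ (x • vK) = 0 := by rw [dotProduct_smul, hwvK, smul_zero]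
  refine ⟨unipotent (x • vK) wK hxv, det_unipotent _ _ _,
    ⟨Matrix.of fun a b => y * ((v a : ℤ) : 𝓞 K) * ((w b : ℤ) : 𝓞 K), ?_, ?_⟩, ?_⟩
  · ext a b
    simp [unipotent, Matrix.vecMulVec_apply, hx, vK, wK]
    ring
  · ext a b
    simp [unipotent, Matrix.vecMulVec_apply, hx, vK, wK]
    ring
  · have htr : ∀ φ : K →+* ℝ, φ (T * ((unipotent (x • vK) wK hxv).1 *
        (unipotent (x • vK) wK hxv).1ᵀ)).trace = φ t₀ + φ x * φ t₁ + φ x ^ 2 * φ t₂ := fun φ => by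
      rw [trace_mul_unipotent T hT vK wK x hxv]
      simp [t₀, t₁, t₂]
    simp only [htr]
    rw [← Finset.add_sum_erase _ _ (Finset.mem_univ φ₀)]
    have hother : ∀ φ ∈ Finset.univ.erase φ₀, φ t₀ + φ x * φ t₁ + φ x ^ 2 * φ t₂ ≤
        |φ t₀| + N * |φ t₁| + N ^ 2 * |φ t₂| := fun φ hφ => by
      have hb : |φ x| ≤ N := by
        have := hy1 φ (Finset.ne_of_mem_erase hφ)
        rw [hx, map_mul, map_natCast, abs_mul, Nat.abs_cast]
        exact mul_le_of_le_one_right (Nat.cast_nonneg _) this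
      have h1 : φ x * φ t₁ ≤ N * |φ t₁| := (le_abs_self _).trans (by rw [abs_mul]; gcongr)
      have h2 : φ x ^ 2 * φ t₂ ≤ N ^ 2 * |φ t₂| :=
        (le_abs_self _).trans (by rw [abs_mul, abs_pow]; gcongr)
      linarith [le_abs_self (φ t₀)]
    have hsum := Finset.sum_le_sum hother
    have hRsplit : |φ₀ t₀| + N * |φ₀ t₁| + N ^ 2 * |φ₀ t₂| +
        ∑ φ ∈ Finset.univ.erase φ₀, (|φ t₀| + N * |φ t₁| + N ^ 2 * |φ t₂|) = R :=
      Finset.add_sum_erase _ (fun φ : K →+* ℝ => |φ t₀| + N * |φ t₁| + N ^ 2 * |φ t₂|)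
        (Finset.mem_univ φ₀)
    have hR0 : 0 ≤ R := Finset.sum_nonneg fun φ _ => by positivity
    set Z : ℝ := |φ₀ x| with hZ
    have hZj : (j : ℝ) ≤ Z := by
      rw [hZ, hx, map_mul, map_natCast, abs_mul, Nat.abs_cast]
      exact hy2.trans (le_mul_of_one_le_left (abs_nonneg _) hN')
    have hZ1 : (|φ₀ t₁| + R + |L|) / δ + 1 < Z := hj.trans_le hZj
    have hZ2 : |φ₀ t₁| + R + |L| < δ * (Z - 1) := by
      rw [← lt_sub_iff_add_lt, div_lt_iff₀ hδ0] at hZ1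
      linarith
    have hZ3 : 1 ≤ Z := by
      have : 0 ≤ (|φ₀ t₁| + R + |L|) / δ := by positivity
      linarith
    have hZsq : φ₀ x ^ 2 = Z ^ 2 := (sq_abs _).symm
    have h1 : φ₀ x * φ₀ t₁ ≤ Z * |φ₀ t₁| := (le_abs_self _).trans (by rw [abs_mul])
    have h2 : Z * (|φ₀ t₁| + R + |L|) ≤ Z * (δ * (Z - 1)) :=
      mul_le_mul_of_nonneg_left hZ2.le (by linarith)
    have h3 : R + |L| ≤ Z * (R + |L|) := le_mul_of_one_le_left (by positivity) hZ3
    have h4 : φ₀ x ^ 2 * φ₀ t₂ = -(Z ^ 2 * δ) := by rw [hZsq, hδ]; ring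
    have h5 : 0 ≤ N * |φ₀ t₁| + N ^ 2 * |φ₀ t₂| := by positivity
    have h6 : Z * (δ * (Z - 1)) < Z ^ 2 * δ := by nlinarith
    have h7 : Z * (|φ₀ t₁| + R + |L|) = Z * |φ₀ t₁| + Z * (R + |L|) := by ring
    linarith [neg_abs_le L, le_abs_self (φ₀ t₀)]

/-- The **Koecher principle**: for `n > 1`, holomorphic functions which are invariant under
`Γ(I₁,…,Iₙ;J)` have a Fourier expansion over positive semi-definite matrices. The translations in
the group give an expansion over all symmetric matrices. A coefficient at `T` is bounded by the same
multiple of `exp(π ∑_φ φ(tr(T U ᵗU)))` for all unipotent `U` in the group, and so vanishes unless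
`T` is positive semi-definite. -/
theorem hasFourierExpansion_of_holo (hn : 1 < n) (k : ℤ) (L : Label n K)
    {f : HalfSpaceProd n K → ℂ} (hf : Holo f) (hinv : ∀ g ∈ Gam L, slash k f g = f) :
    HasFourierExpansion f := by
  obtain ⟨N, hN, hNmem⟩ := exists_nat_mul_mem_forall
    (β := (Fin n × Fin n) × Fin 2) fun b => if b.2 = 0 then L.1 b.1.1 * (L.1 b.1.2)⁻¹ else
      L.1 b.1.1 * L.1 b.1.2 * L.2 * (dif K)⁻¹
  have hN1 : ∀ (i j : Fin n) (y : 𝓞 K), (N : K) * (y : K) ∈ (L.1 i * (L.1 j)⁻¹ : Idl K).1 :=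
    fun i j y => by simpa using hNmem ((i, j), 0) y
  have hN2 : ∀ (i j : Fin n) (y : 𝓞 K),
      (N : K) * (y : K) ∈ (L.1 i * L.1 j * L.2 : Idl K).1 * (different K)⁻¹ :=
    fun i j y => by simpa [dif] using hNmem ((i, j), 1) y
  set H : (CoordIdx n K → ℂ) → ℂ := fun z => extendZero f (coordMat N z) with hHdef
  have hcoordc : Continuous (coordMat N : (CoordIdx n K → ℂ) → _) := by
    refine continuous_pi fun φ => continuous_matrix fun i j => ?_
    simp only [coordMat, Matrix.of_apply]
    fun_prop
  have hHc : ContinuousOn H (tube (posCone n K N)) :=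
    hf.1.comp hcoordc.continuousOn fun z hz => (isPt_coordMat_iff N z).mpr hz
  have hHl : LineHolo (posCone n K N) H := by
    intro z v
    refine hf.2 _ (fun w => coordMat N (z + w • cvec v)) ?_ (fun φ i j => ?_) fun w hw =>
      (isPt_coordMat_iff N _).mpr hw
    · exact (isOpen_tube (isOpen_posCone N)).preimage (by fun_prop)
    · simp only [coordMat, Matrix.of_apply, Pi.add_apply, Pi.smul_apply, smul_eq_mul]
      fun_prop
  have hHp : IntPeriodic (posCone n K N) H := by
    intro z hz m
    have hpt := (isPt_coordMat_iff N z).mpr hz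
    set S : Matrix (Fin n) (Fin n) K := Matrix.of fun i j =>
      (N : K) * ((∑ r, (m (s(i, j), r) : 𝓞 K) * NumberField.RingOfIntegers.basis K r : 𝓞 K) : K)
      with hS
    have hSs : S.IsSymm := by
      ext i j
      simp [hS, Sym2.eq_swap (a := i)]
    have hmem : transl S hSs ∈ Gam L := by
      refine ⟨⟨1, fun φ => by simp, by simp [transl]⟩, fun i j => one_apply_mem L.1 i j,
        fun i j => hN2 i j _, fun i j => zero_mem_idl _, fun i j => ?_⟩
      rw [mul_comm (L.1 i)⁻¹, ← Matrix.transpose_apply (transl S hSs).D]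
      simpa only [transl, Matrix.transpose_one] using one_apply_mem L.1 j i
    have h1 := extendZero_slash_transl k f S hSs hpt
    rw [hinv _ hmem] at h1
    simp only [hHdef]
    rw [h1]
    congr 1
    funext φ
    rw [coordMat_add, coordMat_cvec]
    congr 1
    ext i j
    simp [realMat, emb, hS, mul_comm]
  obtain ⟨c, hsum, hest⟩ := exists_tube_expansion (isOpen_posCone N) (convex_posCone N) hHc hHl hHp
  -- A bound `B` for `|f|` on `i I + X`, with `X` real, is one on `i U ᵗU + X` as well.
  have hone : ∀ φ : K →+* ℝ, ((Complex.I • (1 : Matrix (Fin n) (Fin n) ℂ)).IsSymm) := fun _ => by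
    simp [Matrix.IsSymm]
  obtain ⟨z₀, hz₀⟩ := exists_coordMat_eq (n := n) (K := K) hN
    (fun _ => Complex.I • (1 : Matrix (Fin n) (Fin n) ℂ)) hone
  have hz₀t : z₀ ∈ tube (posCone n K N) := by
    rw [← isPt_coordMat_iff, hz₀]
    refine fun φ => ⟨hone φ, ?_⟩
    have : (Complex.I • (1 : Matrix (Fin n) (Fin n) ℂ)).map Complex.im = 1 := by
      ext i j
      by_cases h : i = j <;> simp [Matrix.one_apply, h]
    rw [this]
    exact Matrix.PosDef.one
  obtain ⟨B, hB⟩ := exists_forall_norm_le (isOpen_posCone N) hHc hHp hz₀t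
  -- A coefficient `c m` is bounded by `B exp(π tr(T U ᵗU))`, which can be made arbitrarily small.
  have hvan : ∀ m, (¬ ∀ φ : K →+* ℝ, ((dualMat N m).map φ).PosSemidef) → c m = 0 := by
    intro m hm
    push Not at hm
    obtain ⟨φ₀, hφ₀⟩ := hm
    by_contra hc0
    have hcpos : 0 < ‖c m‖ := norm_pos_iff.mpr hc0
    obtain ⟨X, hdet, ⟨E, hE1, hE2⟩, hlt⟩ := exists_unipotent_trace_lt hn
      (isSymm_dualMat N m) hφ₀ N hN (-(B / ‖c m‖) / Real.pi)
    have hmem : levi X ∈ Gam L := by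
      have haux : ∀ (E : Matrix (Fin n) (Fin n) (𝓞 K)) (i j : Fin n),
          (1 + E.map (fun y => (N : K) * (y : K))) i j ∈ (L.1 i * (L.1 j)⁻¹ : Idl K).1 := by
        intro E i j
        exact Submodule.add_mem _ (one_apply_mem L.1 i j) (hN1 i j _)
      refine ⟨⟨1, fun φ => by simp, ?_⟩, fun i j => ?_, fun i j => zero_mem_idl _,
        fun i j => zero_mem_idl _, fun i j => ?_⟩
      · simp only [levi, Matrix.transpose_transpose, Matrix.zero_mul, sub_zero]
        rw [X.mul_inv]
        simp
      · simp only [levi, hE1]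
        exact haux E i j
      · simp only [levi, Matrix.transpose_apply, hE2]
        rw [mul_comm (L.1 i)⁻¹]
        exact haux (E.map fun y => -y) j i
    have hXim : ∀ φ : K →+* ℝ, (Complex.I • (emb φ X.1 * (emb φ X.1)ᵀ)).IsSymm := fun φ => by
      simp [Matrix.IsSymm, Matrix.transpose_mul]
    obtain ⟨z₁, hz₁⟩ := exists_coordMat_eq (n := n) (K := K) hN _ hXim
    have htransform : ∀ M : (K →+* ℝ) → Matrix (Fin n) (Fin n) ℂ, IsPt M →
        extendZero f (fun φ => emb φ X.1 * M φ * (emb φ X.1)ᵀ) = extendZero f M := fun M hM => by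
      rw [← extendZero_slash_levi k f X hdet hM, hinv _ hmem]
    have hXX : ∀ φ : K →+* ℝ, emb φ X.1 * emb φ (X⁻¹).1 = 1 := fun φ => by
      rw [← emb_mul, X.mul_inv, emb_one]
    have hbd : ∀ x, ‖H (z₁ + cvec x)‖ ≤ B := by
      intro x
      have hsy : ∀ φ : K →+* ℝ, (((X⁻¹).1.map φ) * realMat N x φ * ((X⁻¹).1.map φ)ᵀ).IsSymm := by
        intro φ
        rw [Matrix.IsSymm, Matrix.transpose_mul, Matrix.transpose_mul, Matrix.transpose_transpose,
          (isSymm_realMat N x φ).eq, Matrix.mul_assoc]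
      obtain ⟨x', hx'⟩ := exists_realMat_eq (n := n) (K := K) hN _ hsy
      have hmat : coordMat N (z₁ + cvec x) =
          fun φ => emb φ X.1 * coordMat N (z₀ + cvec x') φ * (emb φ X.1)ᵀ := by
        funext φ
        rw [coordMat_add, coordMat_add, hz₁, hz₀, coordMat_cvec N x', hx']
        have e1 : (((X⁻¹).1.map φ) * realMat N x φ * ((X⁻¹).1.map φ)ᵀ).map
            (fun x : ℝ => (x : ℂ)) =
            emb φ (X⁻¹).1 * coordMat N (cvec x) φ * (emb φ (X⁻¹).1)ᵀ := by
          rw [coordMat_cvec]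
          change Matrix.map _ Complex.ofRealHom = _
          rw [Matrix.map_mul, Matrix.map_mul]
          rfl
        rw [e1, Matrix.mul_add, Matrix.add_mul]
        congr 1
        · simp
        · calc coordMat N (cvec x) φ
              = (emb φ X.1 * emb φ (X⁻¹).1) * coordMat N (cvec x) φ *
                  (emb φ X.1 * emb φ (X⁻¹).1)ᵀ := by rw [hXX]; simp
            _ = _ := by simp only [Matrix.transpose_mul, Matrix.mul_assoc]
      have hpt : IsPt (coordMat N (z₀ + cvec x')) :=
        (isPt_coordMat_iff N _).mpr (add_cvec_mem_tube hz₀t x')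
      simp only [hHdef]
      rw [hmat, htransform _ hpt]
      exact hB x'
    have hz₁t : z₁ ∈ tube (posCone n K N) := by
      rw [← isPt_coordMat_iff]
      have := isPt_rawMoebius (levi X) ((isPt_coordMat_iff N z₀).mpr hz₀t)
      rw [rawMoebius_levi, hz₀] at this
      simpa [hz₁] using this
    have h1 := hest z₁ hz₁t B hbd m
    rw [← rawExp_dualMat hN m z₁, norm_mul, norm_rawExp] at h1
    have h2 : ∑ φ : K →+* ℝ, ((dualMat N m).map φ * (coordMat N z₁ φ).map Complex.im).trace =
        ∑ φ : K →+* ℝ, φ (dualMat N m * (X.1 * X.1ᵀ)).trace := by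
      refine Finset.sum_congr rfl fun φ _ => ?_
      rw [hz₁]
      have : (Complex.I • (emb φ X.1 * (emb φ X.1)ᵀ)).map Complex.im =
          (X.1 * X.1ᵀ).map φ := by
        ext i j
        simp [emb, Matrix.mul_apply]
      rw [this, ← Matrix.map_mul, AddMonoidHom.map_trace]
    rw [h2] at h1
    have hB0 : 0 ≤ B := (norm_nonneg _).trans (hB 0)
    have h3 : B / ‖c m‖ <
        -(Real.pi * ∑ φ : K →+* ℝ, φ (dualMat N m * (X.1 * X.1ᵀ)).trace) := by
      rw [lt_div_iff₀ Real.pi_pos] at hlt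
      linarith
    have h4 := Real.add_one_le_exp
      (-(Real.pi * ∑ φ : K →+* ℝ, φ (dualMat N m * (X.1 * X.1ᵀ)).trace))
    have h5 : B < ‖c m‖ *
        Real.exp (-(Real.pi * ∑ φ : K →+* ℝ, φ (dualMat N m * (X.1 * X.1ᵀ)).trace)) := by
      rw [← div_lt_iff₀' hcpos]
      linarith
    linarith
  -- The exponents `m` that remain correspond to distinct positive semi-definite matrices.
  set P : Set (CoordIdx n K → ℤ) := {m | ∀ φ : K →+* ℝ, ((dualMat N m).map φ).PosSemidef}
  set e : P → PsdMatrix n K := fun m => ⟨dualMat N m.1, isSymm_dualMat N m.1, m.2⟩ with he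
  have heinj : Function.Injective e := fun m m' h =>
    Subtype.ext (dualMat_injective hN (congrArg Subtype.val h))
  refine ⟨Function.extend e (fun m => c m.1) 0, fun τ => ?_⟩
  obtain ⟨z, hz⟩ := exists_coordMat_eq (n := n) (K := K) hN (fun φ => (τ φ).1)
    fun φ => (τ φ).2.1
  have hzt : z ∈ tube (posCone n K N) := by
    rw [← isPt_coordMat_iff, hz]
    exact isPt_coe τ
  have h1 := hsum z hzt
  have h2 : H z = f τ := by
    simp only [hHdef]
    rw [hz, extendZero_coe]
  rw [h2] at h1
  rw [← hasSum_subtype_iff_of_support_subset (s := P) (fun m hm => by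
    by_contra h
    exact hm (by simp [hvan m h]))] at h1
  rw [← heinj.hasSum_iff fun T hT => by rw [Function.extend_apply' _ _ _ hT]; simp]
  refine h1.congr_fun fun m => ?_
  simp only [Function.comp_apply]
  rw [heinj.extend_apply, expTrace_eq_rawExp, ← hz]
  congr 1
  exact rawExp_dualMat hN m.1 z

end Expansion

/-! ### Composition of similitudes and of their actions -/

section Composition

variable {n : ℕ} {K : Type*} [Field K]

/-- The `2n × 2n` matrix of a similitude. -/
def toMat (g : Similitude n K) : Matrix (Fin n ⊕ Fin n) (Fin n ⊕ Fin n) K :=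
  Matrix.fromBlocks g.A g.B g.C g.D

theorem toMat_injective : Function.Injective (toMat : Similitude n K → _) := by
  intro g h hgh
  obtain ⟨h1, h2, h3, h4⟩ := Matrix.fromBlocks_inj.mp hgh
  exact Similitude.ext h1 h2 h3 h4

theorem mul_transpose_comm {A B : Matrix (Fin n) (Fin n) K} (h : (A * Bᵀ).IsSymm) :
    B * Aᵀ = A * Bᵀ := by
  have := h.eq
  rwa [Matrix.transpose_mul, Matrix.transpose_transpose] at this

/-- The multiplier of a product of similitudes is the product of the multipliers. -/
theorem mul_rel {A B C D A' B' C' D' : Matrix (Fin n) (Fin n) K} {u u' : K}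
    (h : A * Dᵀ - B * Cᵀ = u • (1 : Matrix (Fin n) (Fin n) K))
    (hAB' : (A' * B'ᵀ).IsSymm) (hCD' : (C' * D'ᵀ).IsSymm)
    (h' : A' * D'ᵀ - B' * C'ᵀ = u' • (1 : Matrix (Fin n) (Fin n) K)) :
    (A * A' + B * C') * (C * B' + D * D')ᵀ - (A * B' + B * D') * (C * A' + D * C')ᵀ =
      (u * u') • (1 : Matrix (Fin n) (Fin n) K) := by
  have hAB2 := mul_transpose_comm hAB'
  have hCD2 := mul_transpose_comm hCD'
  have h2 : D' * A'ᵀ - C' * B'ᵀ = u' • (1 : Matrix (Fin n) (Fin n) K) := by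
    have := congrArg Matrix.transpose h'
    simpa [Matrix.transpose_sub, Matrix.transpose_mul] using this
  calc _ = A * (A' * B'ᵀ - B' * A'ᵀ) * Cᵀ + A * (A' * D'ᵀ - B' * C'ᵀ) * Dᵀ
        - B * (D' * A'ᵀ - C' * B'ᵀ) * Cᵀ - B * (D' * C'ᵀ - C' * D'ᵀ) * Dᵀ := by
        simp only [Matrix.transpose_add, Matrix.transpose_mul]
        noncomm_ring
    _ = u' • (A * Dᵀ - B * Cᵀ) := by
        rw [hAB2, hCD2, h', h2]
        simp [smul_sub]
    _ = _ := by rw [h, smul_smul, mul_comm]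

/-- The symmetry relation of one block row is preserved by multiplication on the right by a
similitude. -/
theorem mul_symm_rel {A B A' B' C' D' : Matrix (Fin n) (Fin n) K} {u' : K}
    (hAB : (A * Bᵀ).IsSymm) (hAB' : (A' * B'ᵀ).IsSymm) (hCD' : (C' * D'ᵀ).IsSymm)
    (h' : A' * D'ᵀ - B' * C'ᵀ = u' • (1 : Matrix (Fin n) (Fin n) K)) :
    ((A * A' + B * C') * (A * B' + B * D')ᵀ).IsSymm := by
  have hAB1 := mul_transpose_comm hAB
  have hAB2 := mul_transpose_comm hAB'
  have hCD2 := mul_transpose_comm hCD'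
  have h2 : D' * A'ᵀ - C' * B'ᵀ = u' • (1 : Matrix (Fin n) (Fin n) K) := by
    have := congrArg Matrix.transpose h'
    simpa [Matrix.transpose_sub, Matrix.transpose_mul] using this
  rw [Matrix.IsSymm, Matrix.transpose_mul, Matrix.transpose_transpose, ← sub_eq_zero]
  calc _ = A * (B' * A'ᵀ - A' * B'ᵀ) * Aᵀ - A * (A' * D'ᵀ - B' * C'ᵀ) * Bᵀ
        + B * (D' * A'ᵀ - C' * B'ᵀ) * Aᵀ + B * (D' * C'ᵀ - C' * D'ᵀ) * Bᵀ := by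
        simp only [Matrix.transpose_add, Matrix.transpose_mul]
        noncomm_ring
    _ = 0 := by
        rw [hAB2, hCD2, h', h2]
        simp [hAB1]

theorem TotPos.mul {a b : K} (ha : TotPos a) (hb : TotPos b) : TotPos (a * b) := fun φ => by
  rw [map_mul]
  exact mul_pos (ha φ) (hb φ)

theorem TotPos.inv {a : K} (ha : TotPos a) : TotPos a⁻¹ := fun φ => by
  rw [map_inv₀]
  exact inv_pos.mpr (ha φ)

/-- Matrix multiplication of similitudes. -/
def comp (g h : Similitude n K) : Similitude n K where
  A := g.A * h.A + g.B * h.C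
  B := g.A * h.B + g.B * h.D
  C := g.C * h.A + g.D * h.C
  D := g.C * h.B + g.D * h.D
  symm_AB := by
    obtain ⟨u, -, hu⟩ := h.exists_mult
    exact mul_symm_rel g.symm_AB h.symm_AB h.symm_CD hu
  symm_CD := by
    obtain ⟨u, -, hu⟩ := h.exists_mult
    exact mul_symm_rel g.symm_CD h.symm_AB h.symm_CD hu
  exists_mult := by
    obtain ⟨u, hu0, hu⟩ := g.exists_mult
    obtain ⟨v, hv0, hv⟩ := h.exists_mult
    exact ⟨u * v, hu0.mul hv0, mul_rel hu h.symm_AB h.symm_CD hv⟩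

theorem toMat_comp (g h : Similitude n K) : toMat (comp g h) = toMat g * toMat h := by
  simp [toMat, comp, Matrix.fromBlocks_multiply]

theorem comp_assoc (g h j : Similitude n K) : comp (comp g h) j = comp g (comp h j) :=
  toMat_injective (by simp only [toMat_comp, Matrix.mul_assoc])

theorem toMat_levi_one : toMat (levi (1 : GL (Fin n) K)) = 1 := by
  simp [toMat, levi, Matrix.fromBlocks_one]

theorem comp_eq_of_mul_eq_one {g h : Similitude n K} (hgh : toMat g * toMat h = 1)
    (j : Similitude n K) : comp g (comp h j) = j :=
  toMat_injective (by rw [toMat_comp, toMat_comp, ← Matrix.mul_assoc, hgh, Matrix.one_mul])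

theorem emb_add (φ : K →+* ℝ) (A B : Matrix (Fin n) (Fin n) K) :
    emb φ (A + B) = emb φ A + emb φ B := by
  ext i j
  simp [emb]

theorem denom_comp (g h : Similitude n K) (φ : K →+* ℝ) (τ : HalfSpaceProd n K) :
    denom (comp g h) φ (τ φ) = denom g φ (moebius h τ φ) * denom h φ (τ φ) := by
  have hd := isUnit_denom h φ (τ φ)
  have e : (moebius h τ φ).1 = num h φ (τ φ) * (denom h φ (τ φ))⁻¹ := rfl
  rw [denom, denom, e, Matrix.add_mul, Matrix.mul_assoc, Matrix.mul_assoc,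
    Matrix.nonsing_inv_mul _ hd, Matrix.mul_one]
  simp only [comp, emb_add, emb_mul, num, denom, Matrix.mul_add, Matrix.add_mul, Matrix.mul_assoc]
  abel

theorem num_comp (g h : Similitude n K) (φ : K →+* ℝ) (τ : HalfSpaceProd n K) :
    num (comp g h) φ (τ φ) = num g φ (moebius h τ φ) * denom h φ (τ φ) := by
  have hd := isUnit_denom h φ (τ φ)
  have e : (moebius h τ φ).1 = num h φ (τ φ) * (denom h φ (τ φ))⁻¹ := rfl
  rw [num, num, e, Matrix.add_mul, Matrix.mul_assoc, Matrix.mul_assoc,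
    Matrix.nonsing_inv_mul _ hd, Matrix.mul_one]
  simp only [comp, emb_add, emb_mul, num, denom, Matrix.mul_add, Matrix.add_mul, Matrix.mul_assoc]
  abel

theorem moebius_comp (g h : Similitude n K) (τ : HalfSpaceProd n K) :
    moebius (comp g h) τ = moebius g (moebius h τ) := by
  funext φ
  apply Subtype.ext
  have hd := isUnit_denom h φ (τ φ)
  change num (comp g h) φ (τ φ) * (denom (comp g h) φ (τ φ))⁻¹ =
    num g φ (moebius h τ φ) * (denom g φ (moebius h τ φ))⁻¹
  rw [num_comp, denom_comp, Matrix.mul_inv_rev, Matrix.mul_assoc,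
    ← Matrix.mul_assoc (denom h φ (τ φ)), Matrix.mul_nonsing_inv _ hd, Matrix.one_mul]

theorem slash_comp [Fintype (K →+* ℝ)] (k : ℤ) (f : HalfSpaceProd n K → ℂ)
    (g h : Similitude n K) : slash k (slash k f g) h = slash k f (comp g h) := by
  have hmul : (comp g h).A * (comp g h).Dᵀ - (comp g h).B * (comp g h).Cᵀ =
      (g.A * g.Dᵀ - g.B * g.Cᵀ) * (h.A * h.Dᵀ - h.B * h.Cᵀ) := by
    obtain ⟨u, hu0, hu⟩ := g.exists_mult
    obtain ⟨v, hv0, hv⟩ := h.exists_mult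
    rw [hu, hv]
    refine (mul_rel hu h.symm_AB h.symm_CD hv).trans ?_
    simp [smul_smul]
    ring_nf
  have hpos : ∀ g : Similitude n K,
      0 ≤ ∏ φ : K →+* ℝ, φ (g.A * g.Dᵀ - g.B * g.Cᵀ).det := fun g => by
    obtain ⟨u, hu0, hu⟩ := g.exists_mult
    refine Finset.prod_nonneg fun φ _ => ?_
    rw [hu, Matrix.det_smul, Matrix.det_one, mul_one, map_pow]
    exact pow_nonneg (hu0 φ).le _
  funext τ
  simp only [slash]
  rw [hmul, moebius_comp]
  simp only [denom_comp, Matrix.det_mul, map_mul, Finset.prod_mul_distrib]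
  rw [Real.mul_rpow (hpos g) (hpos h), mul_zpow]
  push_cast
  ring

/-- The inverse of a similitude with multiplier `u`. -/
theorem exists_inverse (g : Similitude n K) {u : K} (hu0 : TotPos u)
    (hne : u ≠ 0)
    (hu : g.A * g.Dᵀ - g.B * g.Cᵀ = u • (1 : Matrix (Fin n) (Fin n) K)) :
    ∃ h : Similitude n K, toMat g * toMat h = 1 ∧ toMat h * toMat g = 1 ∧
      toMat h = u⁻¹ • Matrix.fromBlocks g.Dᵀ (-g.Bᵀ) (-g.Cᵀ) g.Aᵀ ∧
      h.A * h.Dᵀ - h.B * h.Cᵀ = u⁻¹ • (1 : Matrix (Fin n) (Fin n) K) := by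
  obtain ⟨h1, h2, h3⟩ := rels_of_rels hne g.symm_AB g.symm_CD hu
  have hmul : (u⁻¹ • g.Dᵀ) * (u⁻¹ • g.Aᵀ)ᵀ - (u⁻¹ • -g.Bᵀ) * (u⁻¹ • -g.Cᵀ)ᵀ =
      u⁻¹ • (1 : Matrix (Fin n) (Fin n) K) := by
    simp only [Matrix.transpose_smul, Matrix.transpose_neg, Matrix.transpose_transpose,
      Matrix.smul_mul, Matrix.mul_smul, Matrix.neg_mul, Matrix.mul_neg, smul_neg, neg_neg,
      smul_smul]
    rw [← smul_sub, h3, smul_smul, inv_mul_cancel_right₀ hne]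
  let h : Similitude n K :=
    { A := u⁻¹ • g.Dᵀ
      B := u⁻¹ • -g.Bᵀ
      C := u⁻¹ • -g.Cᵀ
      D := u⁻¹ • g.Aᵀ
      symm_AB := by
        simp only [Matrix.IsSymm, Matrix.transpose_mul, Matrix.transpose_smul,
          Matrix.transpose_neg, Matrix.transpose_transpose, Matrix.smul_mul, Matrix.mul_smul,
          Matrix.mul_neg, h2]
      symm_CD := by
        simp only [Matrix.IsSymm, Matrix.transpose_mul, Matrix.transpose_smul,
          Matrix.transpose_neg, Matrix.transpose_transpose, Matrix.smul_mul, Matrix.mul_smul,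
          Matrix.neg_mul, h1]
      exists_mult := ⟨u⁻¹, hu0.inv, hmul⟩ }
  have hmat : toMat h = u⁻¹ • Matrix.fromBlocks g.Dᵀ (-g.Bᵀ) (-g.Cᵀ) g.Aᵀ := by
    rw [Matrix.fromBlocks_smul]
    rfl
  have hAB := mul_transpose_comm g.symm_AB
  have hCD := mul_transpose_comm g.symm_CD
  have h4 : g.D * g.Aᵀ - g.C * g.Bᵀ = u • (1 : Matrix (Fin n) (Fin n) K) := by
    have := congrArg Matrix.transpose hu
    simpa [Matrix.transpose_sub, Matrix.transpose_mul] using this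
  have hgh : toMat g * toMat h = 1 := by
    rw [hmat, toMat, Matrix.mul_smul, Matrix.fromBlocks_multiply, Matrix.mul_neg, Matrix.mul_neg,
      Matrix.mul_neg, Matrix.mul_neg, hAB, hCD, ← sub_eq_add_neg, hu, neg_add_eq_sub,
      neg_add_eq_sub, h4, sub_self, add_neg_cancel, Matrix.fromBlocks_smul,
      ← Matrix.fromBlocks_one]
    simp [smul_smul, hne]
  exact ⟨h, hgh, mul_eq_one_comm.mp hgh, hmat, hmul⟩

end Composition

/-! ### The groupoid of similitudes between the lattices -/

section Groupoid

variable {n : ℕ} {K : Type*} [Field K] [NumberField K]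

/-- The fractional ideals of the lattice `I₁ ⊕ … ⊕ Iₙ ⊕ (I₁J)⁻¹∂ ⊕ … ⊕ (IₙJ)⁻¹∂` in `K²ⁿ`,
whose stabilizer among the similitudes with unit multiplier is `Γ(I₁,…,Iₙ;J)`. -/
def wt (I : Fin n → Idl K) (J : Idl K) : Fin n ⊕ Fin n → Idl K :=
  Sum.elim I fun i => (I i * J)⁻¹ * dif K

/-- The similitude `g` has a unit as multiplier and maps the lattice of the index `(I';J)` into
that of `(I;J)`. -/
def IsMap (I I' : Fin n → Idl K) (J : Idl K) (g : Similitude n K) : Prop :=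
  (∃ u : (𝓞 K)ˣ, TotPos ((u : 𝓞 K) : K) ∧
    g.A * g.Dᵀ - g.B * g.Cᵀ = ((u : 𝓞 K) : K) • (1 : Matrix (Fin n) (Fin n) K)) ∧
  ∀ p q, toMat g p q ∈ (wt I J p * (wt I' J q)⁻¹ : Idl K).1

/-- `Γ(I₁,…,Iₙ;J)` is the vertex group at `(I;J)` of the groupoid formed by the similitudes that
satisfy `IsMap`. -/
theorem isMap_self_iff (I : Fin n → Idl K) (J : Idl K) (g : Similitude n K) :
    IsMap I I J g ↔ g ∈ Gam (I, J) := by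
  have hB : ∀ i j, (wt I J (Sum.inl i) * (wt I J (Sum.inr j))⁻¹ : Idl K).1 =
      (I i * I j * J : Idl K).1 * (different K)⁻¹ := fun i j => by
    have : wt I J (Sum.inl i) * (wt I J (Sum.inr j))⁻¹ = I i * I j * J * (dif K)⁻¹ := by
      simp only [wt, Sum.elim_inl, Sum.elim_inr]
      exact Additive.ofMul.injective (by simp only [ofMul_mul, ofMul_inv]; abel)
    rw [this, Units.val_mul (I i * I j * J), Units.val_inv_eq_inv_val]
    rfl
  have hC : ∀ i j, (wt I J (Sum.inr i) * (wt I J (Sum.inl j))⁻¹ : Idl K).1 =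
      ((I i * I j * J)⁻¹ : Idl K).1 * different K := fun i j => by
    have : wt I J (Sum.inr i) * (wt I J (Sum.inl j))⁻¹ = (I i * I j * J)⁻¹ * dif K := by
      simp only [wt, Sum.elim_inl, Sum.elim_inr]
      exact Additive.ofMul.injective (by simp only [ofMul_mul, ofMul_inv]; abel)
    rw [this, Units.val_mul]
    rfl
  have hD : ∀ i j, wt I J (Sum.inr i) * (wt I J (Sum.inr j))⁻¹ = (I i)⁻¹ * I j := fun i j => by
    simp only [wt, Sum.elim_inr]
    exact Additive.ofMul.injective (by simp only [ofMul_mul, ofMul_inv]; abel)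
  have hA : ∀ i j, wt I J (Sum.inl i) * (wt I J (Sum.inl j))⁻¹ = I i * (I j)⁻¹ := fun i j => rfl
  simp only [IsMap, Gam, Set.mem_ofPred_eq, Sum.forall, toMat, Matrix.fromBlocks_apply₁₁,
    Matrix.fromBlocks_apply₁₂, Matrix.fromBlocks_apply₂₁, Matrix.fromBlocks_apply₂₂, hA, hB, hC, hD]
  constructor
  · rintro ⟨hu, h1, h2⟩
    exact ⟨hu, fun i j => (h1 i).1 j, fun i j => (h1 i).2 j, fun i j => (h2 i).1 j,
      fun i j => (h2 i).2 j⟩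
  · rintro ⟨hu, h1, h2, h3, h4⟩
    exact ⟨hu, fun i => ⟨h1 i, h2 i⟩, fun i => ⟨h3 i, h4 i⟩⟩

theorem IsMap.comp {I I' I'' : Fin n → Idl K} {J : Idl K} {g h : Similitude n K}
    (hg : IsMap I I' J g) (hh : IsMap I' I'' J h) : IsMap I I'' J (comp g h) := by
  obtain ⟨⟨u, hu0, hu⟩, hgm⟩ := hg
  obtain ⟨⟨v, hv0, hv⟩, hhm⟩ := hh
  refine ⟨⟨u * v, ?_, ?_⟩, fun p q => ?_⟩
  · simpa using hu0.mul hv0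
  · push_cast
    exact mul_rel hu h.symm_AB h.symm_CD hv
  · rw [toMat_comp, Matrix.mul_apply]
    refine Submodule.sum_mem _ fun r _ => ?_
    have hmul := FractionalIdeal.mul_mem_mul (hgm p r) (hhm r q)
    rw [← Units.val_mul, mul_assoc, inv_mul_cancel_left] at hmul
    exact hmul

theorem IsMap.exists_inverse {I I' : Fin n → Idl K} {J : Idl K} {g : Similitude n K}
    (hg : IsMap I I' J g) :
    ∃ h, IsMap I' I J h ∧ toMat g * toMat h = 1 ∧ toMat h * toMat g = 1 := by
  obtain ⟨⟨u, hu0, hu⟩, hgm⟩ := hg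
  obtain ⟨h, h1, h2, h3, h4⟩ := HilbertSiegel.exists_inverse g hu0 (by simp) hu
  refine ⟨h, ⟨⟨u⁻¹, ?_, ?_⟩, ?_⟩, h1, h2⟩
  · simpa using hu0.inv
  · simpa using h4
  have hunit : ∀ (P : Idl K) (x : K), x ∈ P.1 → ((u : 𝓞 K) : K)⁻¹ * x ∈ P.1 := fun P x hx => by
    have : ((u : 𝓞 K) : K)⁻¹ * x = ((u⁻¹ : (𝓞 K)ˣ) : 𝓞 K) • x := by
      rw [Algebra.smul_def]
      simp
    rw [this]
    exact Submodule.smul_mem _ _ hx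
  have hneg : ∀ (P : Idl K) (x : K), x ∈ P.1 → -x ∈ P.1 := fun P x hx => Submodule.neg_mem _ hx
  have hw : ∀ (I : Fin n → Idl K) i, wt I J (Sum.inr i) = (wt I J (Sum.inl i))⁻¹ * (J⁻¹ * dif K) :=
    fun I i => by
      simp only [wt, Sum.elim_inl, Sum.elim_inr]
      exact Additive.ofMul.injective (by simp only [ofMul_mul, ofMul_inv]; abel)
  rw [h3]
  have hswap : ∀ a b c : Idl K, a⁻¹ * c * (b⁻¹ * c)⁻¹ = b * a⁻¹ := fun a b c => by
    exact Additive.ofMul.injective (by simp only [ofMul_mul, ofMul_inv]; abel)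
  have hswap2 : ∀ a b c : Idl K, a * (b⁻¹ * c)⁻¹ = b * (a⁻¹ * c)⁻¹ := fun a b c => by
    exact Additive.ofMul.injective (by simp only [ofMul_mul, ofMul_inv]; abel)
  have hswap3 : ∀ a b c : Idl K, a⁻¹ * c * b⁻¹ = b⁻¹ * c * a⁻¹ := fun a b c => by
    exact Additive.ofMul.injective (by simp only [ofMul_mul, ofMul_inv]; abel)
  rintro (i | i) (j | j) <;>
    simp only [Matrix.smul_apply, smul_eq_mul, Matrix.fromBlocks_apply₁₁,
      Matrix.fromBlocks_apply₁₂, Matrix.fromBlocks_apply₂₁, Matrix.fromBlocks_apply₂₂,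
      Matrix.neg_apply, Matrix.transpose_apply] <;> apply hunit
  · have := hgm (Sum.inr j) (Sum.inr i)
    rw [hw, hw, hswap] at this
    exact this
  · have := hgm (Sum.inl j) (Sum.inr i)
    rw [hw, hswap2, ← hw] at this
    exact hneg _ _ this
  · have := hgm (Sum.inr j) (Sum.inl i)
    rw [hw, hswap3, ← hw] at this
    exact hneg _ _ this
  · have := hgm (Sum.inl j) (Sum.inl i)
    rw [hw, hw, hswap]
    exact this

theorem isMap_one (I : Fin n → Idl K) (J : Idl K) : IsMap I I J (levi 1) := by
  refine ⟨⟨1, fun φ => by simp, by simp [levi]⟩, fun p q => ?_⟩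
  rw [toMat_levi_one]
  by_cases hpq : p = q
  · subst hpq
    rw [mul_inv_cancel, Matrix.one_apply_eq]
    exact FractionalIdeal.one_mem_one (𝓞 K)⁰
  · rw [Matrix.one_apply_ne hpq]
    exact zero_mem_idl _

theorem isMap_levi {I I' : Fin n → Idl K} (J : Idl K) (X : GL (Fin n) K)
    (h1 : ∀ i j, X.1 i j ∈ (I i * (I' j)⁻¹ : Idl K).1)
    (h2 : ∀ i j, X⁻¹.1 i j ∈ (I' i * (I j)⁻¹ : Idl K).1) : IsMap I I' J (levi X) := by
  refine ⟨⟨1, fun φ => by simp, ?_⟩, ?_⟩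
  · simp only [levi, Matrix.transpose_transpose, Matrix.zero_mul, sub_zero]
    rw [X.mul_inv]
    simp
  rintro (i | i) (j | j)
  · exact h1 i j
  · exact zero_mem_idl _
  · exact zero_mem_idl _
  · have : wt I J (Sum.inr i) * (wt I' J (Sum.inr j))⁻¹ = I' j * (I i)⁻¹ := by
      simp only [wt, Sum.elim_inr]
      exact Additive.ofMul.injective (by simp only [ofMul_mul, ofMul_inv]; abel)
    rw [this]
    exact h2 j i

end Groupoid

/-! ### Matrices of determinant one in two rows and columns -/

section Blocks

variable {n : ℕ} {K : Type*} [Field K]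

/-- The `n × 2` matrix whose columns are the standard basis vectors of index `l` and `m`. -/
def twoCols (K : Type*) [Field K] (l m : Fin n) : Matrix (Fin n) (Fin 2) K :=
  fun i a => if i = ![l, m] a then 1 else 0

/-- The matrix which is `B` in the rows and columns `l, m` and the identity elsewhere, for
`l ≠ m`. -/
def blk (l m : Fin n) (B : Matrix (Fin 2) (Fin 2) K) : Matrix (Fin n) (Fin n) K :=
  1 + twoCols K l m * (B - 1) * (twoCols K l m)ᵀ

theorem twoCols_transpose_mul {l m : Fin n} (hlm : l ≠ m) :
    (twoCols K l m)ᵀ * twoCols K l m = 1 := by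
  ext a b
  simp only [Matrix.mul_apply, Matrix.transpose_apply, twoCols, ite_mul, one_mul, zero_mul,
    Finset.sum_ite_eq', Finset.mem_univ, if_true]
  fin_cases a <;> fin_cases b <;> simp [hlm, hlm.symm]

theorem blk_mul {l m : Fin n} (hlm : l ≠ m) (B B' : Matrix (Fin 2) (Fin 2) K) :
    blk l m B * blk l m B' = blk l m (B * B') := by
  have h := twoCols_transpose_mul (K := K) hlm
  set E := twoCols K l m with hE
  have : E * (B - 1) * Eᵀ * (E * (B' - 1) * Eᵀ) = E * ((B - 1) * (B' - 1)) * Eᵀ := by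
    calc _ = E * (B - 1) * (Eᵀ * E) * (B' - 1) * Eᵀ := by simp only [Matrix.mul_assoc]
      _ = _ := by rw [h, Matrix.mul_one]; simp only [Matrix.mul_assoc]
  rw [blk, blk, blk, ← hE, Matrix.add_mul, Matrix.mul_add, Matrix.mul_add, this]
  have h2 : B * B' - 1 = (B - 1) + (B' - 1) + (B - 1) * (B' - 1) := by noncomm_ring
  rw [h2]
  simp only [Matrix.mul_add, Matrix.add_mul, Matrix.one_mul, Matrix.mul_one]
  abel

theorem blk_one (l m : Fin n) : blk l m (1 : Matrix (Fin 2) (Fin 2) K) = 1 := by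
  simp [blk]

theorem det_blk {l m : Fin n} (hlm : l ≠ m) (B : Matrix (Fin 2) (Fin 2) K) :
    (blk l m B).det = B.det := by
  rw [blk, Matrix.mul_assoc, Matrix.det_one_add_mul_comm, Matrix.mul_assoc,
    twoCols_transpose_mul hlm, Matrix.mul_one, add_sub_cancel]

theorem blk_apply_eq {l m : Fin n} (hlm : l ≠ m) (B : Matrix (Fin 2) (Fin 2) K) (a b : Fin 2) :
    blk l m B (![l, m] a) (![l, m] b) = B a b := by
  fin_cases a <;> fin_cases b <;>
    simp [blk, Matrix.mul_apply, twoCols, hlm, hlm.symm, Matrix.one_apply, Fin.sum_univ_two]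

theorem blk_apply_of_not {l m : Fin n} (B : Matrix (Fin 2) (Fin 2) K) {i j : Fin n}
    (h : ¬((i = l ∨ i = m) ∧ (j = l ∨ j = m))) :
    blk l m B i j = (1 : Matrix (Fin n) (Fin n) K) i j := by
  have : ∀ i, ¬(i = l ∨ i = m) → ∀ a, twoCols K l m i a = 0 := fun i hi a => by
    rw [not_or] at hi
    fin_cases a <;> simp [twoCols, hi.1, hi.2]
  rw [blk, Matrix.add_apply, Matrix.mul_assoc]
  rw [not_and_or] at h
  rcases h with h | h
  · simp [Matrix.mul_apply, this i h]
  · rw [← Matrix.mul_assoc]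
    simp [Matrix.mul_apply, this j h]

theorem eq_blk {l m : Fin n} (hlm : l ≠ m) {X : Matrix (Fin n) (Fin n) K}
    (hX : ∀ i j, ¬((i = l ∨ i = m) ∧ (j = l ∨ j = m)) →
      X i j = (1 : Matrix (Fin n) (Fin n) K) i j) :
    X = blk l m !![X l l, X l m; X m l, X m m] := by
  ext i j
  by_cases h : (i = l ∨ i = m) ∧ (j = l ∨ j = m)
  · have h00 := blk_apply_eq hlm !![X l l, X l m; X m l, X m m] 0 0
    have h01 := blk_apply_eq hlm !![X l l, X l m; X m l, X m m] 0 1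
    have h10 := blk_apply_eq hlm !![X l l, X l m; X m l, X m m] 1 0
    have h11 := blk_apply_eq hlm !![X l l, X l m; X m l, X m m] 1 1
    simp at h00 h01 h10 h11
    rcases h with ⟨rfl | rfl, rfl | rfl⟩ <;> simp [*]
  · rw [hX i j h, blk_apply_of_not _ h]

end Blocks

section Ideals

variable {K : Type*} [Field K] [NumberField K]

/-- There are matrices of determinant `1` with entries in `P`, `P⁻¹X`, `PX⁻¹`, `P⁻¹`. For nonzero
`a ∈ P` the ideal `aP⁻¹` is integral, and `c ∈ Y = PX⁻¹` can be chosen such that `c` and `aP⁻¹Y`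
generate `Y`; then `aP⁻¹ + cY⁻¹ = 1`. -/
theorem exists_det_one (P X : Idl K) : ∃ a b c d : K, a * d - b * c = 1 ∧ a ∈ P.1 ∧
    b ∈ (P⁻¹ * X : Idl K).1 ∧ c ∈ (P * X⁻¹ : Idl K).1 ∧ d ∈ (P⁻¹ : Idl K).1 := by
  obtain ⟨a, haP, ha⟩ : ∃ a ∈ P.1, a ≠ 0 := by
    by_contra! h
    exact P.ne_zero (FractionalIdeal.eq_zero_iff.mpr h)
  obtain ⟨Y, hY⟩ : ∃ Y : Idl K, Y = P * X⁻¹ := ⟨_, rfl⟩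
  have hYP : P⁻¹ * X = Y⁻¹ := by rw [hY, mul_inv, inv_inv]
  rw [hYP, ← hY]
  obtain ⟨y, 𝔶, hy, h𝔶⟩ := FractionalIdeal.exists_eq_spanSingleton_mul Y.1
  obtain ⟨𝔞, h𝔞⟩ : ∃ 𝔞 : Ideal (𝓞 K), (𝔞 : FractionalIdeal (𝓞 K)⁰ K) =
      FractionalIdeal.spanSingleton (𝓞 K)⁰ a * (P⁻¹ : Idl K).1 := by
    refine (FractionalIdeal.le_one_iff_exists_coeIdeal.mp ?_)
    calc _ ≤ P.1 * (P⁻¹ : Idl K).1 := by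
          gcongr
          exact FractionalIdeal.spanSingleton_le_iff_mem.mpr haP
      _ = 1 := P.mul_inv
  have hy0 : algebraMap (𝓞 K) K y ≠ 0 := by simpa using hy
  have h𝔶0 : 𝔶 ≠ ⊥ := by
    rintro rfl
    exact Y.ne_zero (by rw [h𝔶]; simp)
  have h𝔞0 : 𝔞 ≠ ⊥ := by
    rintro rfl
    rw [FractionalIdeal.coeIdeal_bot, eq_comm, mul_eq_zero,
      FractionalIdeal.spanSingleton_eq_zero_iff] at h𝔞
    exact h𝔞.elim ha (P⁻¹).ne_zero
  obtain ⟨c, hc⟩ := IsDedekindDomain.exists_sup_span_eq (I := 𝔶 * 𝔞) (J := 𝔶) Ideal.mul_le_left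
    (mul_ne_zero h𝔶0 h𝔞0)
  have hone : (1 : FractionalIdeal (𝓞 K)⁰ K) = FractionalIdeal.spanSingleton (𝓞 K)⁰ a *
      (P⁻¹ : Idl K).1 + FractionalIdeal.spanSingleton (𝓞 K)⁰
        ((algebraMap (𝓞 K) K y)⁻¹ * algebraMap (𝓞 K) K c) * (Y⁻¹ : Idl K).1 := by
    have : Y.1 = Y.1 * 𝔞 + FractionalIdeal.spanSingleton (𝓞 K)⁰
        ((algebraMap (𝓞 K) K y)⁻¹ * algebraMap (𝓞 K) K c) := by
      rw [← FractionalIdeal.spanSingleton_mul_spanSingleton,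
        ← FractionalIdeal.coeIdeal_span_singleton, h𝔶, mul_assoc, ← FractionalIdeal.coeIdeal_mul,
        ← mul_add, ← FractionalIdeal.coeIdeal_sup, hc]
    calc (1 : FractionalIdeal (𝓞 K)⁰ K) = Y.1 * (Y⁻¹ : Idl K).1 := Y.mul_inv.symm
      _ = (Y.1 * 𝔞 + FractionalIdeal.spanSingleton (𝓞 K)⁰
        ((algebraMap (𝓞 K) K y)⁻¹ * algebraMap (𝓞 K) K c)) * (Y⁻¹ : Idl K).1 := by rw [← this]
      _ = _ := by rw [add_mul, mul_right_comm, Y.mul_inv, one_mul, h𝔞]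
  have hmem := FractionalIdeal.one_mem_one (P := K) (𝓞 K)⁰
  rw [hone, ← FractionalIdeal.mem_coe, FractionalIdeal.coe_add, Submodule.add_eq_sup,
    Submodule.mem_sup] at hmem
  obtain ⟨s, hs, t, ht, hst⟩ := hmem
  obtain ⟨d, hd, rfl⟩ := FractionalIdeal.mem_singleton_mul.mp hs
  obtain ⟨b, hb, rfl⟩ := FractionalIdeal.mem_singleton_mul.mp ht
  refine ⟨a, -b, (algebraMap (𝓞 K) K y)⁻¹ * algebraMap (𝓞 K) K c, d, ?_, haP,
    Submodule.neg_mem _ hb, ?_, hd⟩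
  · rw [← hst]
    ring
  · rw [h𝔶]
    refine FractionalIdeal.mem_singleton_mul.mpr ⟨_, ?_, rfl⟩
    refine FractionalIdeal.mem_coeIdeal_of_mem _ ?_
    rw [← hc]
    exact Ideal.mem_sup_right (Ideal.mem_span_singleton_self c)

end Ideals

/-! ### The matrices of `U`, `V` and `S` as maps of lattices -/

section Maps

variable {n : ℕ} {K : Type*} [Field K] [NumberField K]

theorem mem_principal (α : Kˣ) : (α : K) ∈ (principal α).1 := by
  rw [coe_toPrincipalIdeal]
  exact FractionalIdeal.mem_spanSingleton_self _ _

theorem one_mem_mul_inv (P : Idl K) : (1 : K) ∈ (P * P⁻¹ : Idl K).1 := by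
  rw [mul_inv_cancel]
  exact FractionalIdeal.one_mem_one (𝓞 K)⁰

theorem diagonal_apply_mem {v : Fin n → K} (P : Fin n → Fin n → Idl K)
    (h : ∀ i, v i ∈ (P i i).1) (i j : Fin n) : Matrix.diagonal v i j ∈ (P i j).1 := by
  by_cases hij : i = j
  · subst hij
    simpa using h i
  · rw [Matrix.diagonal_apply_ne _ hij]
    exact zero_mem_idl _

theorem isMap_U (I : Fin n → Idl K) (J : Idl K) (l : Fin n) (α : Kˣ) (X : GL (Fin n) K)
    (hX : X.1 = Matrix.diagonal (Function.update 1 l (α⁻¹ : Kˣ).1)) :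
    IsMap I (Function.update I l (principal α * I l)) J (levi X) := by
  have hX' : X⁻¹.1 = Matrix.diagonal (Function.update 1 l (α : K)) := by
    refine Units.inv_eq_of_mul_eq_one_right ?_
    rw [hX, Matrix.diagonal_mul_diagonal, ← Matrix.diagonal_one]
    congr 1
    ext i
    by_cases hi : i = l
    · subst hi
      simp
    · simp [hi]
  refine isMap_levi J X ?_ ?_
  · rw [hX]
    refine diagonal_apply_mem (fun i j => I i * (Function.update I l (principal α * I l) j)⁻¹)
      fun i => ?_
    by_cases hi : i = l
    · subst hi
      have : I i * (principal α * I i)⁻¹ = principal α⁻¹ := by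
        rw [principal, principal, map_inv, mul_inv, mul_left_comm, mul_inv_cancel, mul_one]
      simp only [Function.update_self, this]
      exact mem_principal α⁻¹
    · simp only [Function.update_of_ne hi, Pi.one_apply]
      exact one_mem_mul_inv _
  · rw [hX']
    refine diagonal_apply_mem (fun i j => Function.update I l (principal α * I l) i * (I j)⁻¹)
      fun i => ?_
    by_cases hi : i = l
    · subst hi
      simp only [Function.update_self, mul_inv_cancel_right]
      exact mem_principal α
    · simp only [Function.update_of_ne hi, Pi.one_apply]
      exact one_mem_mul_inv _

theorem apply_mem_of_block {I I' : Fin n → Idl K} {l m : Fin n}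
    (hI : ∀ i, i ≠ l → i ≠ m → I' i = I i) {X : Matrix (Fin n) (Fin n) K}
    (hX : ∀ i j, ¬((i = l ∨ i = m) ∧ (j = l ∨ j = m)) →
      X i j = (1 : Matrix (Fin n) (Fin n) K) i j)
    (h₁₁ : X l l ∈ (I l * (I' l)⁻¹ : Idl K).1) (h₁₂ : X l m ∈ (I l * (I' m)⁻¹ : Idl K).1)
    (h₂₁ : X m l ∈ (I m * (I' l)⁻¹ : Idl K).1) (h₂₂ : X m m ∈ (I m * (I' m)⁻¹ : Idl K).1)
    (i j : Fin n) : X i j ∈ (I i * (I' j)⁻¹ : Idl K).1 := by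
  by_cases h : (i = l ∨ i = m) ∧ (j = l ∨ j = m)
  · rcases h with ⟨rfl | rfl, rfl | rfl⟩ <;> assumption
  · rw [hX i j h]
    by_cases hij : i = j
    · subst hij
      rw [and_self, not_or] at h
      rw [hI i h.1 h.2, Matrix.one_apply_eq]
      exact one_mem_mul_inv _
    · rw [Matrix.one_apply_ne hij]
      exact zero_mem_idl _

theorem isMap_V (I : Fin n → Idl K) (J : Idl K) {l m : Fin n} (hlm : l ≠ m) (Q : Idl K)
    (X : GL (Fin n) K) (hdet : X.1.det = 1)
    (hX : ∀ i j, ¬((i = l ∨ i = m) ∧ (j = l ∨ j = m)) →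
      X.1 i j = (1 : Matrix (Fin n) (Fin n) K) i j)
    (h₁₁ : X.1 l l ∈ (Q⁻¹ : Idl K).1) (h₁₂ : X.1 l m ∈ (Q * I l * (I m)⁻¹ : Idl K).1)
    (h₂₁ : X.1 m l ∈ (Q⁻¹ * (I l)⁻¹ * I m : Idl K).1) (h₂₂ : X.1 m m ∈ Q.1) :
    IsMap I (Function.update (Function.update I l (Q * I l)) m (Q⁻¹ * I m)) J (levi X) := by
  have hblk := eq_blk hlm hX
  set B : Matrix (Fin 2) (Fin 2) K := !![X.1 l l, X.1 l m; X.1 m l, X.1 m m] with hB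
  have hX' : X⁻¹.1 = blk l m B.adjugate := by
    refine Units.inv_eq_of_mul_eq_one_right ?_
    have hdB : B.det = 1 := by rw [← det_blk hlm, ← hblk, hdet]
    rw [hblk, blk_mul hlm, Matrix.mul_adjugate, hdB, one_smul, blk_one]
  set I' := Function.update (Function.update I l (Q * I l)) m (Q⁻¹ * I m) with hI'
  have hl : I' l = Q * I l := by rw [hI', Function.update_of_ne hlm, Function.update_self]
  have hm : I' m = Q⁻¹ * I m := by rw [hI', Function.update_self]
  have hne : ∀ i, i ≠ l → i ≠ m → I' i = I i := fun i h1 h2 => by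
    rw [hI', Function.update_of_ne h2, Function.update_of_ne h1]
  have hY : ∀ a b, X⁻¹.1 (![l, m] a) (![l, m] b) = B.adjugate a b := fun a b => by
    rw [hX', blk_apply_eq hlm]
  rw [hB, Matrix.adjugate_fin_two_of] at hY
  have hY00 := hY 0 0
  have hY01 := hY 0 1
  have hY10 := hY 1 0
  have hY11 := hY 1 1
  simp only [Fin.isValue, Matrix.cons_val_zero, Matrix.cons_val_one, Matrix.of_apply,
    Matrix.cons_val', Matrix.cons_val_fin_one] at hY00 hY01 hY10 hY11
  refine isMap_levi J X (apply_mem_of_block hne hX ?_ ?_ ?_ ?_)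
    (apply_mem_of_block (fun i h1 h2 => (hne i h1 h2).symm) (fun i j h => ?_) ?_ ?_ ?_ ?_)
  · convert h₁₁ using 2
    rw [hl]
    exact Additive.ofMul.injective (by simp only [ofMul_mul, ofMul_inv]; abel)
  · convert h₁₂ using 2
    rw [hm]
    exact Additive.ofMul.injective (by simp only [ofMul_mul, ofMul_inv]; abel)
  · convert h₂₁ using 2
    rw [hl]
    exact Additive.ofMul.injective (by simp only [ofMul_mul, ofMul_inv]; abel)
  · convert h₂₂ using 2
    rw [hm]
    exact Additive.ofMul.injective (by simp only [ofMul_mul, ofMul_inv]; abel)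
  · rw [hX', blk_apply_of_not _ h]
  · rw [hY00]
    convert h₂₂ using 2
    rw [hl]
    exact Additive.ofMul.injective (by simp only [ofMul_mul, ofMul_inv]; abel)
  · rw [hY01]
    refine Submodule.neg_mem _ ?_
    rw [hl]
    exact h₁₂
  · rw [hY10]
    refine Submodule.neg_mem _ ?_
    rw [hm, mul_right_comm]
    exact h₂₁
  · rw [hY11, hm, mul_inv_cancel_right]
    exact h₁₁

theorem isMap_S (I : Fin n → Idl K) (J : Idl K) (l : Fin n) (Q : Idl K) (a b c d : K)
    (h : a * d - b * c = 1) (ha : a ∈ Q.1)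
    (hb : b ∈ (Q⁻¹ * (I l ^ 2 * J * (dif K)⁻¹) : Idl K).1)
    (hc : c ∈ (Q * (I l ^ 2 * J * (dif K)⁻¹)⁻¹ : Idl K).1) (hd : d ∈ (Q⁻¹ : Idl K).1) :
    IsMap I (Function.update I l (Q⁻¹ * I l)) J (embSL l a b c d h) := by
  set I' := Function.update I l (Q⁻¹ * I l) with hI'
  have hl : I' l = Q⁻¹ * I l := Function.update_self ..
  have hne : ∀ i, i ≠ l → I' i = I i := fun i hi => Function.update_of_ne hi ..
  refine ⟨⟨1, fun φ => by simp, ?_⟩, ?_⟩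
  · simp only [embSL, Units.val_one, map_one, one_smul]
    rw [Matrix.diagonal_transpose, Matrix.diagonal_transpose, Matrix.diagonal_mul_diagonal,
      Matrix.diagonal_mul_diagonal, Matrix.diagonal_sub, ← Matrix.diagonal_one]
    congr 1
    ext i
    by_cases hi : i = l
    · subst hi
      simpa using h
    · simp [hi]
  rintro (i | i) (j | j)
  · refine diagonal_apply_mem (fun i j => wt I J (Sum.inl i) * (wt I' J (Sum.inl j))⁻¹)
      (fun i => ?_) i j
    by_cases hi : i = l
    · subst hi
      rw [Function.update_self]
      convert ha using 2
      simp only [wt, Sum.elim_inl, hl]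
      exact Additive.ofMul.injective (by simp only [ofMul_mul, ofMul_inv]; abel)
    · simp only [Function.update_of_ne hi, wt, Sum.elim_inl, hne i hi, Pi.one_apply]
      exact one_mem_mul_inv _
  · refine diagonal_apply_mem (fun i j => wt I J (Sum.inl i) * (wt I' J (Sum.inr j))⁻¹)
      (fun i => ?_) i j
    by_cases hi : i = l
    · subst hi
      rw [Pi.single_eq_same]
      convert hb using 2
      simp only [wt, Sum.elim_inl, Sum.elim_inr, hl, pow_two]
      exact Additive.ofMul.injective (by simp only [ofMul_mul, ofMul_inv]; abel)
    · rw [Pi.single_eq_of_ne hi]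
      exact zero_mem_idl _
  · refine diagonal_apply_mem (fun i j => wt I J (Sum.inr i) * (wt I' J (Sum.inl j))⁻¹)
      (fun i => ?_) i j
    by_cases hi : i = l
    · subst hi
      rw [Pi.single_eq_same]
      convert hc using 2
      simp only [wt, Sum.elim_inl, Sum.elim_inr, hl, pow_two]
      exact Additive.ofMul.injective (by simp only [ofMul_mul, ofMul_inv]; abel)
    · rw [Pi.single_eq_of_ne hi]
      exact zero_mem_idl _
  · refine diagonal_apply_mem (fun i j => wt I J (Sum.inr i) * (wt I' J (Sum.inr j))⁻¹)
      (fun i => ?_) i j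
    by_cases hi : i = l
    · subst hi
      rw [Function.update_self]
      convert hd using 2
      simp only [wt, Sum.elim_inr, hl]
      exact Additive.ofMul.injective (by simp only [ofMul_mul, ofMul_inv]; abel)
    · simp only [Function.update_of_ne hi, wt, Sum.elim_inr, hne i hi, Pi.one_apply]
      exact one_mem_mul_inv _

end Maps

/-! ### Connecting the indices of a given class -/

section Connect

variable {n : ℕ} {K : Type*} [Field K] [NumberField K]

theorem prod_update_eq {G : Type*} [CommGroup G] (f : Fin n → G) (l : Fin n) (b : G) :
    ∏ i, Function.update f l b i = b * (f l)⁻¹ * ∏ i, f i := by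
  have : Function.update f l b = Pi.mulSingle l (b * (f l)⁻¹) * f := by
    ext i
    by_cases hi : i = l
    · subst hi
      simp
    · simp [hi]
  rw [this]
  simp only [Pi.mul_apply, Finset.prod_mul_distrib, Fintype.prod_pi_mulSingle']

theorem mk_principal (α : Kˣ) : ClassGroup.mk K (principal α) = (1 : ClassGroup (𝓞 K)) := by
  rw [ClassGroup.mk_eq_one_iff, FractionalIdeal.isPrincipal_iff]
  exact ⟨α, coe_toPrincipalIdeal α⟩

theorem exists_principal_mul_eq {A B : Idl K}
    (h : (ClassGroup.mk K A : ClassGroup (𝓞 K)) = ClassGroup.mk K B) :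
    ∃ α : Kˣ, principal α * A = B := by
  have h1 : ClassGroup.mk K (B * A⁻¹) = (1 : ClassGroup (𝓞 K)) := by
    rw [map_mul, map_inv, h, mul_inv_cancel]
  rw [ClassGroup.mk_eq_one_iff, FractionalIdeal.isPrincipal_iff] at h1
  obtain ⟨x, hx⟩ := h1
  have hx0 : x ≠ 0 := by
    rintro rfl
    rw [FractionalIdeal.spanSingleton_zero] at hx
    exact (B * A⁻¹).ne_zero hx
  refine ⟨Units.mk0 x hx0, ?_⟩
  rw [← eq_mul_inv_iff_mul_eq]
  apply Units.ext
  rw [coe_toPrincipalIdeal, hx, Units.val_mk0]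

theorem mk_surjective (c : ClassGroup (𝓞 K)) : ∃ Q : Idl K, ClassGroup.mk K Q = c :=
  ClassGroup.induction K (P := fun c => ∃ Q : Idl K, ClassGroup.mk K Q = c)
    (fun I => ⟨I, rfl⟩) c

variable {k : ℤ} {𝒥 : Set (Idl K)} {F : (Fin n → Idl K) × 𝒥 → HalfSpaceProd n K → ℂ}

/-- Some similitude from the index `(I;J)` to the index `(I';J)` takes the component of the family
`F` at the first one to the component at the second one. -/
def Reach (k : ℤ) (F : (Fin n → Idl K) × 𝒥 → HalfSpaceProd n K → ℂ) (J : 𝒥)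
    (I I' : Fin n → Idl K) : Prop :=
  ∃ h, IsMap I I' J h ∧ slash k (F (I, J)) h = F (I', J)

theorem Reach.trans {J : 𝒥} {I I' I'' : Fin n → Idl K} (h : Reach k F J I I')
    (h' : Reach k F J I' I'') : Reach k F J I I'' := by
  obtain ⟨g, hg, e⟩ := h
  obtain ⟨g', hg', e'⟩ := h'
  exact ⟨comp g g', hg.comp hg', by rw [← slash_comp, e, e']⟩

theorem slash_levi_one (f : HalfSpaceProd n K → ℂ) : slash k f (levi 1) = f := by
  funext τ
  have hd : ∀ φ, denom (levi (1 : GL (Fin n) K)) φ (τ φ) = 1 := fun φ => by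
    simp [denom, levi, emb_zero, emb_one]
  have hm : moebius (levi (1 : GL (Fin n) K)) τ = τ := by
    funext φ
    apply Subtype.ext
    change num _ φ (τ φ) * (denom _ φ (τ φ))⁻¹ = (τ φ).1
    rw [hd]
    simp [num, levi, emb_zero, emb_one]
  simp only [slash, hd, hm]
  simp [levi]

theorem reach_refl (J : 𝒥) (I : Fin n → Idl K) : Reach k F J I I :=
  ⟨levi 1, isMap_one I J, slash_levi_one _⟩

theorem reach_U (hF : F ∈ productSpace k 𝒥) (J : 𝒥) (I : Fin n → Idl K) (l : Fin n) (α : Kˣ) :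
    Reach k F J I (Function.update I l (principal α * I l)) := by
  have hmul : Matrix.diagonal (Function.update (1 : Fin n → K) l (α⁻¹ : Kˣ).1) *
      Matrix.diagonal (Function.update 1 l α.1) = 1 := by
    rw [Matrix.diagonal_mul_diagonal, ← Matrix.diagonal_one]
    congr 1
    ext i
    by_cases hi : i = l
    · subst hi
      simp
    · simp [hi]
  let X : GL (Fin n) K := ⟨_, _, hmul, mul_eq_one_comm.mp hmul⟩
  exact ⟨levi X, isMap_U I J l α X rfl,
    (hF.2 (I, J) (_, J) _ (Ident.U I J.1 l α X rfl)).symm⟩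

theorem reach_V (hF : F ∈ productSpace k 𝒥) (J : 𝒥) (I : Fin n → Idl K) (l m : Fin n)
    (hlm : m.1 = l.1 + 1) (Q : Idl K) :
    Reach k F J I (Function.update (Function.update I l (Q * I l)) m (Q⁻¹ * I m)) := by
  have hne : l ≠ m := fun h => by simp [h] at hlm
  obtain ⟨a, b, c, d, h, ha, hb, hc, hd⟩ := exists_det_one Q⁻¹ (I l * (I m)⁻¹)
  have hdet : (!![a, b; c, d] : Matrix (Fin 2) (Fin 2) K).det = 1 := by
    rw [Matrix.det_fin_two_of, h]
  have hmul : blk l m !![a, b; c, d] * blk l m (Matrix.adjugate !![a, b; c, d]) = 1 := by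
    rw [blk_mul hne, Matrix.mul_adjugate, hdet, one_smul, blk_one]
  let X : GL (Fin n) K := ⟨_, _, hmul, mul_eq_one_comm.mp hmul⟩
  have hXdet : X.1.det = 1 := (det_blk hne _).trans hdet
  have hXne : ∀ i j, ¬((i = l ∨ i = m) ∧ (j = l ∨ j = m)) →
      X.1 i j = (1 : Matrix (Fin n) (Fin n) K) i j := fun i j h => blk_apply_of_not _ h
  have h₁₁ : X.1 l l ∈ (Q⁻¹ : Idl K).1 := by
    have : X.1 l l = a := blk_apply_eq hne !![a, b; c, d] 0 0
    rwa [this]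
  have h₁₂ : X.1 l m ∈ (Q * I l * (I m)⁻¹ : Idl K).1 := by
    have : X.1 l m = b := blk_apply_eq hne !![a, b; c, d] 0 1
    rwa [this, mul_assoc, ← inv_inv Q]
  have h₂₁ : X.1 m l ∈ (Q⁻¹ * (I l)⁻¹ * I m : Idl K).1 := by
    have : X.1 m l = c := blk_apply_eq hne !![a, b; c, d] 1 0
    rw [mul_inv, inv_inv, ← mul_assoc] at hc
    rwa [this]
  have h₂₂ : X.1 m m ∈ Q.1 := by
    have : X.1 m m = d := blk_apply_eq hne !![a, b; c, d] 1 1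
    rw [inv_inv] at hd
    rwa [this]
  exact ⟨levi X, isMap_V I J hne Q X hXdet hXne h₁₁ h₁₂ h₂₁ h₂₂,
    (hF.2 (I, J) (_, J) _ (Ident.V I J.1 l m hlm Q X hXdet hXne h₁₁ h₁₂ h₂₁ h₂₂)).symm⟩

theorem prod_update_V (I : Fin n → Idl K) {l m : Fin n} (hne : l ≠ m) (Q : Idl K) :
    ∏ i, Function.update (Function.update I l (Q * I l)) m (Q⁻¹ * I m) i = ∏ i, I i := by
  rw [prod_update_eq, prod_update_eq, Function.update_of_ne hne.symm]
  simp

/-- The entries of an index can be moved, one after the other, to prescribed values by means of the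
maps `V_ℓ(Q)`, except for the last entry; the product of the entries does not change. -/
theorem exists_reach_eq_of_lt (hF : F ∈ productSpace k 𝒥) (J : 𝒥) (I I' : Fin n → Idl K) (j : ℕ)
    (hj : j + 1 ≤ n) :
    ∃ I'', Reach k F J I I'' ∧ (∀ i : Fin n, i.1 < j → I'' i = I' i) ∧
      ∏ i, I'' i = ∏ i, I i := by
  induction j with
  | zero => exact ⟨I, reach_refl J I, fun i hi => absurd hi (Nat.not_lt_zero _), rfl⟩
  | succ j ih =>
    obtain ⟨I₁, h1, h2, h3⟩ := ih (by omega)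
    let l : Fin n := ⟨j, by omega⟩
    let m : Fin n := ⟨j + 1, by omega⟩
    have hne : l ≠ m := fun h => by simpa [l, m] using congrArg Fin.val h
    refine ⟨_, h1.trans (reach_V hF J I₁ l m rfl (I' l * (I₁ l)⁻¹)), fun i hi => ?_, ?_⟩
    · have him : i ≠ m := fun h => by
        rw [h] at hi
        exact lt_irrefl _ hi
      rw [Function.update_of_ne him]
      by_cases hil : i = l
      · rw [hil, Function.update_self, inv_mul_cancel_right]
      · rw [Function.update_of_ne hil]
        refine h2 i (lt_of_le_of_ne (Nat.lt_succ_iff.mp hi) fun h => hil (Fin.ext h))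
    · rw [prod_update_V I₁ hne, h3]

/-- Indices with the same class of `I₁ ⋯ Iₙ` are connected: by maps `V_ℓ(Q)` all entries but the
last are made equal, without changing the product, and the last ones then differ by a principal
ideal. -/
theorem reach_of_mk_eq (hn : 1 < n) (hF : F ∈ productSpace k 𝒥) (J : 𝒥) {I I' : Fin n → Idl K}
    (h : (ClassGroup.mk K (∏ i, I i) : ClassGroup (𝓞 K)) = ClassGroup.mk K (∏ i, I' i)) :
    Reach k F J I I' := by
  obtain ⟨I₁, h1, h2, h3⟩ := exists_reach_eq_of_lt hF J I I' (n - 1) (by omega)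
  let l : Fin n := ⟨n - 1, by omega⟩
  have hI' : I' = Function.update I₁ l (I' l) := by
    funext i
    by_cases hi : i = l
    · rw [hi, Function.update_self]
    · rw [Function.update_of_ne hi, h2 i]
      have : i.1 ≠ n - 1 := fun h => hi (Fin.ext h)
      omega
  obtain ⟨α, hα⟩ := exists_principal_mul_eq h
  have hp : ∏ i, I' i = I' l * (I₁ l)⁻¹ * ∏ i, I₁ i := by
    conv_lhs => rw [hI']
    exact prod_update_eq _ _ _
  rw [hp, h3] at hα
  have h4 : principal α * I₁ l = I' l := by
    rw [mul_right_cancel hα, inv_mul_cancel_right]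
  have h5 := h1.trans (reach_U hF J I₁ l α)
  rwa [h4, ← hI'] at h5

/-- A member of the product space is compatible with all similitudes between indices with the same
ideal class of `I₁ ⋯ Iₙ`, and not only with the matrices that define the identifications. -/
theorem slash_eq_of_mk_eq (hn : 1 < n) (hF : F ∈ productSpace k 𝒥) (J : 𝒥)
    {I I' : Fin n → Idl K}
    (h : (ClassGroup.mk K (∏ i, I i) : ClassGroup (𝓞 K)) = ClassGroup.mk K (∏ i, I' i))
    {g : Similitude n K} (hg : IsMap I I' J g) : slash k (F (I, J)) g = F (I', J) := by
  obtain ⟨g₁, hg₁, e⟩ := reach_of_mk_eq hn hF J h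
  obtain ⟨g₂, hg₂, h12, h21⟩ := hg₁.exists_inverse
  have hγ := (isMap_self_iff I' J.1 _).mp (hg₂.comp hg)
  have e2 := (hF.1 (I', J)).2 _ hγ
  rw [← e, slash_comp, comp_eq_of_mul_eq_one h12] at e2
  rw [e2, e]

end Connect

/-! ### The action of the ideal class group -/

section ClassOp

variable {n : ℕ} {K : Type*} [Field K]

/-- The conjugate `w⁻¹gw` of a similitude `g`, where `w = diag(α⁻¹I, I)` is the matrix of `W(α)`. -/
def conjScaling (α : Kˣ) (g : Similitude n K) : Similitude n K where
  A := g.A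
  B := α.1 • g.B
  C := (α⁻¹ : Kˣ).1 • g.C
  D := g.D
  symm_AB := by
    rw [Matrix.transpose_smul, Matrix.mul_smul]
    exact g.symm_AB.smul _
  symm_CD := by
    rw [Matrix.smul_mul]
    exact g.symm_CD.smul _
  exists_mult := by
    obtain ⟨u, hu0, hu⟩ := g.exists_mult
    refine ⟨u, hu0, ?_⟩
    rw [Matrix.transpose_smul, Matrix.smul_mul, Matrix.mul_smul, smul_smul, Units.mul_inv, one_smul,
      hu]

theorem comp_scaling (α : Kˣ) (hα : TotPos (α : K)) (g : Similitude n K) :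
    comp (scaling α hα) (conjScaling α g) = comp g (scaling α hα) := by
  apply Similitude.ext <;> simp [comp, scaling, conjScaling, smul_smul]

variable [NumberField K]

theorem IsMap.conjScaling {I I' : Fin n → Idl K} {J : Idl K} {g : Similitude n K}
    (hg : IsMap I I' J g) (α : Kˣ) :
    IsMap I I' (principal α * J) (conjScaling α g) := by
  obtain ⟨⟨u, hu0, hu⟩, hm⟩ := hg
  refine ⟨⟨u, hu0, ?_⟩, ?_⟩
  · rw [← hu]
    simp [HilbertSiegel.conjScaling, smul_smul]
  have hw : ∀ (I : Fin n → Idl K) i, wt I (principal α * J) (Sum.inr i) =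
      (principal α)⁻¹ * wt I J (Sum.inr i) := fun I i => by
    simp only [wt, Sum.elim_inr]
    exact Additive.ofMul.injective (by simp only [ofMul_mul, ofMul_inv]; abel)
  have hl : ∀ (I : Fin n → Idl K) i, wt I (principal α * J) (Sum.inl i) = wt I J (Sum.inl i) :=
    fun I i => rfl
  rintro (i | i) (j | j)
  · exact hm (Sum.inl i) (Sum.inl j)
  · rw [hw, hl, mul_inv, inv_inv, mul_left_comm, Units.val_mul]
    exact FractionalIdeal.mul_mem_mul (mem_principal α) (hm (Sum.inl i) (Sum.inr j))
  · rw [hw, hl, mul_assoc, Units.val_mul, ← map_inv]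
    exact FractionalIdeal.mul_mem_mul (mem_principal α⁻¹) (hm (Sum.inr i) (Sum.inl j))
  · rw [hw, hw, mul_inv, inv_inv, mul_mul_mul_comm, inv_mul_cancel, one_mul]
    exact hm (Sum.inr i) (Sum.inr j)

theorem upper_ideal_eq (P Q J : Idl K) : (Q⁻¹ * P * J : Idl K).1 * (different K)⁻¹ =
    (Q⁻¹ * (P * J * (dif K)⁻¹) : Idl K).1 := by
  rw [show Q⁻¹ * (P * J * (dif K)⁻¹) = Q⁻¹ * P * J * (dif K)⁻¹ by simp only [mul_assoc],
    Units.val_mul (Q⁻¹ * P * J), Units.val_inv_eq_inv_val]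
  rfl

theorem lower_ideal_eq (P Q J : Idl K) : (Q * P⁻¹ * J⁻¹ : Idl K).1 * different K =
    (Q * (P * J * (dif K)⁻¹)⁻¹ : Idl K).1 := by
  rw [show Q * (P * J * (dif K)⁻¹)⁻¹ = Q * P⁻¹ * J⁻¹ * dif K by
    simp only [mul_assoc, mul_inv, inv_inv], Units.val_mul (Q * P⁻¹ * J⁻¹)]
  rfl

/-- Every index is the target of a map `S_ℓ(Q)`. -/
theorem exists_embSL (l : Fin n) (I' : Fin n → Idl K) (J Q : Idl K) :
    ∃ I : Fin n → Idl K, Function.update I l (Q⁻¹ * I l) = I' ∧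
      ∃ (a b c d : K) (_ : a * d - b * c = 1), a ∈ Q.1 ∧
      b ∈ (Q⁻¹ * (I l ^ 2 * J * (dif K)⁻¹) : Idl K).1 ∧
      c ∈ (Q * (I l ^ 2 * J * (dif K)⁻¹)⁻¹ : Idl K).1 ∧ d ∈ (Q⁻¹ : Idl K).1 := by
  refine ⟨Function.update I' l (Q * I' l), by simp, ?_⟩
  obtain ⟨a, b, c, d, h, ha, hb, hc, hd⟩ := exists_det_one Q
    (Function.update I' l (Q * I' l) l ^ 2 * J * (dif K)⁻¹)
  exact ⟨a, b, c, d, h, ha, hb, hc, hd⟩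

/-- The map `S_ℓ(Q)` divides the class of `I₁ ⋯ Iₙ` by the class of `Q`. -/
theorem mk_prod_update (I : Fin n → Idl K) (l : Fin n) (Q : Idl K) :
    (ClassGroup.mk K (∏ i, I i) : ClassGroup (𝓞 K)) =
      ClassGroup.mk K Q * ClassGroup.mk K (∏ i, Function.update I l (Q⁻¹ * I l) i) := by
  rw [prod_update_eq, mul_inv_cancel_right, map_mul, map_inv, mul_inv_cancel_left]

theorem exists_isMap_of_class (hn : 1 < n) (c : ClassGroup (𝓞 K)) (I' : Fin n → Idl K)
    (J : Idl K) : ∃ p : (Fin n → Idl K) × Similitude n K, IsMap p.1 I' J p.2 ∧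
      (ClassGroup.mk K (∏ i, p.1 i) : ClassGroup (𝓞 K)) =
        c * ClassGroup.mk K (∏ i, I' i) := by
  obtain ⟨Q, rfl⟩ := mk_surjective c
  obtain ⟨I, rfl, a, b, c, d, h, ha, hb, hc, hd⟩ := exists_embSL ⟨0, by omega⟩ I' J Q
  exact ⟨(I, _), isMap_S I J _ Q a b c d h ha hb hc hd, mk_prod_update I _ Q⟩

variable {k : ℤ} {𝒥 : Set (Idl K)} {F : (Fin n → Idl K) × 𝒥 → HalfSpaceProd n K → ℂ}

/-- The operator of an ideal class `c` on families of functions: the component at `(I';J)` is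
`f|g`, where `f` is the component of `F` at an index `(I;J)` such that the class of `∏ I` is `c`
times that of `∏ I'`, and `g` maps the lattice of `(I';J)` into that of `(I;J)`. On the product
space it does not depend on the choice of `I` and `g`. -/
def classFamily (hn : 1 < n) (k : ℤ) (c : ClassGroup (𝓞 K))
    (F : (Fin n → Idl K) × 𝒥 → HalfSpaceProd n K → ℂ) :
    (Fin n → Idl K) × 𝒥 → HalfSpaceProd n K → ℂ :=
  fun L => slash k (F ((exists_isMap_of_class hn c L.1 L.2.1).choose.1, L.2))
    (exists_isMap_of_class hn c L.1 L.2.1).choose.2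

theorem classFamily_eq (hn : 1 < n) (hF : F ∈ productSpace k 𝒥) (c : ClassGroup (𝓞 K)) (J : 𝒥)
    {I I' : Fin n → Idl K} {g : Similitude n K} (hg : IsMap I I' J g)
    (h : (ClassGroup.mk K (∏ i, I i) : ClassGroup (𝓞 K)) = c * ClassGroup.mk K (∏ i, I' i)) :
    classFamily hn k c F (I', J) = slash k (F (I, J)) g := by
  obtain ⟨h1, h2⟩ := (exists_isMap_of_class hn c I' J.1).choose_spec
  rw [classFamily]
  set p := (exists_isMap_of_class hn c I' J.1).choose
  obtain ⟨g', hg', e1, e2⟩ := h1.exists_inverse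
  rw [← slash_eq_of_mk_eq hn hF J (h.trans h2.symm) (hg.comp hg'), slash_comp, comp_assoc]
  congr 1
  exact toMat_injective (by rw [toMat_comp, toMat_comp, e2, Matrix.mul_one])

theorem classFamily_isMap (hn : 1 < n) (hF : F ∈ productSpace k 𝒥) (c : ClassGroup (𝓞 K))
    (J : 𝒥) {I I' : Fin n → Idl K} {g : Similitude n K} (hg : IsMap I I' J g)
    (h : (ClassGroup.mk K (∏ i, I i) : ClassGroup (𝓞 K)) = ClassGroup.mk K (∏ i, I' i)) :
    classFamily hn k c F (I', J) = slash k (classFamily hn k c F (I, J)) g := by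
  obtain ⟨⟨I₀, g₀⟩, h1, h2⟩ := exists_isMap_of_class hn c I J.1
  rw [classFamily_eq hn hF c J h1 h2, slash_comp]
  exact classFamily_eq hn hF c J (h1.comp hg) (by rw [h2, h])

/-- The product space is stable under the operators of ideal classes. The expansion at infinity of
the components is a consequence of the Koecher principle. -/
theorem classFamily_mem [NumberField.IsTotallyReal K] (hn : 1 < n) (hF : F ∈ productSpace k 𝒥)
    (c : ClassGroup (𝓞 K)) : classFamily hn k c F ∈ productSpace k 𝒥 := by
  constructor
  · rintro ⟨I, J⟩
    have hinv : ∀ g ∈ Gam (I, J.1), slash k (classFamily hn k c F (I, J)) g =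
        classFamily hn k c F (I, J) := fun g hg =>
      (classFamily_isMap hn hF c J ((isMap_self_iff I J.1 g).mpr hg) rfl).symm
    refine ⟨hasFourierExpansion_of_holo hn k (I, J.1) (Holo.slash ?_ k _) hinv, hinv⟩
    exact (hF.1 _).1.holo
  · rintro ⟨I, J, hJ⟩ ⟨I', J', hJ'⟩ g hg
    simp only at hg
    cases hg with
    | U _ _ l α X hX =>
      refine classFamily_isMap hn hF c ⟨J, hJ⟩ (isMap_U I J l α X hX) ?_
      rw [prod_update_eq, mul_inv_cancel_right, map_mul, mk_principal, one_mul]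
    | W _ _ α hα =>
      -- with `w` the matrix of `W(α)`, `f|g₀|w = (f|w)|w⁻¹g₀w`, and `F` is compatible with `w`
      obtain ⟨⟨I₀, g₀⟩, h1, h2⟩ := exists_isMap_of_class hn c I J
      rw [classFamily_eq hn hF c ⟨J, hJ⟩ h1 h2, slash_comp, ← comp_scaling, ← slash_comp,
        ← hF.2 (I₀, ⟨J, hJ⟩) (I₀, ⟨_, hJ'⟩) _ (Ident.W I₀ J α hα)]
      exact classFamily_eq hn hF c ⟨_, hJ'⟩ (h1.conjScaling α) h2
    | V _ _ l m hlm Q X hdet hX h₁₁ h₁₂ h₂₁ h₂₂ =>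
      have hne : l ≠ m := fun h => by simp [h] at hlm
      refine classFamily_isMap hn hF c ⟨J, hJ⟩
        (isMap_V I J hne Q X hdet hX h₁₁ h₁₂ h₂₁ h₂₂) ?_
      rw [prod_update_V I hne]

theorem slash_add (k : ℤ) (f f' : HalfSpaceProd n K → ℂ) (g : Similitude n K) :
    slash k (f + f') g = slash k f g + slash k f' g := by
  funext τ
  simp [slash, mul_add]

theorem slash_smul (k : ℤ) (r : ℂ) (f : HalfSpaceProd n K → ℂ) (g : Similitude n K) :
    slash k (r • f) g = r • slash k f g := by
  funext τ
  simp [slash, mul_left_comm]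

variable (𝒥) in
/-- The action of the ideal class group on the product space; the class of `Q` acts as `S(Q)`. -/
def classAction [NumberField.IsTotallyReal K] (hn : 1 < n) (k : ℤ) :
    ClassGroup (𝓞 K) →* Module.End ℂ (productSpace (n := n) k 𝒥) where
  toFun c :=
    { toFun := fun F => ⟨classFamily hn k c F.1, classFamily_mem hn F.2 c⟩
      map_add' := fun F G => Subtype.ext (funext fun L => slash_add k _ _ _)
      map_smul' := fun r F => Subtype.ext (funext fun L => slash_smul k _ _ _) }
  map_one' := by
    ext1 F
    refine Subtype.ext (funext fun L => ?_)
    have h := classFamily_eq hn F.2 1 L.2 (isMap_one L.1 L.2.1) (one_mul _).symm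
    rw [slash_levi_one] at h
    exact h
  map_mul' c c' := by
    ext1 F
    refine Subtype.ext (funext fun L => ?_)
    obtain ⟨⟨I₁, g₁⟩, h1, h2⟩ := exists_isMap_of_class hn c L.1 L.2.1
    obtain ⟨⟨I₂, g₂⟩, h3, h4⟩ := exists_isMap_of_class hn c' I₁ L.2.1
    have e1 := classFamily_eq hn (classFamily_mem hn F.2 c') c L.2 h1 h2
    rw [classFamily_eq hn F.2 c' L.2 h3 h4, slash_comp] at e1
    refine (classFamily_eq hn F.2 (c * c') L.2 (h3.comp h1) ?_).trans e1.symm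
    rw [h4, h2, mul_left_comm, mul_assoc]

/-- `F|S(Q)` is well-defined, and given by the operator of the class of `Q`. -/
theorem isImageS_iff (hn : 1 < n) (hF : F ∈ productSpace k 𝒥) (Q : Idl K)
    (G : (Fin n → Idl K) × 𝒥 → HalfSpaceProd n K → ℂ) :
    IsImageS k Q F G ↔ classFamily hn k (ClassGroup.mk K Q) F = G := by
  constructor
  · intro h
    funext ⟨I', J⟩
    obtain ⟨I, rfl, a, b, c, d, hdet, ha, hb, hc, hd⟩ := exists_embSL ⟨0, by omega⟩ I' J.1 Q
    rw [h _ I J a b c d hdet ha (by rwa [upper_ideal_eq]) (by rwa [lower_ideal_eq]) hd]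
    exact classFamily_eq hn hF _ J (isMap_S I J.1 _ Q a b c d hdet ha hb hc hd)
      (mk_prod_update I _ Q)
  · rintro rfl l I J a b c d h ha hb hc hd
    rw [upper_ideal_eq] at hb
    rw [lower_ideal_eq] at hc
    exact classFamily_eq hn hF _ J (isMap_S I J.1 l Q a b c d h ha hb hc hd)
      (mk_prod_update I l Q)

theorem mem_eigenspace_iff [NumberField.IsTotallyReal K] (hn : 1 < n)
    (χ : ClassGroup (𝓞 K) →* ℂˣ) (F : productSpace (n := n) k 𝒥) :
    F ∈ eigenspace n k 𝒥 χ ↔ ∀ c, classAction 𝒥 hn k c F = (χ c : ℂ) • F := by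
  constructor
  · intro h c
    obtain ⟨Q, rfl⟩ := mk_surjective c
    exact Subtype.ext ((isImageS_iff hn F.2 Q _).mp (h Q))
  · intro h Q
    exact (isImageS_iff hn F.2 Q _).mpr (congrArg Subtype.val (h (ClassGroup.mk K Q)))

end ClassOp

/-! ### Decomposition under a finite commutative group -/

section Characters

variable {G V : Type*} [CommGroup G] [Fintype G] [AddCommGroup V] [Module ℂ V]

theorem sum_character_apply (χ : G →* ℂˣ) [Decidable (χ = 1)] :
    ∑ g, (χ g : ℂ) = if χ = 1 then (Fintype.card G : ℂ) else 0 := by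
  split_ifs with h
  · simp [h]
  · refine sum_hom_units_eq_zero ((Units.coeHom ℂ).comp χ) fun h1 => h ?_
    ext g
    exact DFunLike.congr_fun h1 g

theorem sum_characters_apply [Fintype (G →* ℂˣ)] {g : G} (hg : g ≠ 1) :
    ∑ χ : G →* ℂˣ, (χ g : ℂ) = 0 := by
  obtain ⟨χ, hχ⟩ := CommGroup.exists_apply_ne_one_of_hasEnoughRootsOfUnity G ℂ hg
  refine sum_hom_units_eq_zero ((Units.coeHom ℂ).comp (MonoidHom.eval g)) fun h1 => hχ ?_
  ext
  exact DFunLike.congr_fun h1 χ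

/-- A complex representation of a finite commutative group is the direct sum of its isotypic
components for the characters of the group. -/
theorem isInternal_of_mem_iff [DecidableEq (G →* ℂˣ)] (ρ : G →* Module.End ℂ V)
    (E : (G →* ℂˣ) → Submodule ℂ V) (hE : ∀ χ v, v ∈ E χ ↔ ∀ g, ρ g v = (χ g : ℂ) • v) :
    DirectSum.IsInternal E := by
  have hcard : (Fintype.card G : ℂ) ≠ 0 := Nat.cast_ne_zero.mpr Fintype.card_ne_zero
  rw [DirectSum.isInternal_submodule_iff_iSupIndep_and_iSup_eq_top]
  constructor
  · rw [iSupIndep_iff_finsetSum_eq_zero_imp_eq_zero]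
    intro s v hv h0 χ hχ
    have key : ∑ g, ((χ⁻¹ g : ℂˣ) : ℂ) • ρ g (∑ ψ ∈ s, v ψ) = (Fintype.card G : ℂ) • v χ := by
      calc _ = ∑ g, ∑ ψ ∈ s, (((ψ * χ⁻¹) g : ℂˣ) : ℂ) • v ψ := by
            refine Finset.sum_congr rfl fun g _ => ?_
            rw [map_sum, Finset.smul_sum]
            refine Finset.sum_congr rfl fun ψ hψ => ?_
            rw [(hE ψ (v ψ)).mp (hv ψ hψ) g, smul_smul, MonoidHom.mul_apply, Units.val_mul,
              mul_comm]
        _ = ∑ ψ ∈ s, (if ψ * χ⁻¹ = 1 then (Fintype.card G : ℂ) else 0) • v ψ := by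
            rw [Finset.sum_comm]
            refine Finset.sum_congr rfl fun ψ _ => ?_
            rw [← Finset.sum_smul, sum_character_apply]
        _ = _ := by
            rw [Finset.sum_eq_single_of_mem χ hχ fun ψ _ hψ => by
              rw [if_neg (mul_inv_eq_one.not.mpr hψ), zero_smul], if_pos (mul_inv_cancel χ)]
    rw [h0] at key
    simp only [map_zero, smul_zero, Finset.sum_const_zero] at key
    exact (smul_eq_zero.mp key.symm).resolve_left hcard
  · rw [eq_top_iff]
    intro v _
    have := Fintype.ofFinite (G →* ℂˣ)
    have hmem : ∀ χ : G →* ℂˣ, ∑ g, ((χ⁻¹ g : ℂˣ) : ℂ) • ρ g v ∈ E χ := fun χ => by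
      refine (hE χ _).mpr fun h => ?_
      rw [map_sum, Finset.smul_sum]
      refine Fintype.sum_equiv (Equiv.mulLeft h) _ _ fun g => ?_
      have : (χ⁻¹ g : ℂˣ) = χ h * χ⁻¹ (h * g) := by simp
      rw [map_smul, ← Module.End.mul_apply, ← map_mul, Equiv.coe_mulLeft, smul_smul, this,
        Units.val_mul]
    have key : ∑ χ : G →* ℂˣ, ∑ g, ((χ⁻¹ g : ℂˣ) : ℂ) • ρ g v =
        (Fintype.card (G →* ℂˣ) : ℂ) • v := by
      rw [Finset.sum_comm, Finset.sum_eq_single 1]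
      · simp [Nat.cast_smul_eq_nsmul]
      · intro g _ hg
        have h0 := sum_characters_apply (G := G) (inv_ne_one.mpr hg)
        simp only [map_inv] at h0
        simp only [MonoidHom.inv_apply]
        rw [← Finset.sum_smul, h0, zero_smul]
      · simp
    have hcard' : (Fintype.card (G →* ℂˣ) : ℂ) ≠ 0 := Nat.cast_ne_zero.mpr Fintype.card_ne_zero
    have : v = (Fintype.card (G →* ℂˣ) : ℂ)⁻¹ •
        ∑ χ : G →* ℂˣ, ∑ g, ((χ⁻¹ g : ℂˣ) : ℂ) • ρ g v := by
      rw [key, smul_smul, inv_mul_cancel₀ hcard', one_smul]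
    rw [this]
    exact Submodule.smul_mem _ _ (Submodule.sum_mem _ fun χ _ =>
      Submodule.mem_iSup_of_mem χ (hmem χ))

end Characters

end HilbertSiegel

end

theorem proposition3p2 {K : Type*} [Field K] [NumberField K] [NumberField.IsTotallyReal K]
    [DecidableEq (ClassGroup (𝓞 K) →* ℂˣ)] (n : ℕ) (hn : 1 < n) (k : ℤ)
    (𝒥 : Set (HilbertSiegel.Idl K)) :
    DirectSum.IsInternal
      (fun χ : ClassGroup (𝓞 K) →* ℂˣ => HilbertSiegel.eigenspace n k 𝒥 χ) :=
  HilbertSiegel.isInternal_of_mem_iff (HilbertSiegel.classAction 𝒥 hn k) _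
    fun χ F => HilbertSiegel.mem_eigenspace_iff hn χ F
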